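/- **Theorem 3.6.** Let $0<d<\pi/2$, $\mathscr{D}_d=\{\zeta\in\mathbb{C}:|\operatorname{Im}\zeta|<d\}$, and $\psi(\zeta)=\log(1+e^{\pi\sinh\zeta})$, where $\log$ is taken as the branch that makes $\psi$ analytic in $\mathscr{D}_d$ and real on $\mathbb{R}$ (the function $1+e^{\pi\sinh\zeta}$ has no zeros in $\mathscr{D}_d$). Then $\psi$ maps $\mathbb{R}$ bijectively onto $(0,\infty)$, with inverse $\psi^{-1}(\tau)=\operatorname{arcsinh}(\pi^{-1}\log(e^{\tau}-1))$. Let $K>0$, $0<\alpha\le 1$ and $\beta>0$. Let $f$ be a complex-valued function that is analytic in $\psi(\mathscr{D}_d)$ and satisfies $$|f(z)|\le K\left|\left(\frac{z}{1+z}\right)^{\alpha-1}e^{-\beta z}\right|\qquad\text{for all } z\in\psi(\mathscr{D}_d)$$ (if $\alpha<1$ and $z=-1$, the right-hand side is read as $0$; if $\alpha=1$, the power is read as $1$). Let $\mu=\min\{\alpha,\beta\}$ and $\nu=\max\{\alpha,\beta\}$. For a positive integer $n$ put $h=\log(2dn/\mu)/n$ and $$M=n,\quad N=n-\lfloor\log(\beta/\alpha)/h\rfloor\quad(\text{if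 }\mu=\alpha),\qquad N=n,\quad M=n-\lfloor\log(\alpha/\beta)/h\rfloor\quad(\text{if }\mu=\beta).$$ For $\gamma>0$ let $$x_\gamma=\operatorname{arcsinh}\left(\frac{\sqrt{1+\sqrt{1-(2\pi\gamma)^2}}}{2\pi\gamma}\right)\ \text{ if } \gamma<\frac1{2\pi},\qquad x_\gamma=\operatorname{arcsinh}(1)\ \text{ if }\gamma\ge\frac1{2\pi},$$ and assume that $n$ is so large that $n\ge \nu e/(2d)$, $Mh\ge x_\alpha$ and $Nh\ge x_\beta$. Put $$J(k,h)(x)=h\left\{\frac12+\frac1\pi\operatorname{Si}[\pi(x/h-k)]\right\},\qquad \operatorname{Si}(x)=\int_0^x\frac{\sin\sigma}{\sigma}\,d\sigma .$$ Then $f$ is integrable on $(0,\tau)$ for every $\tau>0$, and $$\sup_{\tau\in(0,\infty)}\left|\int_0^\tau f(t)\,dt-\sum_{k=-M}^{N}f(\psi(kh))\,\psi'(kh)\,J(k,h)(\psi^{-1}(\tau))\right|\le C_{3\ddagger}\,\frac{\log(2dn/\mu)}{n}\,e^{-\pi dn/\log(2dn/\mu)},$$ where $C_{3\ddagger}$ does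 not depend on $n$: $$C_{3\ddagger}=\frac{2K}{\mu d}\left\{\frac{\tilde c_d^{\,1-\alpha}}{(1-e^{-\pi\mu e})\{\cos(\frac\pi2\sin d)\}^{\alpha+\beta}\cos d}+e^{\pi(1+5\alpha+6\beta)/12}\right\},$$ $$\tilde c_d=\frac{1+\log(1+c_d)}{\log(1+c_d)}\,c_d,\qquad c_d=1+\frac1{\cos(\frac\pi2\sin d)} .$$ -/

import Mathlib

noncomputable section

namespace SincDE

/-- The strip of complex numbers whose imaginary part is less than `d` in absolute value. -/
def strip (d : ℝ) : Set ℂ := {ζ : ℂ | |ζ.im| < d}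

/-- The analytic branch of `log (1 + exp w)` on the plane cut along the two half-lines
`{i t : |t| ≥ π}` that is real on the real axis. It is the principal value of `log (1 + exp w)`
in the left half-plane; in the right half-plane, where that principal value jumps, it is
`w + log (1 + exp (-w))`. -/
def softplus (w : ℂ) : ℂ :=
  if w.re < 0 then Complex.log (1 + Complex.exp w)
  else w + Complex.log (1 + Complex.exp (-w))

/-- The double-exponential map `log (1 + exp (π sinh ζ))` on the strip `|Im ζ| < π / 2`. -/
def psi (ζ : ℂ) : ℂ := softplus (Real.pi * Complex.sinh ζ)

/-- The double-exponential map on the real line, `x ↦ log (1 + exp (π sinh x))`. -/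
def psiReal (x : ℝ) : ℝ := Real.log (1 + Real.exp (Real.pi * Real.sinh x))

/-- The inverse of `psiReal`, from `(0, ∞)` to `ℝ`. -/
def psiInv (τ : ℝ) : ℝ := Real.arsinh (Real.log (Real.exp τ - 1) / Real.pi)

/-- The comparison function `(z / (1 + z)) ^ (α - 1) * exp (-β z)`; only its norm, which does not
depend on the branch of the power, is used. For `α < 1` its value at `z = -1` is the limit `0`. -/
def E3 (α β : ℝ) (z : ℂ) : ℂ :=
  (z / (1 + z)) ^ ((α : ℂ) - 1) * Complex.exp (-(β : ℂ) * z)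

/-- The sine integral. -/
def Si (x : ℝ) : ℝ := ∫ σ in (0 : ℝ)..x, Real.sinc σ

/-- The basis functions `J(k,h)` of the Sinc indefinite integration. -/
def J (k : ℤ) (h x : ℝ) : ℝ := h * (1 / 2 + 1 / Real.pi * Si (Real.pi * (x / h - k)))

/-- The threshold `x_γ` for `γ > 0`. -/
def xThreshold (γ : ℝ) : ℝ :=
  if γ < 1 / (2 * Real.pi) then
    Real.arsinh (√(1 + √(1 - (2 * Real.pi * γ) ^ 2)) / (2 * Real.pi * γ))
  else Real.arsinh 1

/-- The lower truncation number `M` (an integer). -/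
def lowerM (α β h : ℝ) (n : ℕ) : ℤ :=
  if α ≤ β then (n : ℤ) else (n : ℤ) - ⌊Real.log (α / β) / h⌋

/-- The upper truncation number `N` (an integer). -/
def upperN (α β h : ℝ) (n : ℕ) : ℤ :=
  if α ≤ β then (n : ℤ) - ⌊Real.log (β / α) / h⌋ else (n : ℤ)

/-- The rate `exp (-π d n / log (4 d n / μ)) * log (4 d n / μ) / n`. -/
def epsDE (d μ : ℝ) (n : ℕ) : ℝ :=
  Real.exp (-(Real.pi * d * n) / Real.log (4 * d * n / μ)) * Real.log (4 * d * n / μ) / n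

/-- The constant `c_d`. -/
def cD (d : ℝ) : ℝ := 1 + 1 / Real.cos (Real.pi / 2 * Real.sin d)

/-- The constant `c̃_d`. -/
def cTilde (d : ℝ) : ℝ := (1 + Real.log (1 + cD d)) / Real.log (1 + cD d) * cD d

/-- The explicit constant of the error bound, where `μ = min α β`. -/
def errConst (d K α β : ℝ) : ℝ :=
  2 * K / (min α β * d) *
    (cTilde d ^ (1 - α) /
        ((1 - Real.exp (-(Real.pi * min α β * Real.exp 1))) *
          Real.cos (Real.pi / 2 * Real.sin d) ^ (α + β) * Real.cos d) +
      Real.exp (Real.pi * (1 + 5 * α + 6 * β) / 12))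

/-! Checks that the branch is the intended one and that the inverse is the inverse. -/

theorem one_add_exp_mem_slitPlane {w : ℂ} (h : w.re < 0 ∨ |w.im| < Real.pi) :
    1 + Complex.exp w ∈ Complex.slitPlane := by
  rw [Complex.mem_slitPlane_iff]
  rcases h with h | h
  · left
    have h1 : |(Complex.exp w).re| ≤ ‖Complex.exp w‖ := Complex.abs_re_le_norm _
    rw [Complex.norm_exp] at h1
    have h2 : Real.exp w.re < 1 := by simpa using h
    have := (abs_le.1 h1).1
    simp only [Complex.add_re, Complex.one_re]
    linarith
  · by_cases h0 : w.im = 0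
    · left
      simp only [Complex.add_re, Complex.one_re, Complex.exp_re, h0, Real.cos_zero, mul_one]
      positivity
    · right
      simp only [Complex.add_im, Complex.one_im, Complex.exp_im, zero_add]
      obtain ⟨h1, h2⟩ := abs_lt.1 h
      have : Real.sin w.im ≠ 0 := by
        rcases lt_or_gt_of_ne h0 with h3 | h3
        · exact (Real.sin_neg_of_neg_of_neg_pi_lt h3 h1).ne
        · exact (Real.sin_pos_of_pos_of_lt_pi h3 h2).ne'
      exact mul_ne_zero (Real.exp_pos _).ne' this

theorem softplus_branches_agree {w : ℂ} (h : |w.im| < Real.pi) :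
    Complex.log (1 + Complex.exp w) = w + Complex.log (1 + Complex.exp (-w)) := by
  have hs := one_add_exp_mem_slitPlane (w := w) (Or.inr h)
  have hs' := one_add_exp_mem_slitPlane (w := -w) (Or.inr (by simpa using h))
  have hw : w + Complex.log (1 + Complex.exp (-w))
      = Complex.log (1 + Complex.exp w) ↔ True := by
    simp only [iff_true]
    have e : Complex.exp (w + Complex.log (1 + Complex.exp (-w)))
        = 1 + Complex.exp w := by
      rw [Complex.exp_add, Complex.exp_log (Complex.slitPlane_ne_zero hs'), mul_add,
        ← Complex.exp_add]
      simp [add_comm]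
    rw [← e]
    symm
    have key : -Real.pi < w.im + (1 + Complex.exp (-w)).arg ∧
        w.im + (1 + Complex.exp (-w)).arg ≤ Real.pi := by
      obtain ⟨h1, h2⟩ := abs_lt.1 h
      have im' : (1 + Complex.exp (-w)).im = -(Real.exp (-w.re) * Real.sin w.im) := by
        simp [Complex.exp_im]
      have ha := Complex.neg_pi_lt_arg (1 + Complex.exp (-w))
      have hb := Complex.arg_le_pi (1 + Complex.exp (-w))
      rcases lt_trichotomy w.im 0 with h0 | h0 | h0
      · have : 0 ≤ (1 + Complex.exp (-w)).arg := by
          rw [Complex.arg_nonneg_iff, im']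
          have := Real.sin_neg_of_neg_of_neg_pi_lt h0 h1
          have := Real.exp_pos (-w.re)
          nlinarith
        constructor <;> linarith
      · constructor <;> linarith
      · have : (1 + Complex.exp (-w)).arg < 0 := by
          rw [Complex.arg_neg_iff, im']
          have := Real.sin_pos_of_pos_of_lt_pi h0 h2
          have := Real.exp_pos (-w.re)
          nlinarith
        constructor <;> linarith
    apply Complex.log_exp
    · simpa [Complex.log_im] using key.1
    · simpa [Complex.log_im] using key.2
  exact (hw.2 trivial).symm

/-- `softplus` is a logarithm of `1 + exp w`. -/
theorem exp_softplus {w : ℂ} (h : w.re ≠ 0 ∨ |w.im| < Real.pi) :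
    Complex.exp (softplus w) = 1 + Complex.exp w := by
  unfold softplus
  split_ifs with h0
  · exact Complex.exp_log (Complex.slitPlane_ne_zero (one_add_exp_mem_slitPlane (Or.inl h0)))
  · have hs : 1 + Complex.exp (-w) ∈ Complex.slitPlane := by
      apply one_add_exp_mem_slitPlane
      rcases h with h | h
      · left
        simpa using lt_of_le_of_ne (not_lt.1 h0) h.symm
      · right
        simpa using h
    rw [Complex.exp_add, Complex.exp_log (Complex.slitPlane_ne_zero hs), mul_add,
      ← Complex.exp_add]
    simp [add_comm]

/-- `softplus` is holomorphic off the two cuts. -/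
theorem differentiableAt_softplus {w : ℂ} (h : w.re ≠ 0 ∨ |w.im| < Real.pi) :
    DifferentiableAt ℂ softplus w := by
  have hA : ∀ {z : ℂ}, (z.re < 0 ∨ |z.im| < Real.pi) →
      DifferentiableAt ℂ (fun z => Complex.log (1 + Complex.exp z)) z := fun hz =>
    DifferentiableAt.clog (by fun_prop) (one_add_exp_mem_slitPlane hz)
  have hB : ∀ {z : ℂ}, 0 < z.re →
      DifferentiableAt ℂ (fun z => z + Complex.log (1 + Complex.exp (-z))) z := fun hz =>
    differentiableAt_id.add
      (DifferentiableAt.clog (by fun_prop) (one_add_exp_mem_slitPlane (Or.inl (by simpa using hz))))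
  by_cases hi : |w.im| < Real.pi
  · refine (hA (Or.inr hi)).congr_of_eventuallyEq ?_
    have ho : IsOpen {z : ℂ | |z.im| < Real.pi} :=
      isOpen_lt (Complex.continuous_im.abs) continuous_const
    filter_upwards [ho.mem_nhds hi] with z hz
    unfold softplus
    split_ifs
    · rfl
    · exact (softplus_branches_agree hz).symm
  · rcases lt_or_gt_of_ne (h.resolve_right hi) with hr | hr
    · refine (hA (Or.inl hr)).congr_of_eventuallyEq ?_
      filter_upwards [(isOpen_lt Complex.continuous_re continuous_const).mem_nhds hr] with z hz
      have hz' : z.re < 0 := hz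
      simp [softplus, hz']
    · refine (hB hr).congr_of_eventuallyEq ?_
      filter_upwards [(isOpen_lt continuous_const Complex.continuous_re).mem_nhds hr] with z hz
      have hz' : ¬ z.re < 0 := not_lt.2 (le_of_lt hz)
      simp [softplus, hz']

theorem pi_sinh_avoids_cuts {ζ : ℂ} (h : ζ ∈ strip (Real.pi / 2)) :
    (Real.pi * Complex.sinh ζ).re ≠ 0 ∨ |(Real.pi * Complex.sinh ζ).im| < Real.pi := by
  have hz : |ζ.im| < Real.pi / 2 := h
  obtain ⟨h1, h2⟩ := abs_lt.1 hz
  have hc : 0 < Real.cos ζ.im := Real.cos_pos_of_mem_Ioo ⟨h1, h2⟩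
  have e : Complex.sinh ζ = (Real.sinh ζ.re * Real.cos ζ.im : ℝ)
      + (Real.cosh ζ.re * Real.sin ζ.im : ℝ) * Complex.I := by
    conv_lhs => rw [← Complex.re_add_im ζ, Complex.sinh_add, Complex.sinh_mul_I,
      Complex.cosh_mul_I]
    push_cast
    ring
  have er : (Complex.sinh ζ).re = Real.sinh ζ.re * Real.cos ζ.im := by
    rw [e]; simp [-Complex.ofReal_mul]
  have ei : (Complex.sinh ζ).im = Real.cosh ζ.re * Real.sin ζ.im := by
    rw [e]; simp [-Complex.ofReal_mul]
  rw [Complex.re_ofReal_mul, Complex.im_ofReal_mul, er, ei]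
  by_cases h0 : ζ.re = 0
  · right
    rw [h0, Real.cosh_zero, one_mul, abs_mul, abs_of_pos Real.pi_pos]
    have : |Real.sin ζ.im| < 1 := by
      rw [← sq_lt_one_iff_abs_lt_one]
      nlinarith [Real.sin_sq_add_cos_sq ζ.im]
    nlinarith [Real.pi_pos]
  · left
    have : Real.sinh ζ.re ≠ 0 := by simpa using h0
    exact mul_ne_zero Real.pi_pos.ne' (mul_ne_zero this hc.ne')

theorem exp_psi {ζ : ℂ} (h : ζ ∈ strip (Real.pi / 2)) :
    Complex.exp (psi ζ) = 1 + Complex.exp (Real.pi * Complex.sinh ζ) :=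
  exp_softplus (pi_sinh_avoids_cuts h)

theorem differentiableOn_psi : DifferentiableOn ℂ psi (strip (Real.pi / 2)) := fun ζ h =>
  ((differentiableAt_softplus (pi_sinh_avoids_cuts h)).comp ζ
    (by fun_prop : DifferentiableAt ℂ (fun ζ => Real.pi * Complex.sinh ζ) ζ)).differentiableWithinAt

theorem psi_ofReal (x : ℝ) : psi x = psiReal x := by
  have h : |((Real.pi : ℂ) * Complex.sinh x).im| < Real.pi := by
    rw [Complex.im_ofReal_mul, Complex.sinh_ofReal_im]
    simpa using Real.pi_pos
  have e : psi x = Complex.log (1 + Complex.exp (Real.pi * Complex.sinh x)) := by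
    unfold psi softplus
    split_ifs
    · rfl
    · exact (softplus_branches_agree h).symm
  rw [e, psiReal, Complex.ofReal_log (by positivity)]
  push_cast
  rfl

theorem psiReal_pos (x : ℝ) : 0 < psiReal x :=
  Real.log_pos (by linarith [Real.exp_pos (Real.pi * Real.sinh x)])

theorem psiInv_psiReal (x : ℝ) : psiInv (psiReal x) = x := by
  unfold psiInv psiReal
  rw [Real.exp_log (by positivity), add_sub_cancel_left, Real.log_exp,
    mul_div_cancel_left₀ _ Real.pi_pos.ne', Real.arsinh_sinh]

theorem psiReal_psiInv {τ : ℝ} (h : 0 < τ) : psiReal (psiInv τ) = τ := by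
  unfold psiInv psiReal
  have h1 : 0 < Real.exp τ - 1 := by linarith [Real.one_lt_exp_iff.2 h]
  rw [Real.sinh_arsinh, mul_div_cancel₀ _ Real.pi_pos.ne', Real.exp_log h1,
    add_sub_cancel, Real.log_exp]

end SincDE

end

/-! ### Contour integrals over rectangles. -/

namespace SincDE
open Complex MeasureTheory Filter Topology intervalIntegral

/-! The substitution `t = ψ(x)` turns `∫₀^τ f` into the integral over `(-∞, ψ⁻¹(τ)]` of `F = (f ∘ ψ)
ψ'` (`deF`), which is holomorphic for `|Im ζ| < d` and decays double exponentially. Since `J(k,h)`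
is the antiderivative, vanishing at `-∞`, of the `k`-th sinc function, the quadrature sum is the
integral of the Sinc interpolant of `F`, cut down to `-M ≤ k ≤ N`. The error is a discretization
error plus a truncation error.

Discretization: for `D < d`, residues write the interpolation error at `x` as a difference of
integrals of `F(z) sin(πx/h) / (sin(πz/h) (z - x))` over the lines `Im z = ∓D` (`sinc_error`). There
`1/|sin(πz/h)| ≤ 1/sinh(πD/h)`, the source of the rate `exp(-πD/h)`; integrating in `x` by parts
gains a factor `h` (`norm_integral_nodeSin_le`). What remains is the `L¹` norm of `F` on the two
lines. It is controlled by a lower bound of `|1 + exp(±π sinh ζ)|` by its value at the real part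
times `cos(π/2 sin D)` (`norm_one_add_exp_pi_sinh_ge`), and by a bound of `(1+z)/z · (1 - exp(-z))`
(`norm_one_add_div_mul_le`), in which the zero of the second factor cancels the singularity at `z =
0`. Finally `D → d`.

Truncation: on the real line `|F|` is at most a multiple of `cosh x exp(-πβ sinh x)`, and of the
same with `α` and `-x`. The tails are dominated by telescoping sums (`cosh_mul_exp_telescope`). As
`Mh ≥ log(2dn/α)` and `Nh ≥ log(2dn/β)`, both have size about `exp(-πdn)` (`exp_neg_sinh_le`); the
surplus over `exp(-πd/h)` pays for a factor of order `n` (`truncation_numeric`). -/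

/-- The contour integral of `f` over the boundary of the rectangle `[a, b] × [-D, D]`. -/
noncomputable def rectInt (f : ℂ → ℂ) (a b D : ℝ) : ℂ :=
  (∫ x in a..b, f (x - D * I)) - (∫ x in a..b, f (x + D * I)) +
    I * (∫ y in (-D)..D, f (b + y * I)) - I * ∫ y in (-D)..D, f (a + y * I)

theorem rectInt_eq_zero {f : ℂ → ℂ} {a b D : ℝ}
    (hf : DifferentiableOn ℂ f (Set.uIcc a b ×ℂ Set.uIcc (-D) D)) : rectInt f a b D = 0 := by
  have := Complex.integral_boundary_rect_eq_zero_of_differentiableOn f ⟨a, -D⟩ ⟨b, D⟩ (by simpa using hf)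
  simpa [rectInt, sub_eq_add_neg] using this

/-- Continuity is asked only on the boundary, so that integrands with a pole inside can be added. -/
theorem rectInt_add {f g : ℂ → ℂ} {a b D : ℝ} (hab : a ≤ b) (hD : 0 ≤ D)
    (hf : ContinuousOn f (Set.Icc a b ×ℂ Set.Icc (-D) D \ Set.Ioo a b ×ℂ Set.Ioo (-D) D))
    (hg : ContinuousOn g (Set.Icc a b ×ℂ Set.Icc (-D) D \ Set.Ioo a b ×ℂ Set.Ioo (-D) D)) :
    rectInt (fun z => f z + g z) a b D = rectInt f a b D + rectInt g a b D := by
  have hD' : -D ≤ D := by linarith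
  have key : ∀ k : ℂ → ℂ,
      ContinuousOn k (Set.Icc a b ×ℂ Set.Icc (-D) D \ Set.Ioo a b ×ℂ Set.Ioo (-D) D) →
      IntervalIntegrable (fun x : ℝ => k (x - D * I)) volume a b ∧
      IntervalIntegrable (fun x : ℝ => k (x + D * I)) volume a b ∧
      IntervalIntegrable (fun y : ℝ => k (b + y * I)) volume (-D) D ∧
      IntervalIntegrable (fun y : ℝ => k (a + y * I)) volume (-D) D := by
    intro k hk
    refine ⟨?_, ?_, ?_, ?_⟩ <;> refine ContinuousOn.intervalIntegrable (hk.comp (by fun_prop) ?_)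
    · intro x hx
      rw [Set.uIcc_of_le hab] at hx
      simp [mem_reProdIm, hx.1, hx.2, hD']
    · intro x hx
      rw [Set.uIcc_of_le hab] at hx
      simp [mem_reProdIm, hx.1, hx.2, hD']
    · intro x hx
      rw [Set.uIcc_of_le hD'] at hx
      simp [mem_reProdIm, hx.1, hx.2, hab]
    · intro x hx
      rw [Set.uIcc_of_le hD'] at hx
      simp [mem_reProdIm, hx.1, hx.2, hab]
  obtain ⟨f1, f2, f3, f4⟩ := key f hf
  obtain ⟨g1, g2, g3, g4⟩ := key g hg
  unfold rectInt
  rw [integral_add f1 g1, integral_add f2 g2, integral_add f3 g3, integral_add f4 g4]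
  ring

theorem rectInt_const_mul (c : ℂ) (f : ℂ → ℂ) (a b D : ℝ) :
    rectInt (fun z => c * f z) a b D = c * rectInt f a b D := by
  unfold rectInt
  simp only [intervalIntegral.integral_const_mul]
  ring

theorem rectInt_congr {f g : ℂ → ℂ} {a b D : ℝ} (hab : a ≤ b) (hD : 0 ≤ D)
    (h : ∀ z ∈ Set.Icc a b ×ℂ Set.Icc (-D) D \ Set.Ioo a b ×ℂ Set.Ioo (-D) D, f z = g z) :
    rectInt f a b D = rectInt g a b D := by
  have hD' : -D ≤ D := by linarith
  unfold rectInt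
  congr 1
  · congr 1
    · congr 1 <;> refine intervalIntegral.integral_congr fun x hx => h _ ?_ <;>
      · rw [Set.uIcc_of_le hab] at hx
        simp [mem_reProdIm, hx.1, hx.2, hD']
    · congr 1; refine intervalIntegral.integral_congr fun x hx => h _ ?_
      rw [Set.uIcc_of_le hD'] at hx
      simp [mem_reProdIm, hx.1, hx.2, hab]
  · congr 1; refine intervalIntegral.integral_congr fun x hx => h _ ?_
    rw [Set.uIcc_of_le hD'] at hx
    simp [mem_reProdIm, hx.1, hx.2, hab]

theorem ofReal_add_mul_I_ne_zero {a b : ℝ} (h : a ≠ 0 ∨ b ≠ 0) : (a : ℂ) + b * I ≠ 0 := by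
  intro h0
  have h1 := congrArg Complex.re h0
  have h2 := congrArg Complex.im h0
  simp at h1 h2
  tauto

theorem integral_inv_sub_inv {D : ℝ} (hD : D ≠ 0) (R : ℝ) :
    (∫ u in (-R)..R, (1 / ((u : ℂ) - D * I) - 1 / ((u : ℂ) + D * I))) =
      4 * Real.arctan (R / D) * I := by
  have : ∀ u : ℝ, 1 / ((u : ℂ) - D * I) - 1 / ((u : ℂ) + D * I)
      = 2 * I * ((D / (u ^ 2 + D ^ 2) : ℝ) : ℂ) := by
    intro u
    have h1 : (u : ℂ) + D * I ≠ 0 := ofReal_add_mul_I_ne_zero (Or.inr hD)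
    have h2 : (u : ℂ) - D * I ≠ 0 := by
      have := ofReal_add_mul_I_ne_zero (a := u) (b := -D) (Or.inr (neg_ne_zero.2 hD))
      simpa [sub_eq_add_neg] using this
    have h3 : ((u : ℂ) ^ 2 + D ^ 2) ≠ 0 := by
      have : (0 : ℝ) < u ^ 2 + D ^ 2 := by positivity
      exact_mod_cast this.ne'
    push_cast
    rw [div_sub_div _ _ h2 h1, mul_div_assoc', div_eq_div_iff (mul_ne_zero h2 h1) h3]
    linear_combination (2 * D * I * D ^ 2) * I_sq
  simp_rw [this]
  rw [intervalIntegral.integral_const_mul, intervalIntegral.integral_ofReal,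
    funext fun u : ℝ => congrArg (fun w => D / w) (add_comm (u ^ 2) (D ^ 2)), integral_div_sq_add_sq,
    neg_div, Real.arctan_neg]
  push_cast
  ring

/-- Multiplication by `i` gives the vertical sides the form of the horizontal ones, and the total is
`4i (arctan(R/D) + arctan(D/R)) = 2πi`. -/
theorem rectInt_inv {c R D : ℝ} (hR : 0 < R) (hD : 0 < D) :
    rectInt (fun z => 1 / (z - c)) (c - R) (c + R) D = 2 * Real.pi * I := by
  unfold rectInt
  have e1 : ∀ g : ℝ → ℂ, (∫ x in (c - R)..(c + R), g (x - c)) = ∫ u in (-R)..R, g u := by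
    intro g
    rw [intervalIntegral.integral_comp_sub_right g c]
    congr 1 <;> ring
  have a1 := e1 (fun u => 1 / ((u : ℂ) - D * I))
  have a2 := e1 (fun u => 1 / ((u : ℂ) + D * I))
  have b1 : (∫ x in (c - R)..(c + R), 1 / ((x : ℂ) - D * I - c)) =
      ∫ u in (-R)..R, 1 / ((u : ℂ) - D * I) := by
    rw [← a1]; refine intervalIntegral.integral_congr fun x _ => ?_
    simp only [ofReal_sub]; congr 1; ring
  have b2 : (∫ x in (c - R)..(c + R), 1 / ((x : ℂ) + D * I - c)) =
      ∫ u in (-R)..R, 1 / ((u : ℂ) + D * I) := by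
    rw [← a2]; refine intervalIntegral.integral_congr fun x _ => ?_
    simp only [ofReal_sub]; congr 1; ring
  have i1 : IntervalIntegrable (fun u : ℝ => 1 / ((u : ℂ) - D * I)) volume (-R) R := by
    refine Continuous.intervalIntegrable (Continuous.div (by fun_prop) (by fun_prop) fun u => ?_) _ _
    have := ofReal_add_mul_I_ne_zero (a := u) (b := -D) (Or.inr (neg_ne_zero.2 hD.ne'))
    simpa [sub_eq_add_neg] using this
  have i2 : IntervalIntegrable (fun u : ℝ => 1 / ((u : ℂ) + D * I)) volume (-R) R := by
    refine Continuous.intervalIntegrable (Continuous.div (by fun_prop) (by fun_prop) fun u => ?_) _ _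
    exact ofReal_add_mul_I_ne_zero (Or.inr hD.ne')
  have i3 : IntervalIntegrable (fun u : ℝ => 1 / ((u : ℂ) - R * I)) volume (-D) D := by
    refine Continuous.intervalIntegrable (Continuous.div (by fun_prop) (by fun_prop) fun u => ?_) _ _
    have := ofReal_add_mul_I_ne_zero (a := u) (b := -R) (Or.inr (neg_ne_zero.2 hR.ne'))
    simpa [sub_eq_add_neg] using this
  have i4 : IntervalIntegrable (fun u : ℝ => 1 / ((u : ℂ) + R * I)) volume (-D) D := by
    refine Continuous.intervalIntegrable (Continuous.div (by fun_prop) (by fun_prop) fun u => ?_) _ _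
    exact ofReal_add_mul_I_ne_zero (Or.inr hR.ne')
  have c1 : I * (∫ y in (-D)..D, 1 / (((c + R : ℝ) : ℂ) + y * I - c)) =
      ∫ u in (-D)..D, 1 / ((u : ℂ) - R * I) := by
    rw [← intervalIntegral.integral_const_mul]
    refine intervalIntegral.integral_congr fun x _ => ?_
    have : ((c + R : ℝ) : ℂ) + x * I - c = I * ((x : ℂ) - R * I) := by
      push_cast; linear_combination (R : ℂ) * I_sq
    simp only [this, one_div, mul_inv]
    rw [← mul_assoc, mul_inv_cancel₀ I_ne_zero, one_mul]
  have c2 : I * (∫ y in (-D)..D, 1 / (((c - R : ℝ) : ℂ) + y * I - c)) =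
      ∫ u in (-D)..D, 1 / ((u : ℂ) + R * I) := by
    rw [← intervalIntegral.integral_const_mul]
    refine intervalIntegral.integral_congr fun x _ => ?_
    have : ((c - R : ℝ) : ℂ) + x * I - c = I * ((x : ℂ) + R * I) := by
      push_cast; linear_combination -(R : ℂ) * I_sq
    simp only [this, one_div, mul_inv]
    rw [← mul_assoc, mul_inv_cancel₀ I_ne_zero, one_mul]
  rw [b1, b2, c1, c2, add_sub_assoc, ← intervalIntegral.integral_sub i1 i2, ← intervalIntegral.integral_sub i3 i4,
    integral_inv_sub_inv hD.ne', integral_inv_sub_inv hR.ne']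
  have := Real.arctan_inv_of_pos (x := R / D) (by positivity)
  rw [inv_div] at this
  rw [this]; push_cast; ring

/-- Cauchy's integral formula on a rectangle, at its centre. -/
theorem rectInt_div_sub {g : ℂ → ℂ} {c R D : ℝ} (hR : 0 < R) (hD : 0 < D)
    (hg : DifferentiableOn ℂ g (Set.Icc (c - R) (c + R) ×ℂ Set.Icc (-D) D)) :
    rectInt (fun z => g z / (z - c)) (c - R) (c + R) D = 2 * Real.pi * I * g c := by
  have hab : c - R ≤ c + R := by linarith
  have hnhds : Set.Icc (c - R) (c + R) ×ℂ Set.Icc (-D) D ∈ 𝓝 (c : ℂ) := by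
    have ho : IsOpen (Set.Ioo (c - R) (c + R) ×ℂ Set.Ioo (-D) D) := isOpen_Ioo.reProdIm isOpen_Ioo
    refine mem_of_superset (ho.mem_nhds ?_)
      (reProdIm_subset_iff.2 (Set.prod_mono Set.Ioo_subset_Icc_self Set.Ioo_subset_Icc_self))
    simp [mem_reProdIm, hR, hD]
  have hds := (Complex.differentiableOn_dslope hnhds).2 hg
  have hne : ∀ z ∈ Set.Icc (c - R) (c + R) ×ℂ Set.Icc (-D) D \
      Set.Ioo (c - R) (c + R) ×ℂ Set.Ioo (-D) D, z - (c : ℂ) ≠ 0 := by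
    rintro z ⟨-, hz⟩ h0
    rw [sub_eq_zero] at h0
    subst h0
    exact hz (by simp [mem_reProdIm, hR, hD])
  -- Splitting off the pole: the remaining difference quotient is holomorphic on the whole
  -- rectangle, so its contour integral vanishes.
  have h1 : rectInt (fun z => g z / (z - c)) (c - R) (c + R) D =
      rectInt (fun z => dslope g c z + g c * (1 / (z - c))) (c - R) (c + R) D := by
    refine rectInt_congr hab hD.le fun z hz => ?_
    have := hne z hz
    rw [dslope_of_ne _ (sub_ne_zero.1 this), slope_def_field]
    field_simp
    ring
  rw [h1, rectInt_add hab hD.le, rectInt_const_mul, rectInt_inv hR hD, rectInt_eq_zero]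
  · ring
  · rwa [Set.uIcc_of_le hab, Set.uIcc_of_le (by linarith)]
  · exact hds.continuousOn.mono Set.sdiff_subset
  · refine ContinuousOn.mul continuousOn_const (ContinuousOn.div continuousOn_const (by fun_prop) ?_)
    exact hne

end SincDE

/-! ### Letting rectangles exhaust a strip: Cauchy's formula on two lines. -/

namespace SincDE
open Complex MeasureTheory Filter Topology intervalIntegral

theorem rectInt_adjacent {f : ℂ → ℂ} {a b c D : ℝ}
    (h₁ : Integrable (fun x : ℝ => f (x - D * I))) (h₂ : Integrable (fun x : ℝ => f (x + D * I))) :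
    rectInt f a b D + rectInt f b c D = rectInt f a c D := by
  unfold rectInt
  rw [← integral_add_adjacent_intervals (a := a) (b := b) (c := c) h₁.intervalIntegrable
    h₁.intervalIntegrable, ← integral_add_adjacent_intervals (a := a) (b := b) (c := c)
    h₂.intervalIntegrable h₂.intervalIntegrable]
  ring

/-- Each column has width `h` and is centred at a node. Shared vertical sides cancel, and the outer
ones lie at `±(m + 1/2) h`, midway between nodes. -/
theorem rectInt_sum_columns {f : ℂ → ℂ} {h D : ℝ}
    (h₁ : Integrable (fun x : ℝ => f (x - D * I))) (h₂ : Integrable (fun x : ℝ => f (x + D * I)))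
    (m : ℕ) :
    ∑ k ∈ Finset.Icc (-(m : ℤ)) m, rectInt f (k * h - h / 2) (k * h + h / 2) D =
      rectInt f (-(m * h + h / 2)) (m * h + h / 2) D := by
  induction m with
  | zero => simp
  | succ m ih =>
    have hd : Disjoint (Finset.Icc (-(m : ℤ)) m) {(-(m + 1) : ℤ), (m + 1 : ℤ)} := by
      rw [Finset.disjoint_left]
      intro x hx hx'
      simp only [Finset.mem_Icc, Finset.mem_insert, Finset.mem_singleton] at hx hx'
      omega
    have hne : (-(m + 1) : ℤ) ≠ (m + 1 : ℤ) := by omega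
    push_cast
    rw [Finset.Icc_succ_succ, Finset.sum_union hd, ih, Finset.sum_pair hne]
    have e1 : ((-(m + 1) : ℤ) : ℝ) * h + h / 2 = -(m * h + h / 2) := by push_cast; ring
    have e2 : ((m + 1 : ℤ) : ℝ) * h - h / 2 = m * h + h / 2 := by push_cast; ring
    have e3 : ((-(m + 1) : ℤ) : ℝ) * h - h / 2 = -((m + 1) * h + h / 2) := by push_cast; ring
    have e4 : ((m + 1 : ℤ) : ℝ) * h + h / 2 = (m + 1) * h + h / 2 := by push_cast; ring
    rw [e1, e2, e3, e4, add_comm, add_assoc, add_comm (rectInt f (m * h + h / 2) _ D),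
      rectInt_adjacent h₁ h₂, rectInt_adjacent h₁ h₂]

theorem tendsto_rectInt {f : ℂ → ℂ} {D C : ℝ} {g : ℝ → ℝ} {a b : ℕ → ℝ} (hD : 0 ≤ D)
    (h₁ : Integrable (fun x : ℝ => f (x - D * I))) (h₂ : Integrable (fun x : ℝ => f (x + D * I)))
    (ha : Tendsto a atTop atBot) (hb : Tendsto b atTop atTop)
    (hg : Tendsto g atTop (𝓝 0)) (hg' : Tendsto g atBot (𝓝 0))
    (hfa : ∀ᶠ m in atTop, ∀ y : ℝ, |y| ≤ D → ‖f (a m + y * I)‖ ≤ C * g (a m))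
    (hfb : ∀ᶠ m in atTop, ∀ y : ℝ, |y| ≤ D → ‖f (b m + y * I)‖ ≤ C * g (b m)) :
    Tendsto (fun m => rectInt f (a m) (b m) D) atTop
      (𝓝 ((∫ x : ℝ, f (x - D * I)) - ∫ x : ℝ, f (x + D * I))) := by
  have side : ∀ c : ℕ → ℝ, Tendsto (fun m => g (c m)) atTop (𝓝 0) →
      (∀ᶠ m in atTop, ∀ y : ℝ, |y| ≤ D → ‖f (c m + y * I)‖ ≤ C * g (c m)) →
      Tendsto (fun m => I * ∫ y in (-D)..D, f (c m + y * I)) atTop (𝓝 0) := by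
    intro c hc hfc
    rw [tendsto_zero_iff_norm_tendsto_zero]
    have hlim : Tendsto (fun m => C * g (c m) * |D - -D|) atTop (𝓝 0) := by
      simpa using (hc.const_mul C).mul_const |D - -D|
    refine squeeze_zero' (Eventually.of_forall fun _ => norm_nonneg _) ?_ hlim
    filter_upwards [hfc] with m hm
    rw [norm_mul, norm_I, one_mul]
    refine norm_integral_le_of_norm_le_const fun y hy => hm y ?_
    rw [Set.uIoc_of_le (by linarith)] at hy
    exact abs_le.2 ⟨hy.1.le, hy.2⟩
  have t1 := intervalIntegral_tendsto_integral h₁ ha hb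
  have t2 := intervalIntegral_tendsto_integral h₂ ha hb
  have t3 := side b (hg.comp hb) hfb
  have t4 := side a (hg'.comp ha) hfa
  simpa [rectInt] using ((t1.sub t2).add t3).sub t4

/-- `F` is holomorphic on the closed strip `|Im z| ≤ D`, where it is dominated by the integrable
function `g` of the real part, which tends to `0` at infinity. -/
structure StripDecay (F : ℂ → ℂ) (D : ℝ) (g : ℝ → ℝ) : Prop where
  pos : 0 < D
  diff : ∀ z : ℂ, |z.im| ≤ D → DifferentiableAt ℂ F z
  bound : ∀ t y : ℝ, |y| ≤ D → ‖F (t + y * I)‖ ≤ g t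
  integrable : Integrable g
  top : Tendsto g atTop (𝓝 0)
  bot : Tendsto g atBot (𝓝 0)

namespace StripDecay
variable {F : ℂ → ℂ} {D : ℝ} {g : ℝ → ℝ}

theorem continuous_line (H : StripDecay F D g) {y : ℝ} (hy : |y| ≤ D) :
    Continuous (fun t : ℝ => F (t + y * I)) := by
  rw [continuous_iff_continuousAt]
  intro t
  have : ContinuousAt F (t + y * I) := (H.diff _ (by simpa using hy)).continuousAt
  exact this.comp (f := fun t : ℝ => (t : ℂ) + y * I) (by fun_prop)

theorem integrable_line (H : StripDecay F D g) {y : ℝ} (hy : |y| ≤ D) :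
    Integrable (fun t : ℝ => F (t + y * I)) :=
  H.integrable.mono' (H.continuous_line hy).aestronglyMeasurable
    (Eventually.of_forall fun t => H.bound t y hy)

theorem abs_neg_le (H : StripDecay F D g) : |(-D)| ≤ D := by rw [abs_neg, abs_of_pos H.pos]

theorem abs_le (H : StripDecay F D g) : |D| ≤ D := by rw [abs_of_pos H.pos]

/-- Multiplying by a bounded continuous function preserves integrability along a line. -/
theorem integrable_mul (H : StripDecay F D g) {y C : ℝ} (hy : |y| ≤ D) {k : ℝ → ℂ}
    (hk : Continuous k) (hC : ∀ t, ‖k t‖ ≤ C) : Integrable (fun t : ℝ => F (t + y * I) * k t) :=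
  (H.integrable_line hy).mul_bdd hk.aestronglyMeasurable (Eventually.of_forall hC)

end StripDecay

theorem sub_ofReal_ne_zero {y : ℝ} (hy : y ≠ 0) (t x : ℝ) : (t : ℂ) + y * I - x ≠ 0 := by
  have := ofReal_add_mul_I_ne_zero (a := t - x) (b := y) (Or.inr hy)
  intro h; apply this; rw [← h]; push_cast; ring

theorem abs_im_le_norm_sub (t y x : ℝ) : |y| ≤ ‖(t : ℂ) + y * I - x‖ := by
  have := Complex.abs_im_le_norm ((t : ℂ) + y * I - x)
  simpa using this

theorem norm_inv_sub_le {y : ℝ} (hy : y ≠ 0) (t x : ℝ) : ‖((t : ℂ) + y * I - x)⁻¹‖ ≤ |y|⁻¹ := by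
  rw [norm_inv]
  exact inv_anti₀ (abs_pos.2 hy) (abs_im_le_norm_sub t y x)

theorem abs_re_sub_le_norm (t y x : ℝ) : |t - x| ≤ ‖(t : ℂ) + y * I - x‖ := by
  have := Complex.abs_re_le_norm ((t : ℂ) + y * I - x)
  simpa using this

namespace StripDecay
variable {F : ℂ → ℂ} {D : ℝ} {g : ℝ → ℝ}

theorem line_ne (H : StripDecay F D g) : D ≠ 0 ∧ -D ≠ 0 := ⟨H.pos.ne', neg_ne_zero.2 H.pos.ne'⟩

/-- Cauchy's integral formula on a strip. -/
theorem cauchy (H : StripDecay F D g) (x : ℝ) :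
    (∫ t : ℝ, F (t + (-D : ℝ) * I) * (t + (-D : ℝ) * I - x)⁻¹) -
      ∫ t : ℝ, F (t + D * I) * (t + D * I - x)⁻¹ = 2 * Real.pi * I * F x := by
  have hint : ∀ y : ℝ, |y| ≤ D → y ≠ 0 →
      Integrable (fun t : ℝ => F (t + y * I) * (t + y * I - x)⁻¹) := fun y hy hy0 =>
    H.integrable_mul hy (Continuous.inv₀ (by fun_prop) fun t => sub_ofReal_ne_zero hy0 t x)
      (fun t => norm_inv_sub_le hy0 t x)
  set f : ℂ → ℂ := fun z => F z / (z - x) with hf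
  have e1 : ∀ t : ℝ, f (t - D * I) = F (t + (-D : ℝ) * I) * (t + (-D : ℝ) * I - x)⁻¹ := by
    intro t; simp only [hf, div_eq_mul_inv]; push_cast; simp only [neg_mul, ← sub_eq_add_neg]
  have e2 : ∀ t : ℝ, f (t + D * I) = F (t + D * I) * (t + D * I - x)⁻¹ := by
    intro t; simp only [hf, div_eq_mul_inv]
  have h₁ : Integrable (fun t : ℝ => f (t - D * I)) := by
    simp_rw [e1]; exact hint _ H.abs_neg_le H.line_ne.2
  have h₂ : Integrable (fun t : ℝ => f (t + D * I)) := by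
    simp_rw [e2]; exact hint _ H.abs_le H.line_ne.1
  have hvert : ∀ (u y : ℝ), 1 ≤ |u - x| → |y| ≤ D → ‖f (u + y * I)‖ ≤ 1 * g u := by
    intro u y hu hy
    have h3 := abs_re_sub_le_norm u y x
    have h4 : 1 ≤ ‖(u : ℂ) + y * I - x‖ := hu.trans h3
    simp only [hf, norm_div]
    rw [one_mul]
    exact (div_le_self (norm_nonneg _) h4).trans (H.bound u y hy)
  -- The rectangles are centred at `x` with half-width `m + 1`, so `|z - x| ≥ 1` on the vertical
  -- sides.
  have hb : Tendsto (fun m : ℕ => x + ((m : ℝ) + 1)) atTop atTop :=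
    tendsto_atTop_add_const_left _ _ (tendsto_atTop_add_const_right _ _ tendsto_natCast_atTop_atTop)
  have ha : Tendsto (fun m : ℕ => x - ((m : ℝ) + 1)) atTop atBot :=
    tendsto_atBot_add_const_left _ _ (tendsto_neg_atTop_atBot.comp
      (tendsto_atTop_add_const_right _ _ tendsto_natCast_atTop_atTop))
  have lim := tendsto_rectInt (C := 1) H.pos.le h₁ h₂ ha hb H.top H.bot
    (Eventually.of_forall fun m y hy => hvert _ y (by
      rw [show x - ((m : ℝ) + 1) - x = -((m : ℝ) + 1) by ring, abs_neg, abs_of_pos (by positivity)]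
      linarith [(Nat.cast_nonneg m : (0 : ℝ) ≤ m)]) hy)
    (Eventually.of_forall fun m y hy => hvert _ y (by
      rw [show x + ((m : ℝ) + 1) - x = ((m : ℝ) + 1) by ring, abs_of_pos (by positivity)]
      linarith [(Nat.cast_nonneg m : (0 : ℝ) ≤ m)]) hy)
  have hconst : ∀ m : ℕ, rectInt f (x - ((m : ℝ) + 1)) (x + ((m : ℝ) + 1)) D
      = 2 * Real.pi * I * F x := fun m =>
    rectInt_div_sub (by positivity) H.pos fun z hz =>
      (H.diff z (_root_.abs_le.2 ⟨hz.2.1, hz.2.2⟩)).differentiableWithinAt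
  simp_rw [hconst] at lim
  simp_rw [e1, e2] at lim
  exact tendsto_nhds_unique lim tendsto_const_nhds

end StripDecay
end SincDE

/-! ### The function `sin(πz/h)` and the error of Sinc interpolation. -/

namespace SincDE
open Complex MeasureTheory Filter Topology intervalIntegral

theorem normSq_sin_add_mul_I (a b : ℝ) :
    ‖Complex.sin (a + b * I)‖ ^ 2 = Real.sin a ^ 2 + Real.sinh b ^ 2 := by
  have : Complex.sin (a + b * I) =
      (Real.sin a * Real.cosh b : ℝ) + (Real.cos a * Real.sinh b : ℝ) * I := by
    rw [Complex.sin_add_mul_I]; push_cast; ring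
  rw [this, ← Complex.normSq_eq_norm_sq, Complex.normSq_add_mul_I]
  have h1 := Real.cosh_sq b
  have h2 := Real.sin_sq_add_cos_sq a
  rw [mul_pow, mul_pow, h1]
  linear_combination Real.sinh b ^ 2 * h2

theorem abs_sinh_le_norm_sin (a b : ℝ) : |Real.sinh b| ≤ ‖Complex.sin (a + b * I)‖ := by
  rw [← abs_of_nonneg (norm_nonneg (Complex.sin (a + b * I))), ← sq_le_sq, normSq_sin_add_mul_I]
  nlinarith [sq_nonneg (Real.sin a)]

/-- On vertical lines midway between zeros `sin² a = 1`, so the sine stays away from `0` uniformly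
in `b`. The outer sides of the contours are placed there. -/
theorem one_le_norm_sin {a : ℝ} (ha : Real.cos a = 0) (b : ℝ) :
    1 ≤ ‖Complex.sin (a + b * I)‖ := by
  have h2 := Real.sin_sq_add_cos_sq a
  rw [← abs_of_nonneg (norm_nonneg (Complex.sin (a + b * I))), ← abs_one, ← sq_le_sq,
    normSq_sin_add_mul_I]
  rw [ha] at h2
  nlinarith [sq_nonneg (Real.sinh b)]

/-- The function `sin (π z / h)`, which vanishes exactly at the nodes `k h`. -/
noncomputable def nodeSin (h : ℝ) (z : ℂ) : ℂ := Complex.sin (Real.pi / h * z)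

theorem differentiable_nodeSin (h : ℝ) : Differentiable ℂ (nodeSin h) := by
  unfold nodeSin; fun_prop

theorem nodeSin_line (h t y : ℝ) : nodeSin h (t + y * I) =
    Complex.sin ((Real.pi / h * t : ℝ) + (Real.pi / h * y : ℝ) * I) := by
  unfold nodeSin; congr 1; push_cast; ring

theorem nodeSin_ofReal (h x : ℝ) : nodeSin h x = (Real.sin (Real.pi / h * x) : ℝ) := by
  unfold nodeSin; push_cast; rfl

theorem norm_nodeSin_ofReal_le (h x : ℝ) : ‖nodeSin h x‖ ≤ 1 := by
  rw [nodeSin_ofReal, Complex.norm_real]; exact Real.abs_sin_le_one _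

theorem sinh_le_norm_nodeSin {h : ℝ} (t y : ℝ) :
    |Real.sinh (Real.pi / h * y)| ≤ ‖nodeSin h (t + y * I)‖ := by
  rw [nodeSin_line]; exact abs_sinh_le_norm_sin _ _

theorem nodeSin_line_ne_zero {h y : ℝ} (hh : 0 < h) (hy : y ≠ 0) (t : ℝ) :
    nodeSin h (t + y * I) ≠ 0 := by
  have h1 := sinh_le_norm_nodeSin (h := h) t y
  rw [← norm_pos_iff]
  refine lt_of_lt_of_le (abs_pos.2 ?_) h1
  have := Real.pi_pos
  rw [Ne, Real.sinh_eq_zero]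
  positivity

theorem nodeSin_eq_zero_iff {h : ℝ} (hh : 0 < h) (z : ℂ) :
    nodeSin h z = 0 ↔ ∃ k : ℤ, z = k * h := by
  unfold nodeSin
  rw [Complex.sin_eq_zero_iff]
  have h1 : (h : ℂ) ≠ 0 := by exact_mod_cast hh.ne'
  have h2 : (Real.pi : ℂ) ≠ 0 := by exact_mod_cast Real.pi_ne_zero
  refine exists_congr fun k => ?_
  constructor
  · intro e
    field_simp at e
    linear_combination e
  · rintro rfl
    field_simp

theorem nodeSin_node {h : ℝ} (hh : 0 < h) (k : ℤ) : nodeSin h ((k * h : ℝ) : ℂ) = 0 :=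
  (nodeSin_eq_zero_iff hh _).2 ⟨k, by push_cast; rfl⟩

theorem deriv_nodeSin (h : ℝ) (z : ℂ) :
    deriv (nodeSin h) z = Real.pi / h * Complex.cos (Real.pi / h * z) := by
  have h1 : HasDerivAt (fun z : ℂ => (Real.pi / h : ℂ) * z) (Real.pi / h) z := by
    simpa using (hasDerivAt_id z).const_mul (Real.pi / h : ℂ)
  have := h1.csin
  unfold nodeSin
  rw [this.deriv, mul_comm]

theorem cos_int_mul_pi_sq (k : ℤ) : Real.cos (k * Real.pi) ^ 2 = 1 := by
  have h1 := Real.sin_sq_add_cos_sq (k * Real.pi)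
  rw [Real.sin_int_mul_pi] at h1
  linarith

theorem deriv_nodeSin_node {h : ℝ} (hh : 0 < h) (k : ℤ) :
    deriv (nodeSin h) ((k * h : ℝ) : ℂ) = ((Real.pi / h * Real.cos (k * Real.pi) : ℝ) : ℂ) := by
  rw [deriv_nodeSin]
  push_cast
  have h1 : (h : ℂ) ≠ 0 := by exact_mod_cast hh.ne'
  congr 2
  field_simp

theorem deriv_nodeSin_node_ne_zero {h : ℝ} (hh : 0 < h) (k : ℤ) :
    deriv (nodeSin h) ((k * h : ℝ) : ℂ) ≠ 0 := by
  rw [deriv_nodeSin_node hh]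
  have h1 := cos_int_mul_pi_sq k
  have : Real.cos (k * Real.pi) ≠ 0 := by intro h0; rw [h0] at h1; norm_num at h1
  have := Real.pi_pos
  exact_mod_cast (by positivity)

/-- The quotient is the residue weight at the node `kh`. Using `dslope` covers the case where `x` is
itself a node. The sign `(-1)^k` is carried as `cos(kπ)`, of which only the square matters. -/
theorem dslope_nodeSin_div_deriv {h : ℝ} (hh : 0 < h) (k : ℤ) (x : ℝ) :
    dslope (nodeSin h) x ((k * h : ℝ) : ℂ) / deriv (nodeSin h) ((k * h : ℝ) : ℂ) =
      (Real.sinc (Real.pi * (x / h - k)) : ℝ) := by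
  by_cases hx : x = k * h
  · subst hx
    rw [dslope_same, div_self (deriv_nodeSin_node_ne_zero hh k)]
    have : k * h / h - k = 0 := by field_simp; ring
    simp [this]
  · have hx' : ((k * h : ℝ) : ℂ) ≠ x := by exact_mod_cast Ne.symm hx
    rw [dslope_of_ne _ hx', slope_def_field, nodeSin_node hh, deriv_nodeSin_node hh, nodeSin_ofReal]
    have hpi := Real.pi_pos
    have h0 : x / h - k ≠ 0 := by
      intro h0; apply hx; field_simp at h0; linarith
    have h1 := cos_int_mul_pi_sq k
    have hc : Real.cos (k * Real.pi) ≠ 0 := by intro h0; rw [h0] at h1; norm_num at h1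
    rw [Real.sinc_of_ne_zero (mul_ne_zero hpi.ne' h0)]
    have e : Real.sin (Real.pi * (x / h - k)) =
        Real.sin (Real.pi / h * x) * Real.cos (k * Real.pi) := by
      rw [show Real.pi * (x / h - k) = Real.pi / h * x - k * Real.pi by ring, Real.sin_sub,
        Real.sin_int_mul_pi, mul_zero, sub_zero]
    rw [e]
    norm_cast
    rw [zero_sub, div_div, div_eq_div_iff (by positivity) (by positivity)]
    have e3 : x / h - k = -(k * h - x) / h := by field_simp; ring
    rw [e3]
    have hh' := hh.ne'
    generalize Real.cos (k * Real.pi) = C at *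
    field_simp
    linear_combination -Real.sin (Real.pi * x / h) * (k * h - x) * h1

theorem differentiable_dslope_nodeSin (h : ℝ) (c : ℂ) :
    Differentiable ℂ (dslope (nodeSin h) c) := by
  rw [← differentiableOn_univ]
  exact (Complex.differentiableOn_dslope univ_mem).2 (differentiable_nodeSin h).differentiableOn

/-- The column of width `h` about `kh` contains no other zero of the sine, and the zero at `kh` is
simple. -/
theorem dslope_nodeSin_node_ne_zero {h D : ℝ} (hh : 0 < h) (k : ℤ) {z : ℂ}
    (hz : z ∈ Set.Icc (k * h - h / 2) (k * h + h / 2) ×ℂ Set.Icc (-D) D) :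
    dslope (nodeSin h) ((k * h : ℝ) : ℂ) z ≠ 0 := by
  by_cases hzk : z = ((k * h : ℝ) : ℂ)
  · rw [hzk, dslope_same]; exact deriv_nodeSin_node_ne_zero hh k
  · rw [dslope_of_ne _ hzk, slope_def_field, nodeSin_node hh, sub_zero]
    refine div_ne_zero ?_ (sub_ne_zero.2 hzk)
    rw [Ne, nodeSin_eq_zero_iff hh]
    rintro ⟨j, rfl⟩
    obtain ⟨h1, h2⟩ := hz.1
    simp only [mul_re, intCast_re, ofReal_re, intCast_im, ofReal_im, mul_zero, sub_zero] at h1 h2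
    have h3 : ((j - k : ℤ) : ℝ) < 1 := by push_cast; nlinarith
    have h4 : (-1 : ℝ) < ((j - k : ℤ) : ℝ) := by push_cast; nlinarith
    have h5 : j - k < 1 := by exact_mod_cast h3
    have h6 : -1 < j - k := by exact_mod_cast h4
    have : j = k := by omega
    subst this
    exact hzk (by push_cast; rfl)

namespace StripDecay
variable {F : ℂ → ℂ} {D : ℝ} {g : ℝ → ℝ}

/-- The kernel `dslope (nodeSin h) x z / nodeSin h z` equals `(1 - sin(πx/h)/sin(πz/h)) / (z - x)`;
it has no pole at `x` unless `x` is a node. In this column its only possible pole is `kh`. Writing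
`sin(πz/h) = (z - kh) · dslope` reduces the residue to Cauchy's formula at the centre. -/
theorem rectInt_column (H : StripDecay F D g) {h : ℝ} (hh : 0 < h) (k : ℤ) (x : ℝ) :
    rectInt (fun z => F z * (dslope (nodeSin h) x z / nodeSin h z)) (k * h - h / 2) (k * h + h / 2) D
      = 2 * Real.pi * I * (F ((k * h : ℝ) : ℂ) * (Real.sinc (Real.pi * (x / h - k)) : ℝ)) := by
  have hG : DifferentiableOn ℂ (fun z => F z * (dslope (nodeSin h) x z /
      dslope (nodeSin h) ((k * h : ℝ) : ℂ) z))
      (Set.Icc (k * h - h / 2) (k * h + h / 2) ×ℂ Set.Icc (-D) D) := by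
    intro z hz
    refine DifferentiableAt.differentiableWithinAt (DifferentiableAt.mul ?_ (DifferentiableAt.div
      (differentiable_dslope_nodeSin h _ z) (differentiable_dslope_nodeSin h _ z) ?_))
    · exact H.diff z (_root_.abs_le.2 ⟨hz.2.1, hz.2.2⟩)
    · exact dslope_nodeSin_node_ne_zero hh k hz
  have h2 : 0 < h / 2 := by positivity
  have := rectInt_div_sub h2 H.pos hG
  rw [dslope_same (nodeSin h) (((k * h : ℝ) : ℂ)), dslope_nodeSin_div_deriv hh] at this
  rw [← this]
  refine rectInt_congr (by linarith) H.pos.le fun z hz => ?_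
  have hzk : z ≠ ((k * h : ℝ) : ℂ) := by
    rintro rfl
    refine hz.2 ?_
    simp [mem_reProdIm, hh, H.pos]
  have hzk' := sub_ne_zero.2 hzk
  have hne := dslope_nodeSin_node_ne_zero hh k hz.1
  rw [dslope_of_ne _ hzk, slope_def_field, nodeSin_node hh, sub_zero] at hne ⊢
  have hs : nodeSin h z ≠ 0 := (div_ne_zero_iff.1 hne).1
  field_simp

theorem summable_nodes (H : StripDecay F D g) {h : ℝ} (hs : Summable fun k : ℤ => g (k * h)) :
    Summable fun k : ℤ => ‖F ((k * h : ℝ) : ℂ)‖ :=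
  Summable.of_nonneg_of_le (fun _ => norm_nonneg _) (fun k => by
    simpa using H.bound (k * h) 0 (by simpa using H.pos.le)) hs

theorem norm_dslope_div_le {h : ℝ} {z : ℂ} {x s δ : ℝ} (hs : 0 < s) (hδ : 0 < δ)
    (hz : δ ≤ ‖z - x‖) (hsz : s ≤ ‖nodeSin h z‖) :
    ‖dslope (nodeSin h) x z / nodeSin h z‖ ≤ δ⁻¹ * (1 + s⁻¹) := by
  have hzx : z ≠ x := by
    rintro rfl; simp at hz; linarith
  have hn : nodeSin h z ≠ 0 := norm_pos_iff.1 (hs.trans_le hsz)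
  have : dslope (nodeSin h) x z / nodeSin h z = (z - x)⁻¹ * (1 - nodeSin h x * (nodeSin h z)⁻¹) := by
    rw [dslope_of_ne _ hzx, slope_def_field]
    field_simp
  rw [this, norm_mul, norm_inv]
  refine mul_le_mul (inv_anti₀ hδ hz) ?_ (norm_nonneg _) (by positivity)
  refine (norm_sub_le _ _).trans ?_
  rw [norm_one, norm_mul, norm_inv]
  gcongr
  calc ‖nodeSin h x‖ * ‖nodeSin h z‖⁻¹ ≤ 1 * s⁻¹ :=
        mul_le_mul (norm_nodeSin_ofReal_le h x) (inv_anti₀ hs hsz) (by positivity) zero_le_one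
    _ = s⁻¹ := one_mul _

/-- The Sinc interpolant as a difference of line integrals. -/
theorem sinc_sum (H : StripDecay F D g) {h : ℝ} (hh : 0 < h)
    (hs : Summable fun k : ℤ => g (k * h)) (x : ℝ) :
    (∫ t : ℝ, F (t + (-D : ℝ) * I) *
        (dslope (nodeSin h) x (t + (-D : ℝ) * I) / nodeSin h (t + (-D : ℝ) * I))) -
      ∫ t : ℝ, F (t + D * I) * (dslope (nodeSin h) x (t + D * I) / nodeSin h (t + D * I)) =
    2 * Real.pi * I *
      ∑' k : ℤ, F ((k * h : ℝ) : ℂ) * (Real.sinc (Real.pi * (x / h - k)) : ℝ) := by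
  have hpos := H.pos
  have hint : ∀ y : ℝ, |y| = D → y ≠ 0 → Integrable (fun t : ℝ => F (t + y * I) *
      (dslope (nodeSin h) x (t + y * I) / nodeSin h (t + y * I))) := by
    intro y hy hy0
    refine H.integrable_mul hy.le (C := |y|⁻¹ * (1 + |Real.sinh (Real.pi / h * y)|⁻¹)) ?_ fun t => ?_
    · refine Continuous.div ?_ ?_ fun t => nodeSin_line_ne_zero hh hy0 t
      · exact (differentiable_dslope_nodeSin h x).continuous.comp (by fun_prop)
      · exact (differentiable_nodeSin h).continuous.comp (by fun_prop)
    · refine norm_dslope_div_le (abs_pos.2 ?_) (abs_pos.2 hy0) (abs_im_le_norm_sub t y x)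
        (sinh_le_norm_nodeSin t y)
      rw [Ne, Real.sinh_eq_zero]
      positivity
  set f : ℂ → ℂ := fun z => F z * (dslope (nodeSin h) x z / nodeSin h z) with hf
  have e1 : ∀ t : ℝ, f (t - D * I) = f (t + (-D : ℝ) * I) := by
    intro t; push_cast; simp only [neg_mul, ← sub_eq_add_neg]
  have h₁ : Integrable (fun t : ℝ => f (t - D * I)) := by
    simp_rw [e1]; exact hint _ (by rw [abs_neg, abs_of_pos hpos]) H.line_ne.2
  have h₂ : Integrable (fun t : ℝ => f (t + D * I)) := hint _ (abs_of_pos hpos) H.line_ne.1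
  have hb : Tendsto (fun m : ℕ => (m : ℝ) * h + h / 2) atTop atTop :=
    tendsto_atTop_add_const_right _ _ (tendsto_natCast_atTop_atTop.atTop_mul_const hh)
  have ha : Tendsto (fun m : ℕ => -((m : ℝ) * h + h / 2)) atTop atBot :=
    tendsto_neg_atTop_atBot.comp hb
  -- Far enough out, both `|z - x|` and `|sin(πz/h)|` are at least `1`, so the kernel is at most `1
  -- · (1 + 1) = 2`.
  have hvert : ∀ (u y : ℝ), Real.cos (Real.pi / h * u) = 0 → 1 ≤ |u - x| → |y| ≤ D →
      ‖f (u + y * I)‖ ≤ 2 * g u := by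
    intro u y hc hu hy
    have h4 : 1 ≤ ‖(u : ℂ) + y * I - x‖ := hu.trans (abs_re_sub_le_norm u y x)
    have h5 : 1 ≤ ‖nodeSin h (u + y * I)‖ := by
      rw [nodeSin_line]; exact one_le_norm_sin hc _
    have h6 := norm_dslope_div_le (h := h) one_pos one_pos h4 h5
    simp only [hf, norm_mul]
    calc _ ≤ g u * (1⁻¹ * (1 + 1⁻¹)) :=
          mul_le_mul (H.bound u y hy) h6 (norm_nonneg _) ((norm_nonneg _).trans (H.bound u y hy))
      _ = 2 * g u := by ring
  have hcos : ∀ m : ℕ, Real.cos (Real.pi / h * ((m : ℝ) * h + h / 2)) = 0 := by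
    intro m
    have : Real.pi / h * ((m : ℝ) * h + h / 2) = m * Real.pi + Real.pi / 2 := by
      field_simp
    rw [this, Real.cos_add_pi_div_two, Real.sin_nat_mul_pi, neg_zero]
  have lim := tendsto_rectInt (C := 2) hpos.le h₁ h₂ ha hb H.top H.bot
    (by
      filter_upwards [ha.eventually (eventually_le_atBot (x - 1))] with m hm y hy
      refine hvert _ y ?_ ?_ hy
      · rw [mul_neg, Real.cos_neg, hcos]
      · rw [abs_sub_comm]; exact le_trans (by linarith) (le_abs_self _))
    (by
      filter_upwards [hb.eventually (eventually_ge_atTop (x + 1))] with m hm y hy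
      exact hvert _ y (hcos m) (le_trans (by linarith) (le_abs_self _)) hy)
  have hcol : ∀ m : ℕ, rectInt f (-(m * h + h / 2)) (m * h + h / 2) D = 2 * Real.pi * I *
      ∑ k ∈ Finset.Icc (-(m : ℤ)) m,
        F ((k * h : ℝ) : ℂ) * (Real.sinc (Real.pi * (x / h - k)) : ℝ) := by
    intro m
    rw [← rectInt_sum_columns h₁ h₂, Finset.mul_sum]
    exact Finset.sum_congr rfl fun k _ => H.rectInt_column hh k x
  simp_rw [hcol, e1] at lim
  have hsum : Summable fun k : ℤ =>
      F ((k * h : ℝ) : ℂ) * (Real.sinc (Real.pi * (x / h - k)) : ℝ) := by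
    refine Summable.of_norm_bounded (H.summable_nodes hs) fun k => ?_
    rw [norm_mul, Complex.norm_real]
    exact mul_le_of_le_one_right (norm_nonneg _) (Real.abs_sinc_le_one _)
  have lim2 := (hsum.hasSum.comp (Finset.tendsto_Icc_neg (R := ℤ))).const_mul (2 * Real.pi * I)
  exact tendsto_nhds_unique lim lim2

/-- The error of Sinc interpolation as a difference of line integrals. -/
theorem sinc_error (H : StripDecay F D g) {h : ℝ} (hh : 0 < h)
    (hs : Summable fun k : ℤ => g (k * h)) (x : ℝ) :
    2 * Real.pi * I *
      (F x - ∑' k : ℤ, F ((k * h : ℝ) : ℂ) * (Real.sinc (Real.pi * (x / h - k)) : ℝ)) =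
    (∫ t : ℝ, F (t + (-D : ℝ) * I) * (nodeSin h (t + (-D : ℝ) * I))⁻¹ *
        (nodeSin h x * (t + (-D : ℝ) * I - x)⁻¹)) -
      ∫ t : ℝ, F (t + D * I) * (nodeSin h (t + D * I))⁻¹ *
        (nodeSin h x * (t + D * I - x)⁻¹) := by
  -- Subtracting the interpolation kernel from the Cauchy kernel cancels `1/(z - x)` and leaves the
  -- small term with `1/sin(πz/h)`.
  have key : ∀ y : ℝ, |y| = D → y ≠ 0 →
      (∫ t : ℝ, F (t + y * I) * (nodeSin h (t + y * I))⁻¹ * (nodeSin h x * (t + y * I - x)⁻¹)) =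
      (∫ t : ℝ, F (t + y * I) * (t + y * I - x)⁻¹) - ∫ t : ℝ, F (t + y * I) *
        (dslope (nodeSin h) x (t + y * I) / nodeSin h (t + y * I)) := by
    intro y hy hy0
    rw [← MeasureTheory.integral_sub]
    · congr 1; ext t
      have h1 := sub_ofReal_ne_zero hy0 t x
      have h2 := nodeSin_line_ne_zero hh hy0 t
      rw [dslope_of_ne _ (sub_ne_zero.1 h1), slope_def_field]
      field_simp
      ring
    · exact H.integrable_mul hy.le (Continuous.inv₀ (by fun_prop) fun t => sub_ofReal_ne_zero hy0 t x)
        (fun t => norm_inv_sub_le hy0 t x)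
    · refine H.integrable_mul hy.le (C := |y|⁻¹ * (1 + |Real.sinh (Real.pi / h * y)|⁻¹)) ?_ fun t => ?_
      · refine Continuous.div ?_ ?_ fun t => nodeSin_line_ne_zero hh hy0 t
        · exact (differentiable_dslope_nodeSin h x).continuous.comp (by fun_prop)
        · exact (differentiable_nodeSin h).continuous.comp (by fun_prop)
      · refine norm_dslope_div_le (abs_pos.2 ?_) (abs_pos.2 hy0) (abs_im_le_norm_sub t y x)
          (sinh_le_norm_nodeSin t y)
        rw [Ne, Real.sinh_eq_zero]
        positivity
  rw [key _ (by rw [abs_neg, abs_of_pos H.pos]) H.line_ne.2, key _ (abs_of_pos H.pos) H.line_ne.1,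
    mul_sub, ← H.cauchy x, ← H.sinc_sum hh hs x]
  ring

end StripDecay
end SincDE

/-! ### The sine integral and the basis functions `J(k,h)`. -/

namespace SincDE
open MeasureTheory Filter Topology Set

/-- The Laplace-type integrand whose integral over `(0, ∞)` is `π / 2 - Si x`. -/
noncomputable def siTailKernel (x t : ℝ) : ℝ :=
  Real.exp (-(x * t)) * (Real.cos x + t * Real.sin x) * (1 + t ^ 2)⁻¹

/-- The difference `π / 2 - Si x` for `x > 0`. -/
noncomputable def siTail (x : ℝ) : ℝ := ∫ t in Ioi (0 : ℝ), siTailKernel x t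

theorem continuous_siTailKernel (x : ℝ) : Continuous (siTailKernel x) := by
  unfold siTailKernel
  refine Continuous.mul (by fun_prop) (Continuous.inv₀ (by fun_prop) fun t => ?_)
  positivity

/-- By Cauchy–Schwarz `|cos x + t sin x| ≤ √(1 + t²) ≤ 1 + t²`. -/
theorem abs_siTailKernel_le (x t : ℝ) : |siTailKernel x t| ≤ Real.exp (-(x * t)) := by
  unfold siTailKernel
  rw [abs_mul, abs_mul, abs_of_pos (Real.exp_pos _), mul_assoc]
  refine mul_le_of_le_one_right (Real.exp_pos _).le ?_
  have h1 : (0 : ℝ) < 1 + t ^ 2 := by positivity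
  rw [abs_of_pos (inv_pos.2 h1), ← div_eq_mul_inv, div_le_one h1]
  refine abs_le_of_sq_le_sq ?_ h1.le
  have h2 := Real.sin_sq_add_cos_sq x
  have h3 := sq_nonneg (t * Real.cos x - Real.sin x)
  nlinarith [sq_nonneg t, sq_nonneg (t ^ 2)]

theorem integrableOn_exp_neg_mul {x : ℝ} (hx : 0 < x) :
    IntegrableOn (fun t => Real.exp (-(x * t))) (Ioi 0) := by
  simpa [neg_mul] using integrableOn_exp_mul_Ioi (neg_lt_zero.2 hx) 0

theorem integral_exp_neg_mul {x : ℝ} (hx : 0 < x) :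
    ∫ t in Ioi (0 : ℝ), Real.exp (-(x * t)) = x⁻¹ := by
  have := integral_exp_mul_Ioi (neg_lt_zero.2 hx) 0
  simpa [neg_mul, neg_div] using this

theorem abs_siTail_le {x : ℝ} (hx : 0 < x) : |siTail x| ≤ x⁻¹ := by
  rw [← integral_exp_neg_mul hx]
  rw [siTail, ← Real.norm_eq_abs]
  exact norm_integral_le_of_norm_le (integrableOn_exp_neg_mul hx)
    (Eventually.of_forall fun t => (Real.norm_eq_abs _).trans_le (abs_siTailKernel_le x t))

theorem hasDerivAt_siTailKernel (x t : ℝ) :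
    HasDerivAt (fun x => siTailKernel x t) (-(Real.exp (-(x * t)) * Real.sin x)) x := by
  have h1 : HasDerivAt (fun x : ℝ => Real.exp (-(x * t))) (Real.exp (-(x * t)) * (-(1 * t))) x :=
    (((hasDerivAt_id x).mul_const t).neg).exp
  have h2 : HasDerivAt (fun x : ℝ => Real.cos x + t * Real.sin x) (-Real.sin x + t * Real.cos x) x :=
    (Real.hasDerivAt_cos x).add ((Real.hasDerivAt_sin x).const_mul t)
  refine ((h1.mul h2).mul_const ((1 + t ^ 2)⁻¹)).congr_deriv ?_
  have h3 : (1 + t ^ 2 : ℝ) ≠ 0 := by positivity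
  field_simp
  ring

/-- Differentiating the kernel in `x` cancels the denominator `1 + t²` and leaves `-exp(-xt) sin x`,
whose integral is `-sin x / x`. -/
theorem hasDerivAt_siTail {x : ℝ} (hx : 0 < x) : HasDerivAt siTail (-Real.sinc x) x := by
  have hx2 : 0 < x / 2 := by positivity
  have key := hasDerivAt_integral_of_dominated_loc_of_deriv_le (𝕜 := ℝ)
    (μ := volume.restrict (Ioi (0 : ℝ))) (F := siTailKernel)
    (F' := fun x t => -(Real.exp (-(x * t)) * Real.sin x)) (x₀ := x)
    (bound := fun t => Real.exp (-((x / 2) * t))) (Ioi_mem_nhds (half_lt_self hx))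
    (Eventually.of_forall fun x => (continuous_siTailKernel x).aestronglyMeasurable)
    ((integrableOn_exp_neg_mul hx).mono' (continuous_siTailKernel x).aestronglyMeasurable
      (Eventually.of_forall fun t => abs_siTailKernel_le x t))
    (Continuous.aestronglyMeasurable (by fun_prop))
    ((ae_restrict_mem measurableSet_Ioi).mono fun t ht y hy => by
      rw [norm_neg, norm_mul, Real.norm_eq_abs, Real.norm_eq_abs, abs_of_pos (Real.exp_pos _)]
      refine (mul_le_of_le_one_right (Real.exp_pos _).le (Real.abs_sin_le_one _)).trans ?_
      have : 0 < t := ht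
      have : x / 2 < y := hy
      gcongr)
    (integrableOn_exp_neg_mul hx2)
    (Eventually.of_forall fun t y _ => hasDerivAt_siTailKernel y t)
  refine key.2.congr_deriv ?_
  rw [MeasureTheory.integral_neg, MeasureTheory.integral_mul_const, integral_exp_neg_mul hx,
    Real.sinc_of_ne_zero hx.ne']
  ring

theorem siTail_zero : siTail 0 = Real.pi / 2 := by
  simp [siTail, siTailKernel]

theorem tendsto_siTail_zero : Tendsto siTail (𝓝[>] 0) (𝓝 (Real.pi / 2)) := by
  rw [← siTail_zero]
  -- The bound `exp(-xt)` is not integrable uniformly as `x → 0`; instead `|cos x + t sin x| ≤ 1 +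
  -- tx ≤ exp(tx)` keeps the decay of `1/(1 + t²)`.
  refine tendsto_integral_filter_of_dominated_convergence (fun t => 2 * (1 + t ^ 2)⁻¹)
    (Eventually.of_forall fun x => (continuous_siTailKernel x).aestronglyMeasurable) ?_ ?_ ?_
  · filter_upwards [self_mem_nhdsWithin] with x hx
    have hx : 0 < x := hx
    filter_upwards [ae_restrict_mem measurableSet_Ioi] with t ht
    have ht : 0 < t := ht
    unfold siTailKernel
    rw [Real.norm_eq_abs, abs_mul, abs_of_pos (inv_pos.2 (by positivity : (0 : ℝ) < 1 + t ^ 2))]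
    gcongr
    have h1 : |Real.cos x + t * Real.sin x| ≤ 1 + t * x := by
      refine (abs_add_le _ _).trans (add_le_add (Real.abs_cos_le_one x) ?_)
      rw [abs_mul, abs_of_pos ht]
      gcongr
      simpa [abs_of_pos hx] using Real.abs_sin_le_abs (x := x)
    have h2 : 1 + x * t ≤ Real.exp (x * t) := by linarith [Real.add_one_le_exp (x * t)]
    rw [abs_mul, abs_of_pos (Real.exp_pos _), Real.exp_neg]
    have h3 := Real.exp_pos (x * t)
    rw [inv_mul_le_iff₀ h3]
    nlinarith
  · exact (integrable_inv_one_add_sq.const_mul 2).integrableOn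
  · refine Eventually.of_forall fun t => ?_
    have : Continuous fun x => siTailKernel x t := by unfold siTailKernel; fun_prop
    exact (this.tendsto 0).mono_left nhdsWithin_le_nhds

theorem hasDerivAt_Si (x : ℝ) : HasDerivAt Si (Real.sinc x) x :=
  intervalIntegral.integral_hasDerivAt_right (Real.continuous_sinc.intervalIntegrable _ _)
    (Real.continuous_sinc.stronglyMeasurableAtFilter _ _) Real.continuous_sinc.continuousAt

theorem Si_zero : Si 0 = 0 := by simp [Si]

/-- `Si + siTail` has derivative zero on `(0, ∞)`, and its limit at `0` is `π/2`. -/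
theorem Si_eq {x : ℝ} (hx : 0 < x) : Si x = Real.pi / 2 - siTail x := by
  have hder : ∀ y ∈ Ioi (0 : ℝ), HasDerivAt (fun y => Si y + siTail y) 0 y := fun y hy =>
    ((hasDerivAt_Si y).add (hasDerivAt_siTail hy)).congr_deriv (add_neg_cancel _)
  have hconst : ∀ y ∈ Ioi (0 : ℝ), Si y + siTail y = Si x + siTail x := fun y hy =>
    isOpen_Ioi.is_const_of_deriv_eq_zero isPreconnected_Ioi
      (fun z hz => (hder z hz).differentiableAt.differentiableWithinAt)
      (fun z hz => (hder z hz).deriv) hy hx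
  have h1 : Tendsto (fun y => Si y + siTail y) (𝓝[>] 0) (𝓝 (0 + Real.pi / 2)) := by
    refine Tendsto.add ?_ tendsto_siTail_zero
    have h0 : Tendsto Si (𝓝 0) (𝓝 (Si 0)) := (hasDerivAt_Si 0).continuousAt
    rw [Si_zero] at h0
    exact h0.mono_left nhdsWithin_le_nhds
  have h2 : Tendsto (fun y => Si y + siTail y) (𝓝[>] 0) (𝓝 (Si x + siTail x)) := by
    refine tendsto_const_nhds.congr' ?_
    filter_upwards [self_mem_nhdsWithin] with y hy
    exact (hconst y hy).symm
  have := tendsto_nhds_unique h1 h2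
  linarith

theorem Si_neg (x : ℝ) : Si (-x) = -Si x := by
  unfold Si
  have := intervalIntegral.integral_comp_neg (a := 0) (b := x) Real.sinc
  simp only [Real.sinc_neg, neg_zero] at this
  rw [this, intervalIntegral.integral_symm]

theorem tendsto_Si_atTop : Tendsto Si atTop (𝓝 (Real.pi / 2)) := by
  have h1 : Tendsto siTail atTop (𝓝 0) := by
    refine squeeze_zero_norm' ?_ tendsto_inv_atTop_zero
    filter_upwards [eventually_gt_atTop 0] with x hx using abs_siTail_le hx
  have h2 : Tendsto (fun x => Real.pi / 2 - siTail x) atTop (𝓝 (Real.pi / 2)) := by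
    simpa using tendsto_const_nhds.sub h1
  refine h2.congr' ?_
  filter_upwards [eventually_gt_atTop 0] with x hx using (Si_eq hx).symm

theorem tendsto_Si_atBot : Tendsto Si atBot (𝓝 (-(Real.pi / 2))) := by
  have : Si = fun x => -Si (-x) := by ext x; rw [Si_neg, neg_neg]
  rw [this]
  exact (tendsto_Si_atTop.comp tendsto_neg_atBot_atTop).neg

/-- `Si` increases on `[0, π]`; beyond `π` its distance to `π/2` is at most `1/x ≤ 1/π`. -/
theorem Si_bounds {x : ℝ} (hx : 0 ≤ x) : 0 ≤ Si x ∧ Si x ≤ Real.pi / 2 + Real.pi⁻¹ := by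
  have hpi := Real.pi_gt_three
  have hpi0 := Real.pi_pos
  have hinv : Real.pi⁻¹ ≤ 1 := inv_le_one_of_one_le₀ (by linarith)
  have large : ∀ {x : ℝ}, Real.pi ≤ x → 0 ≤ Si x ∧ Si x ≤ Real.pi / 2 + Real.pi⁻¹ := by
    intro x hx
    have h0 : 0 < x := hpi0.trans_le hx
    have h1 := abs_le.1 ((abs_siTail_le h0).trans (inv_anti₀ hpi0 hx))
    rw [Si_eq h0]
    constructor <;> linarith [h1.1, h1.2]
  rcases le_total Real.pi x with h | h
  · exact large h
  · have hmono : MonotoneOn Si (Icc 0 Real.pi) := by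
      refine monotoneOn_of_deriv_nonneg (convex_Icc _ _)
        (fun y _ => (hasDerivAt_Si y).continuousAt.continuousWithinAt)
        (fun y _ => (hasDerivAt_Si y).differentiableAt.differentiableWithinAt) fun y hy => ?_
      rw [interior_Icc] at hy
      rw [(hasDerivAt_Si y).deriv, Real.sinc_of_ne_zero hy.1.ne']
      exact div_nonneg (Real.sin_nonneg_of_nonneg_of_le_pi hy.1.le hy.2.le) hy.1.le
    have h0 := hmono (left_mem_Icc.2 hpi0.le) ⟨hx, h⟩ hx
    have h1 := hmono ⟨hx, h⟩ (right_mem_Icc.2 hpi0.le) h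
    rw [Si_zero] at h0
    exact ⟨h0, h1.trans (large le_rfl).2⟩

/-- The uniform bound of the basis functions `J(k,h)`. -/
theorem abs_half_add_Si_le (x : ℝ) : |1 / 2 + 1 / Real.pi * Si x| ≤ 1 + (Real.pi⁻¹) ^ 2 := by
  have e : Real.pi⁻¹ * (Real.pi / 2 + Real.pi⁻¹) = 1 / 2 + Real.pi⁻¹ ^ 2 := by
    field_simp
  have hp : 0 < Real.pi⁻¹ := by positivity
  rw [one_div Real.pi]
  rcases le_total 0 x with h | h
  · obtain ⟨h1, h2⟩ := Si_bounds h
    have h3 := mul_le_mul_of_nonneg_left h2 hp.le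
    have h4 := mul_nonneg hp.le h1
    rw [abs_le]; constructor <;> nlinarith
  · obtain ⟨h1, h2⟩ := Si_bounds (neg_nonneg.2 h)
    rw [Si_neg] at h1 h2
    have h3 := mul_le_mul_of_nonneg_left h2 hp.le
    have h4 := mul_nonneg hp.le h1
    rw [abs_le]; constructor <;> nlinarith

theorem abs_J_le (k : ℤ) {h : ℝ} (hh : 0 ≤ h) (x : ℝ) : |J k h x| ≤ (1 + (Real.pi⁻¹) ^ 2) * h := by
  unfold J
  rw [abs_mul, abs_of_nonneg hh, mul_comm]
  exact mul_le_mul_of_nonneg_right (abs_half_add_Si_le _) hh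

theorem tendsto_J_atBot (k : ℤ) {h : ℝ} (hh : 0 < h) : Tendsto (J k h) atBot (𝓝 0) := by
  have h1 : Tendsto (fun x : ℝ => Real.pi * (x / h - k)) atBot atBot :=
    (tendsto_atBot_add_const_right _ (-(k : ℝ))
      (tendsto_id.atBot_div_const hh)).const_mul_atBot Real.pi_pos
  have h2 := ((tendsto_Si_atBot.comp h1).const_mul (1 / Real.pi)).const_add (1 / 2)
  have h3 := h2.const_mul h
  have : h * (1 / 2 + 1 / Real.pi * -(Real.pi / 2)) = 0 := by
    have := Real.pi_pos
    field_simp; ring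
  rw [this] at h3
  exact h3

theorem hasDerivAt_J (k : ℤ) {h : ℝ} (hh : 0 < h) (x : ℝ) :
    HasDerivAt (J k h) (Real.sinc (Real.pi * (x / h - k))) x := by
  have h1 : HasDerivAt (fun x : ℝ => Real.pi * (x / h - k)) (Real.pi * (1 / h)) x :=
    (((hasDerivAt_id x).div_const h).sub_const (k : ℝ)).const_mul Real.pi
  have h2 := ((((hasDerivAt_Si _).comp x h1).const_mul (1 / Real.pi)).const_add (1 / 2)).const_mul h
  refine h2.congr_deriv ?_
  have := Real.pi_pos
  field_simp

theorem integral_sinc_node (k : ℤ) {h : ℝ} (hh : 0 < h) (a b : ℝ) :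
    ∫ x in a..b, Real.sinc (Real.pi * (x / h - k)) = J k h b - J k h a :=
  intervalIntegral.integral_eq_sub_of_hasDerivAt (fun x _ => hasDerivAt_J k hh x)
    (Continuous.intervalIntegrable (Real.continuous_sinc.comp (by fun_prop)) _ _)

end SincDE

/-! ### The discretization error of Sinc indefinite integration. -/

namespace SincDE
open Complex MeasureTheory Filter Topology intervalIntegral

theorem integral_inv_sq_shift_le {y : ℝ} (hy : y ≠ 0) (t a b : ℝ) :
    ∫ x in a..b, (y ^ 2 + (x - t) ^ 2)⁻¹ ≤ Real.pi / |y| := by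
  rw [intervalIntegral.integral_comp_sub_right (fun x => (y ^ 2 + x ^ 2)⁻¹) t,
    ← sq_abs y, integral_inv_sq_add_sq (abs_ne_zero.2 hy), div_eq_inv_mul Real.pi]
  refine mul_le_mul_of_nonneg_left ?_ (inv_nonneg.2 (abs_nonneg y))
  have h1 := Real.arctan_lt_pi_div_two ((b - t) / |y|)
  have h2 := Real.neg_pi_div_two_lt_arctan ((a - t) / |y|)
  linarith

theorem norm_line_sub_sq (t y x : ℝ) : ‖(t : ℂ) + y * I - x‖ ^ 2 = y ^ 2 + (x - t) ^ 2 := by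
  have : (t : ℂ) + y * I - x = ((t - x : ℝ) : ℂ) + y * I := by push_cast; ring
  rw [this, ← Complex.normSq_eq_norm_sq, Complex.normSq_add_mul_I]
  ring

/-- Integration by parts from a zero of the cosine. -/
theorem norm_integral_nodeSin_le {h y : ℝ} (hh : 0 < h) (hy : y ≠ 0) {a b : ℝ} (hab : a ≤ b)
    (ha : Real.cos (Real.pi / h * a) = 0) (t : ℝ) :
    ‖∫ x in a..b, nodeSin h x * ((t : ℂ) + y * I - x)⁻¹‖ ≤ h / Real.pi * ((1 + Real.pi) / |y|) := by
  set v : ℝ → ℂ := fun x => ((-(h / Real.pi * Real.cos (Real.pi / h * x)) : ℝ) : ℂ) with hv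
  have hnv : ∀ x, ‖v x‖ ≤ h / Real.pi := by
    intro x
    rw [hv, Complex.norm_real, norm_neg, Real.norm_eq_abs, abs_mul, abs_of_pos (by positivity)]
    exact mul_le_of_le_one_right (by positivity) (Real.abs_cos_le_one _)
  have hvd : ∀ x : ℝ, HasDerivAt v (nodeSin h x) x := by
    intro x
    rw [nodeSin_ofReal]
    have h1 : HasDerivAt (fun x : ℝ => Real.pi / h * x) (Real.pi / h * 1) x :=
      (hasDerivAt_id x).const_mul _
    have h2 := ((h1.cos).const_mul (h / Real.pi)).neg
    refine (h2.congr_deriv ?_).ofReal_comp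
    field_simp
  have hud : ∀ x : ℝ, HasDerivAt (fun x : ℝ => ((t : ℂ) + y * I - x)⁻¹)
      ((((t : ℂ) + y * I - x) ^ 2)⁻¹) x := by
    intro x
    have h1 : HasDerivAt (fun x : ℝ => (t : ℂ) + y * I - x) (-1) x := by
      simpa using (hasDerivAt_id x).ofReal_comp.const_sub ((t : ℂ) + y * I)
    refine (h1.fun_inv (sub_ofReal_ne_zero hy t x)).congr_deriv ?_
    rw [neg_neg, one_div]
  have hcu' : Continuous fun x : ℝ => (((t : ℂ) + y * I - x) ^ 2)⁻¹ :=
    Continuous.inv₀ (by fun_prop) fun x => pow_ne_zero 2 (sub_ofReal_ne_zero hy t x)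
  have hcs : Continuous fun x : ℝ => nodeSin h x :=
    (differentiable_nodeSin h).continuous.comp continuous_ofReal
  have parts := intervalIntegral.integral_mul_deriv_eq_deriv_mul (a := a) (b := b)
    (fun x _ => hud x) (fun x _ => hvd x)
    (hcu'.intervalIntegrable _ _) (hcs.intervalIntegrable _ _)
  -- Starting at a zero of the cosine removes one boundary term: the constant is `1 + π` and not `2
  -- + π`. The final comparison with `π²/2` would fail for the latter.
  have hva : v a = 0 := by
    simp only [hv]
    rw [ha]
    simp
  simp_rw [mul_comm (nodeSin h _)]
  rw [parts, hva, mul_zero, sub_zero]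
  refine (norm_sub_le _ _).trans ?_
  have b1 : ‖((t : ℂ) + y * I - b)⁻¹ * v b‖ ≤ |y|⁻¹ * (h / Real.pi) := by
    rw [norm_mul]
    exact mul_le_mul (norm_inv_sub_le hy t b) (hnv b) (norm_nonneg _) (by positivity)
  have b2 : ‖∫ x in a..b, (((t : ℂ) + y * I - x) ^ 2)⁻¹ * v x‖ ≤
      (Real.pi / |y|) * (h / Real.pi) := by
    have hcont : Continuous fun x : ℝ => (y ^ 2 + (x - t) ^ 2)⁻¹ :=
      Continuous.inv₀ (by fun_prop) fun x => by positivity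
    calc ‖∫ x in a..b, (((t : ℂ) + y * I - x) ^ 2)⁻¹ * v x‖
        ≤ ∫ x in a..b, (y ^ 2 + (x - t) ^ 2)⁻¹ * (h / Real.pi) := by
          refine intervalIntegral.norm_integral_le_of_norm_le hab
            (Eventually.of_forall fun x _ => ?_) ((hcont.mul_const _).intervalIntegrable _ _)
          rw [norm_mul, norm_inv, norm_pow, norm_line_sub_sq]
          exact mul_le_mul_of_nonneg_left (hnv x) (by positivity)
      _ ≤ _ := by
          rw [intervalIntegral.integral_mul_const]
          exact mul_le_mul_of_nonneg_right (integral_inv_sq_shift_le hy t a b) (by positivity)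
  refine (add_le_add b1 b2).trans (le_of_eq ?_)
  have := abs_pos.2 hy
  field_simp

theorem inv_sinh (u : ℝ) : (Real.sinh u)⁻¹ = 2 * (Real.exp (-u) / (1 - Real.exp (-(2 * u)))) := by
  have e1 : Real.exp (-(2 * u)) = Real.exp (-u) * Real.exp (-u) := by rw [← Real.exp_add]; ring_nf
  have e2 : Real.exp u * Real.exp (-u) = 1 := by rw [← Real.exp_add]; simp
  have : 1 - Real.exp (-(2 * u)) = 2 * Real.sinh u * Real.exp (-u) := by
    rw [e1, Real.sinh_eq]; linear_combination -e2
  rw [this]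
  rcases eq_or_ne (Real.sinh u) 0 with h | h
  · simp [h]
  · field_simp

namespace StripDecay
variable {F : ℂ → ℂ} {D : ℝ} {g : ℝ → ℝ}

theorem continuous_real (H : StripDecay F D g) : Continuous fun t : ℝ => F t := by
  simpa using H.continuous_line (y := 0) (by simpa using H.pos.le)

theorem integrable_real (H : StripDecay F D g) : Integrable fun t : ℝ => F t := by
  simpa using H.integrable_line (y := 0) (by simpa using H.pos.le)

theorem norm_inv_nodeSin_le {h y : ℝ} (hh : 0 < h) (hD : 0 < D) (hy : |y| = D) (t : ℝ) :
    ‖(nodeSin h (t + y * I))⁻¹‖ ≤ (Real.sinh (Real.pi / h * D))⁻¹ := by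
  have h1 := sinh_le_norm_nodeSin (h := h) t y
  rw [Real.abs_sinh, abs_mul, abs_of_pos (by positivity : 0 < Real.pi / h), hy] at h1
  rw [norm_inv]
  exact inv_anti₀ (Real.sinh_pos_iff.2 (by positivity)) h1

theorem integrable_div_nodeSin (H : StripDecay F D g) {h y : ℝ} (hh : 0 < h) (hy : |y| = D)
    (hy0 : y ≠ 0) : Integrable fun t : ℝ => F (t + y * I) * (nodeSin h (t + y * I))⁻¹ :=
  H.integrable_mul hy.le (Continuous.inv₀ ((differentiable_nodeSin h).continuous.comp (by fun_prop))
    fun t => nodeSin_line_ne_zero hh hy0 t) fun t => norm_inv_nodeSin_le hh H.pos hy t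

/-- Fubini: `F / sin(π·/h)` is integrable in `t`, the other factor is bounded, and the range of `x`
has finite measure. -/
theorem integral_swap (H : StripDecay F D g) {h y : ℝ} (hh : 0 < h) (hy : |y| = D) (hy0 : y ≠ 0)
    (a b : ℝ) :
    IntervalIntegrable (fun x : ℝ => ∫ t : ℝ, F (t + y * I) * (nodeSin h (t + y * I))⁻¹ *
      (nodeSin h x * ((t : ℂ) + y * I - x)⁻¹)) volume a b ∧
    ∫ x in a..b, (∫ t : ℝ, F (t + y * I) * (nodeSin h (t + y * I))⁻¹ *
      (nodeSin h x * ((t : ℂ) + y * I - x)⁻¹)) =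
    ∫ t : ℝ, F (t + y * I) * (nodeSin h (t + y * I))⁻¹ *
      ∫ x in a..b, nodeSin h x * ((t : ℂ) + y * I - x)⁻¹ := by
  have hcs : Continuous fun x : ℝ => nodeSin h x :=
    (differentiable_nodeSin h).continuous.comp continuous_ofReal
  have : IsFiniteMeasure (volume.restrict (Set.uIoc a b)) :=
    inferInstanceAs (IsFiniteMeasure (volume.restrict (Set.Ioc (min a b) (max a b))))
  have hint : Integrable (Function.uncurry fun (x t : ℝ) =>
      F (t + y * I) * (nodeSin h (t + y * I))⁻¹ * (nodeSin h x * ((t : ℂ) + y * I - x)⁻¹))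
      ((volume.restrict (Set.uIoc a b)).prod volume) := by
    have h1 : Integrable (fun p : ℝ × ℝ => (1 : ℂ) *
        (F (p.2 + y * I) * (nodeSin h (p.2 + y * I))⁻¹))
        ((volume.restrict (Set.uIoc a b)).prod volume) :=
      (integrable_const (1 : ℂ)).mul_prod (H.integrable_div_nodeSin hh hy hy0)
    simp only [one_mul] at h1
    refine h1.mul_bdd (c := |y|⁻¹) (Continuous.aestronglyMeasurable ?_) (Eventually.of_forall ?_)
    · exact (hcs.comp continuous_fst).mul
        (Continuous.inv₀ (by fun_prop) fun p => sub_ofReal_ne_zero hy0 p.2 p.1)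
    · rintro ⟨x, t⟩
      rw [norm_mul]
      calc _ ≤ 1 * |y|⁻¹ := mul_le_mul (norm_nodeSin_ofReal_le h x) (norm_inv_sub_le hy0 t x)
            (norm_nonneg _) zero_le_one
        _ = _ := one_mul _
  constructor
  · rw [intervalIntegrable_iff]
    exact hint.integral_prod_left
  · rw [intervalIntegral_integral_swap hint]
    simp_rw [intervalIntegral.integral_const_mul]

/-- The error of Sinc indefinite integration over `[a, b]` as a difference of line integrals. -/
theorem sinc_indefinite_error (H : StripDecay F D g) {h : ℝ} (hh : 0 < h)
    (hs : Summable fun k : ℤ => g (k * h)) (a b : ℝ) :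
    2 * Real.pi * I * ((∫ x in a..b, F (x : ℂ)) -
      ∑' k : ℤ, F ((k * h : ℝ) : ℂ) * ((J k h b - J k h a : ℝ) : ℂ)) =
    (∫ t : ℝ, F (t + (-D : ℝ) * I) * (nodeSin h (t + (-D : ℝ) * I))⁻¹ *
        ∫ x in a..b, nodeSin h x * ((t : ℂ) + (-D : ℝ) * I - x)⁻¹) -
      ∫ t : ℝ, F (t + D * I) * (nodeSin h (t + D * I))⁻¹ *
        ∫ x in a..b, nodeSin h x * ((t : ℂ) + D * I - x)⁻¹ := by
  obtain ⟨i1, s1⟩ := H.integral_swap hh (by rw [abs_neg, abs_of_pos H.pos]) H.line_ne.2 a b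
  obtain ⟨i2, s2⟩ := H.integral_swap hh (abs_of_pos H.pos) H.line_ne.1 a b
  rw [← s1, ← s2, ← intervalIntegral.integral_sub i1 i2]
  simp_rw [← H.sinc_error hh hs]
  rw [intervalIntegral.integral_const_mul]
  congr 1
  have hb : ∀ (k : ℤ) (x : ℝ), ‖F ((k * h : ℝ) : ℂ) *
      (Real.sinc (Real.pi * (x / h - k)) : ℝ)‖ ≤ ‖F ((k * h : ℝ) : ℂ)‖ := by
    intro k x
    rw [norm_mul, Complex.norm_real]
    exact mul_le_of_le_one_right (norm_nonneg _) (Real.abs_sinc_le_one _)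
  have hc : ∀ k : ℤ, Continuous fun x : ℝ => F ((k * h : ℝ) : ℂ) *
      ((Real.sinc (Real.pi * (x / h - k)) : ℝ) : ℂ) := fun k =>
    continuous_const.mul (continuous_ofReal.comp (Real.continuous_sinc.comp (by fun_prop)))
  have hsum := intervalIntegral.hasSum_integral_of_dominated_convergence (a := a) (b := b)
    (μ := volume) (F := fun (k : ℤ) (x : ℝ) => F ((k * h : ℝ) : ℂ) *
      ((Real.sinc (Real.pi * (x / h - k)) : ℝ) : ℂ))
    (f := fun x : ℝ => ∑' k : ℤ, F ((k * h : ℝ) : ℂ) * ((Real.sinc (Real.pi * (x / h - k)) : ℝ) : ℂ))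
    (fun k _ => ‖F ((k * h : ℝ) : ℂ)‖)
    (fun k => (hc k).aestronglyMeasurable)
    (fun k => Eventually.of_forall fun x _ => hb k x)
    (Eventually.of_forall fun x _ => H.summable_nodes hs)
    intervalIntegrable_const
    (Eventually.of_forall fun x _ => (Summable.of_norm_bounded (H.summable_nodes hs)
      fun k => hb k x).hasSum)
  have hval : ∀ k : ℤ, (∫ x in a..b, F ((k * h : ℝ) : ℂ) *
      ((Real.sinc (Real.pi * (x / h - k)) : ℝ) : ℂ)) =
      F ((k * h : ℝ) : ℂ) * ((J k h b - J k h a : ℝ) : ℂ) := by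
    intro k
    rw [intervalIntegral.integral_const_mul, intervalIntegral.integral_ofReal,
      integral_sinc_node k hh]
  simp_rw [hval] at hsum
  rw [hsum.tsum_eq, intervalIntegral.integral_sub (H.continuous_real.intervalIntegrable _ _)]
  exact (continuous_tsum hc (H.summable_nodes hs) hb).intervalIntegrable _ _

theorem norm_line_integral_le (H : StripDecay F D g) {h y : ℝ} (hh : 0 < h) (hy : |y| = D)
    (hy0 : y ≠ 0) {a b : ℝ} (hab : a ≤ b) (ha : Real.cos (Real.pi / h * a) = 0) :
    ‖∫ t : ℝ, F (t + y * I) * (nodeSin h (t + y * I))⁻¹ *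
        ∫ x in a..b, nodeSin h x * ((t : ℂ) + y * I - x)⁻¹‖ ≤
      (∫ t : ℝ, ‖F (t + y * I)‖) *
        ((Real.sinh (Real.pi / h * D))⁻¹ * (h / Real.pi * ((1 + Real.pi) / D))) := by
  rw [← MeasureTheory.integral_mul_const]
  refine norm_integral_le_of_norm_le ((H.integrable_line hy.le).norm.mul_const _)
    (Eventually.of_forall fun t => ?_)
  rw [norm_mul, norm_mul, mul_assoc]
  have := norm_integral_nodeSin_le hh hy0 hab ha t
  rw [hy] at this
  exact mul_le_mul_of_nonneg_left (mul_le_mul (norm_inv_nodeSin_le hh H.pos hy t) this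
    (norm_nonneg _) ((norm_nonneg _).trans (norm_inv_nodeSin_le hh H.pos hy t))) (norm_nonneg _)

/-- The discretization error of the Sinc indefinite integration. -/
theorem discretization_error (H : StripDecay F D g) {h : ℝ} (hh : 0 < h)
    (hs : Summable fun k : ℤ => g (k * h)) (b : ℝ) :
    ‖(∫ x in Set.Iic b, F (x : ℂ)) - ∑' k : ℤ, F ((k * h : ℝ) : ℂ) * ((J k h b : ℝ) : ℂ)‖ ≤
      ((∫ t : ℝ, ‖F (t + (-D : ℝ) * I)‖) + ∫ t : ℝ, ‖F (t + D * I)‖) *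
        (h / (2 * D) * (Real.exp (-(Real.pi / h * D)) /
          (1 - Real.exp (-(2 * (Real.pi / h * D)))))) := by
  have hpi := Real.pi_gt_d2
  have hpi0 := Real.pi_pos
  have hpos := H.pos
  set N := (∫ t : ℝ, ‖F (t + (-D : ℝ) * I)‖) + ∫ t : ℝ, ‖F (t + D * I)‖ with hN
  have hN0 : 0 ≤ N := add_nonneg (integral_nonneg fun _ => norm_nonneg _)
    (integral_nonneg fun _ => norm_nonneg _)
  -- Lower limits `-(m + 1/2) h` are zeros of `cos(πx/h)`. The estimate is uniform in them and
  -- passes to `m → ∞`.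
  set a : ℕ → ℝ := fun m => -((m : ℝ) * h + h / 2) with ha
  have hcos : ∀ m : ℕ, Real.cos (Real.pi / h * a m) = 0 := by
    intro m
    have : Real.pi / h * a m = -(m * Real.pi + Real.pi / 2) := by
      rw [ha]; field_simp
    rw [this, Real.cos_neg, Real.cos_add_pi_div_two, Real.sin_nat_mul_pi, neg_zero]
  have hta : Tendsto a atTop atBot := tendsto_neg_atTop_atBot.comp
    (tendsto_atTop_add_const_right _ _ (tendsto_natCast_atTop_atTop.atTop_mul_const hh))
  have hpos2 : 0 < 1 - Real.exp (-(2 * (Real.pi / h * D))) := by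
    rw [sub_pos, Real.exp_lt_one_iff]
    have : 0 < Real.pi / h * D := by positivity
    linarith
  have hfin : ∀ᶠ m in atTop, ‖(∫ x in (a m)..b, F (x : ℂ)) -
      ∑' k : ℤ, F ((k * h : ℝ) : ℂ) * ((J k h b - J k h (a m) : ℝ) : ℂ)‖ ≤
      N * (h / (2 * D) * (Real.exp (-(Real.pi / h * D)) /
          (1 - Real.exp (-(2 * (Real.pi / h * D)))))) := by
    filter_upwards [hta.eventually (eventually_le_atBot b)] with m hm
    have e := congrArg norm (H.sinc_indefinite_error hh hs (a m) b)
    have b1 := H.norm_line_integral_le hh (by rw [abs_neg, abs_of_pos hpos]) H.line_ne.2 hm (hcos m)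
    have b2 := H.norm_line_integral_le hh (abs_of_pos hpos) H.line_ne.1 hm (hcos m)
    have b3 := (norm_sub_le _ _).trans (add_le_add b1 b2)
    rw [← e, ← add_mul, ← hN, norm_mul, norm_mul, norm_mul, norm_I, Complex.norm_real, mul_one,
      Complex.norm_ofNat, Real.norm_eq_abs, abs_of_pos hpi0, inv_sinh] at b3
    set E := Real.exp (-(Real.pi / h * D)) / (1 - Real.exp (-(2 * (Real.pi / h * D)))) with hE
    refine le_of_mul_le_mul_left (b3.trans ?_) (by positivity : 0 < 2 * Real.pi)
    have hcomp : 2 * E * (h / Real.pi * ((1 + Real.pi) / D)) ≤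
        2 * Real.pi * (h / (2 * D) * E) := by
      have : 2 * Real.pi * (h / (2 * D) * E) - 2 * E * (h / Real.pi * ((1 + Real.pi) / D)) =
          E * h / (D * Real.pi) * (Real.pi ^ 2 - 2 * (1 + Real.pi)) := by
        field_simp
      -- The inequality `2(1 + π) ≤ π²` replaces the constant `(1 + π)/π²` by `1/2`.
      have h2 : 0 ≤ Real.pi ^ 2 - 2 * (1 + Real.pi) := by nlinarith
      have h3 : 0 ≤ E * h / (D * Real.pi) * (Real.pi ^ 2 - 2 * (1 + Real.pi)) := by positivity
      linarith
    calc _ ≤ N * (2 * Real.pi * (h / (2 * D) * E)) := mul_le_mul_of_nonneg_left hcomp hN0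
      _ = _ := by ring
  have lim1 := intervalIntegral_tendsto_integral_Iic b H.integrable_real.integrableOn hta
  have lim2 : Tendsto (fun m => ∑' k : ℤ, F ((k * h : ℝ) : ℂ) *
      ((J k h b - J k h (a m) : ℝ) : ℂ)) atTop
      (𝓝 (∑' k : ℤ, F ((k * h : ℝ) : ℂ) * ((J k h b : ℝ) : ℂ))) := by
    refine tendsto_tsum_of_dominated_convergence
      (bound := fun k : ℤ => ‖F ((k * h : ℝ) : ℂ)‖ * (2 * ((1 + (Real.pi⁻¹) ^ 2) * h)))
      ((H.summable_nodes hs).mul_right _) (fun k => ?_) (Eventually.of_forall fun m k => ?_)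
    · have h1 : Tendsto (fun m => J k h b - J k h (a m)) atTop (𝓝 (J k h b - 0)) :=
        ((tendsto_J_atBot k hh).comp hta).const_sub _
      rw [sub_zero] at h1
      exact ((continuous_ofReal.tendsto _).comp h1).const_mul _
    · rw [norm_mul, Complex.norm_real]
      refine mul_le_mul_of_nonneg_left ((norm_sub_le _ _).trans ?_) (norm_nonneg _)
      have h1 := abs_J_le k hh.le b
      have h2 := abs_J_le k hh.le (a m)
      simp only [Real.norm_eq_abs]
      linarith
  exact le_of_tendsto (lim1.sub lim2).norm hfin

end StripDecay
end SincDE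

/-! ### Lower bounds for `1 + exp(π sinh ζ)` and bounds for the comparison function. -/

namespace SincDE
open Filter Topology Set

theorem one_add_sq_div_two_le_cosh (x : ℝ) : 1 + x ^ 2 / 2 ≤ Real.cosh x := by
  have h1 : Real.cosh x = 1 + 2 * Real.sinh (x / 2) ^ 2 := by
    have := Real.cosh_two_mul (x / 2)
    rw [show 2 * (x / 2) = x by ring, Real.cosh_sq] at this
    linarith
  have h2 : (x / 2) ^ 2 ≤ Real.sinh (x / 2) ^ 2 := by
    rw [sq_le_sq, Real.abs_sinh]
    exact Real.self_le_sinh_iff.2 (abs_nonneg _)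
  rw [h1]; nlinarith

/-- The tangent to the sine at `B` has height at least `1` at `π`. With `e = π/2 - B` the right side
is `cos e + (π/2 + e) sin e ≥ 1 - e²/2 + e`, and `e ≤ π/2 ≤ 2`. -/
theorem one_le_sin_add_mul_cos {B : ℝ} (hB : 0 ≤ B) (hB' : B ≤ Real.pi / 2) :
    1 ≤ Real.sin B + (Real.pi - B) * Real.cos B := by
  have hpi4 := Real.pi_le_four
  set e := Real.pi / 2 - B with he
  have h1 : Real.sin B = Real.cos e := by rw [he, Real.cos_pi_div_two_sub]
  have h2 : Real.cos B = Real.sin e := by rw [he, Real.sin_pi_div_two_sub]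
  have h3 : Real.pi - B = Real.pi / 2 + e := by rw [he]; ring
  have he0 : 0 ≤ e := by linarith
  have he1 : e ≤ Real.pi / 2 := by linarith
  rw [h1, h2, h3]
  have h4 := Real.mul_le_sin he0 he1
  have h5 := Real.one_sub_sq_div_two_le_cos (x := e)
  have h6 : Real.pi / 2 * (2 / Real.pi * e) ≤ (Real.pi / 2 + e) * Real.sin e :=
    mul_le_mul (by linarith) h4 (by positivity) (by positivity)
  have h7 : Real.pi / 2 * (2 / Real.pi * e) = e := by field_simp
  nlinarith

/-- The sine lies below its tangent lines beyond the point of tangency. -/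
theorem abs_sin_le_tangent {B x : ℝ} (hB : 0 ≤ B) (hB' : B ≤ Real.pi / 2) (hx : B ≤ x) :
    |Real.sin x| ≤ Real.sin B + (x - B) * Real.cos B := by
  have hpi := Real.pi_pos
  have hc : 0 ≤ Real.cos B := Real.cos_nonneg_of_mem_Icc ⟨by linarith, hB'⟩
  rcases le_total x Real.pi with h | h
  · rw [abs_of_nonneg (Real.sin_nonneg_of_nonneg_of_le_pi (hB.trans hx) h)]
    rcases hx.eq_or_lt with rfl | hlt
    · simp
    · obtain ⟨c, hc, hce⟩ := exists_deriv_eq_slope Real.sin hlt Real.continuous_sin.continuousOn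
        Real.differentiable_sin.differentiableOn
      rw [Real.deriv_sin, eq_div_iff (by linarith)] at hce
      have := Real.cos_le_cos_of_nonneg_of_le_pi hB (hc.2.le.trans h) hc.1.le
      nlinarith
  · refine (Real.abs_sin_le_one x).trans ((one_le_sin_add_mul_cos hB hB').trans ?_)
    nlinarith

/-- For `w = π sinh(t + iy)` this compares `sin(Im w / 2)` with `cosh(Re w / 2)`. With `A`, `B` as
below, `A² + B² = π²/4`. The tangent bound gives `sin B + (cosh t - 1) B cos B`; here `B cos B ≤ A²
sin B` by `cos B ≤ π/2 - B` and `sin B ≥ 2B/π`; and `cosh(A sinh t) ≥ 1 + A² sinh² t / 2 ≥ 1 + A²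
(cosh t - 1)`. -/
theorem abs_sin_cosh_mul_le {y : ℝ} (hy : 0 ≤ y) (hy' : y < Real.pi / 2) (t : ℝ) :
    |Real.sin (Real.cosh t * (Real.pi / 2 * Real.sin y))| ≤
      Real.sin (Real.pi / 2 * Real.sin y) * Real.cosh (Real.pi / 2 * Real.cos y * Real.sinh t) := by
  set B := Real.pi / 2 * Real.sin y with hB
  set A := Real.pi / 2 * Real.cos y with hA
  have hs0 : 0 ≤ Real.sin y := Real.sin_nonneg_of_nonneg_of_le_pi hy (by linarith)
  have hB0 : 0 ≤ B := by positivity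
  have hB1 : B ≤ Real.pi / 2 := by
    have := Real.sin_le_one y
    rw [hB]; nlinarith
  have hsum : A ^ 2 = (Real.pi / 2 - B) * (Real.pi / 2 + B) := by
    rw [hA, hB]
    linear_combination (Real.pi / 2) ^ 2 * Real.sin_sq_add_cos_sq y
  have hc := Real.one_le_cosh t
  have h1 := abs_sin_le_tangent hB0 hB1 (x := Real.cosh t * B) (by nlinarith)
  have hcos : Real.cos B ≤ Real.pi / 2 - B := by
    rw [← Real.sin_pi_div_two_sub]
    exact Real.sin_le (by linarith)
  have hsin := Real.mul_le_sin hB0 hB1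
  have hsinB : 0 ≤ Real.sin B := Real.sin_nonneg_of_nonneg_of_le_pi hB0 (by linarith)
  have h2 : B * Real.cos B ≤ A ^ 2 * Real.sin B := by
    have e1 : B * Real.cos B ≤ B * (Real.pi / 2 - B) := mul_le_mul_of_nonneg_left hcos hB0
    have e2 : (Real.pi / 2 - B) * (Real.pi / 2) * (2 / Real.pi * B) ≤ A ^ 2 * Real.sin B := by
      rw [hsum]
      refine mul_le_mul (mul_le_mul_of_nonneg_left (by linarith) (by linarith)) hsin
        (by positivity) (mul_nonneg (by linarith) (by linarith))
    have e3 : (Real.pi / 2 - B) * (Real.pi / 2) * (2 / Real.pi * B) = B * (Real.pi / 2 - B) := by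
      field_simp
    linarith
  have h3 : 1 + A ^ 2 * (Real.cosh t - 1) ≤ Real.cosh (A * Real.sinh t) := by
    have e1 := one_add_sq_div_two_le_cosh (A * Real.sinh t)
    have e2 := Real.cosh_sq t
    have e3 : A ^ 2 * (Real.cosh t - 1) ≤ A ^ 2 * (Real.sinh t ^ 2 / 2) :=
      mul_le_mul_of_nonneg_left (by nlinarith) (sq_nonneg A)
    nlinarith
  calc _ ≤ _ := h1
    _ = Real.sin B + (Real.cosh t - 1) * (B * Real.cos B) := by ring
    _ ≤ Real.sin B + (Real.cosh t - 1) * (A ^ 2 * Real.sin B) := by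
        have := mul_le_mul_of_nonneg_left h2 (by linarith : 0 ≤ Real.cosh t - 1)
        linarith
    _ = Real.sin B * (1 + A ^ 2 * (Real.cosh t - 1)) := by ring
    _ ≤ _ := mul_le_mul_of_nonneg_left h3 hsinB

theorem norm_one_add_exp_sq (w : ℂ) : ‖1 + Complex.exp w‖ ^ 2 =
    (1 + Real.exp w.re) ^ 2 - 4 * Real.exp w.re * Real.sin (w.im / 2) ^ 2 := by
  have e : 1 + Complex.exp w = ((1 + Real.exp w.re * Real.cos w.im : ℝ) : ℂ) +
      ((Real.exp w.re * Real.sin w.im : ℝ) : ℂ) * Complex.I := by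
    apply Complex.ext <;> simp [Complex.exp_re, Complex.exp_im, -Complex.ofReal_cos, -Complex.ofReal_sin]
  rw [e, ← Complex.normSq_eq_norm_sq, Complex.normSq_add_mul_I]
  have h1 := Real.sin_sq_add_cos_sq w.im
  have h2 : Real.cos w.im = 1 - 2 * Real.sin (w.im / 2) ^ 2 := by
    have := Real.cos_two_mul (w.im / 2)
    rw [show 2 * (w.im / 2) = w.im by ring] at this
    rw [this]; linear_combination 2 * Real.sin_sq_add_cos_sq (w.im / 2)
  linear_combination Real.exp w.re ^ 2 * h1 + 2 * Real.exp w.re * h2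

/-- Since `4 exp(a) cosh²(a/2) = (1 + exp a)²` for `a = Re w`, the hypothesis bounds the subtracted
term of `norm_one_add_exp_sq` by `(1 + exp a)² sin² B`. -/
theorem norm_one_add_exp_ge {w : ℂ} {B : ℝ}
    (h : |Real.sin (w.im / 2)| ≤ Real.sin B * Real.cosh (w.re / 2)) :
    (1 + Real.exp w.re) * Real.cos B ≤ ‖1 + Complex.exp w‖ := by
  refine le_of_sq_le_sq ?_ (norm_nonneg _)
  rw [norm_one_add_exp_sq, mul_pow]
  have h1 : 4 * Real.exp w.re * Real.cosh (w.re / 2) ^ 2 = (1 + Real.exp w.re) ^ 2 := by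
    rw [Real.cosh_eq]
    have e1 : Real.exp w.re = Real.exp (w.re / 2) * Real.exp (w.re / 2) := by
      rw [← Real.exp_add]; ring_nf
    have e2 : Real.exp (w.re / 2) * Real.exp (-(w.re / 2)) = 1 := by
      rw [← Real.exp_add]; simp
    rw [e1]
    generalize Real.exp (w.re / 2) = p at *
    generalize Real.exp (-(w.re / 2)) = q at *
    linear_combination (2 * p ^ 2 + p * q + 1) * e2
  have h2 : Real.sin (w.im / 2) ^ 2 ≤ (Real.sin B * Real.cosh (w.re / 2)) ^ 2 := by
    rw [← sq_abs (Real.sin (w.im / 2))]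
    exact pow_le_pow_left₀ (abs_nonneg _) h 2
  have h3 := Real.sin_sq_add_cos_sq B
  have h4 := mul_le_mul_of_nonneg_left h2 (by positivity : 0 ≤ 4 * Real.exp w.re)
  have h5 : 4 * Real.exp w.re * (Real.sin B * Real.cosh (w.re / 2)) ^ 2 =
      (1 + Real.exp w.re) ^ 2 * Real.sin B ^ 2 := by rw [← h1]; ring
  rw [h5] at h4
  nlinarith

theorem pi_sinh_re (t y : ℝ) :
    ((Real.pi : ℂ) * Complex.sinh (t + y * Complex.I)).re =
      Real.pi * (Real.sinh t * Real.cos y) := by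
  have : Complex.sinh (t + y * Complex.I) = ((Real.sinh t * Real.cos y : ℝ) : ℂ) +
      ((Real.cosh t * Real.sin y : ℝ) : ℂ) * Complex.I := by
    rw [Complex.sinh_add, Complex.sinh_mul_I, Complex.cosh_mul_I]; push_cast; ring
  rw [Complex.re_ofReal_mul, this]; simp [-Complex.ofReal_mul]

theorem pi_sinh_im (t y : ℝ) :
    ((Real.pi : ℂ) * Complex.sinh (t + y * Complex.I)).im =
      Real.pi * (Real.cosh t * Real.sin y) := by
  have : Complex.sinh (t + y * Complex.I) = ((Real.sinh t * Real.cos y : ℝ) : ℂ) +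
      ((Real.cosh t * Real.sin y : ℝ) : ℂ) * Complex.I := by
    rw [Complex.sinh_add, Complex.sinh_mul_I, Complex.cosh_mul_I]; push_cast; ring
  rw [Complex.im_ofReal_mul, this]; simp [-Complex.ofReal_mul]

/-- The quantity `cos (π/2 · sin D)` controlling the distance to the singularities. -/
noncomputable def kap (D : ℝ) : ℝ := Real.cos (Real.pi / 2 * Real.sin D)

theorem kap_pos {D : ℝ} (hD : 0 ≤ D) (hD' : D < Real.pi / 2) : 0 < kap D := by
  have h0 : 0 ≤ Real.sin D := Real.sin_nonneg_of_nonneg_of_le_pi hD (by linarith)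
  have h1 : Real.sin D < 1 := by
    rw [← Real.sin_pi_div_two]
    exact Real.sin_lt_sin_of_lt_of_le_pi_div_two (by linarith) le_rfl hD'
  refine Real.cos_pos_of_mem_Ioo ⟨by nlinarith, by nlinarith⟩

theorem kap_anti {y D : ℝ} (hy : 0 ≤ y) (hyD : y ≤ D) (hD' : D < Real.pi / 2) : kap D ≤ kap y := by
  have h0 : 0 ≤ Real.sin y := Real.sin_nonneg_of_nonneg_of_le_pi hy (by linarith)
  have h1 : Real.sin y ≤ Real.sin D :=
    Real.sin_le_sin_of_le_of_le_pi_div_two (by linarith) hD'.le hyD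
  have h2 := Real.sin_le_one D
  refine Real.cos_le_cos_of_nonneg_of_le_pi (by positivity) (by nlinarith) (by nlinarith)

theorem norm_one_add_exp_pi_sinh_ge {D t y : ℝ} (hy : |y| ≤ D) (hD : D < Real.pi / 2) :
    (1 + Real.exp (Real.pi * (Real.sinh t * Real.cos y))) * kap D ≤
      ‖1 + Complex.exp (Real.pi * Complex.sinh (t + y * Complex.I))‖ ∧
    (1 + Real.exp (-(Real.pi * (Real.sinh t * Real.cos y)))) * kap D ≤
      ‖1 + Complex.exp (-(Real.pi * Complex.sinh (t + y * Complex.I)))‖ := by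
  have hk := kap_anti (abs_nonneg y) hy hD
  have key := abs_sin_cosh_mul_le (abs_nonneg y) (hy.trans_lt hD) t
  have habs : |Real.sin (Real.cosh t * (Real.pi / 2 * Real.sin |y|))| =
      |Real.sin (Real.pi * (Real.cosh t * Real.sin y) / 2)| := by
    rcases abs_choice y with h | h <;> rw [h]
    · congr 2; ring
    · rw [Real.sin_neg, ← abs_neg, ← Real.sin_neg]; congr 2; ring
  rw [habs, Real.cos_abs] at key
  set w : ℂ := Real.pi * Complex.sinh (t + y * Complex.I) with hw
  have hre : w.re = Real.pi * (Real.sinh t * Real.cos y) := pi_sinh_re t y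
  have him : w.im = Real.pi * (Real.cosh t * Real.sin y) := pi_sinh_im t y
  have hch : Real.cosh (Real.pi / 2 * Real.cos y * Real.sinh t) = Real.cosh (w.re / 2) := by
    rw [hre]; congr 1; ring
  rw [hch, ← him] at key
  constructor
  · have := norm_one_add_exp_ge (w := w) key
    rw [← hre]
    exact (mul_le_mul_of_nonneg_left hk (by positivity)).trans this
  · have := norm_one_add_exp_ge (w := -w) (B := Real.pi / 2 * Real.sin |y|) (by
      simpa [neg_div] using key)
    rw [Complex.neg_re] at this
    rw [← hre]
    exact (mul_le_mul_of_nonneg_left hk (by positivity)).trans this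

theorem norm_exp_neg_sub_one_le (z : ℂ) : ‖1 - Complex.exp (-z)‖ ≤ Real.exp ‖z‖ - 1 := by
  have := Complex.norm_exp_sub_sum_le_exp_norm_sub_sum (-z) 1
  simpa [norm_sub_rev] using this

/-- The radius `R = log(1 + c)` is where `exp R - 1 = c`. Inside it, convexity puts `exp|z| - 1`
below the chord `c|z|/R`; outside it, `(1 + |z|)/|z| ≤ (1 + R)/R`. Both give the same constant. -/
theorem norm_one_add_div_mul_le {z : ℂ} {c : ℝ} (hc : 0 < c) (hz : z ≠ 0)
    (hp : ‖1 - Complex.exp (-z)‖ ≤ c) :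
    ‖(1 + z) / z * (1 - Complex.exp (-z))‖ ≤ (1 + Real.log (1 + c)) / Real.log (1 + c) * c := by
  set R := Real.log (1 + c) with hR
  have hR0 : 0 < R := Real.log_pos (by linarith)
  have hexpR : Real.exp R = 1 + c := Real.exp_log (by linarith)
  have hz0 : 0 < ‖z‖ := norm_pos_iff.2 hz
  have h1z : ‖1 + z‖ ≤ 1 + ‖z‖ := by simpa using norm_add_le 1 z
  rw [norm_mul, norm_div]
  rcases le_total ‖z‖ R with h | h
  · have hconv : Real.exp ‖z‖ - 1 ≤ ‖z‖ / R * c := by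
      have h01 : 0 ≤ 1 - ‖z‖ / R := by rw [sub_nonneg, div_le_one hR0]; exact h
      have h02 : 0 ≤ ‖z‖ / R := by positivity
      have := convexOn_exp.2 (mem_univ (0 : ℝ)) (mem_univ R) h01 h02 (by ring)
      simp only [smul_eq_mul, mul_zero, zero_add, Real.exp_zero, hexpR] at this
      rw [div_mul_cancel₀ _ hR0.ne'] at this
      linarith
    calc ‖1 + z‖ / ‖z‖ * ‖1 - Complex.exp (-z)‖
        ≤ (1 + R) / ‖z‖ * (‖z‖ / R * c) :=
          mul_le_mul (div_le_div_of_nonneg_right (by linarith) hz0.le)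
            ((norm_exp_neg_sub_one_le z).trans hconv) (norm_nonneg _) (by positivity)
      _ = _ := by field_simp
  · refine mul_le_mul ?_ hp (norm_nonneg _) (by positivity)
    rw [div_le_div_iff₀ hz0 hR0]
    nlinarith

/-- On the positive real axis the constant is much smaller. -/
theorem one_add_div_mul_le {x : ℝ} (hx : 0 < x) : (1 + x) / x * (1 - Real.exp (-x)) ≤ 13 / 8 := by
  have hmul : (1 + x) * (1 - Real.exp (-x)) ≤ 13 / 8 * x := by
    have h0 := Real.exp_pos (-x)
    -- For `x ≥ 8/5` already `1 + x ≤ 13x/8`. Otherwise `exp(-x) ≥ (1 - 5x/8)(1 - 3x/8)` and `(1 +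
    -- x)(1 - 3x/8) ≥ 1`, whence `(1 + x) exp(-x) ≥ 1 - 5x/8`.
    rcases le_total (8 / 5) x with h | h
    · nlinarith
    · have h1 : 1 - 5 / 8 * x ≤ Real.exp (-(5 / 8 * x)) := by
        linarith [Real.add_one_le_exp (-(5 / 8 * x))]
      have h2 : 1 - 3 / 8 * x ≤ Real.exp (-(3 / 8 * x)) := by
        linarith [Real.add_one_le_exp (-(3 / 8 * x))]
      have h3 : Real.exp (-x) = Real.exp (-(5 / 8 * x)) * Real.exp (-(3 / 8 * x)) := by
        rw [← Real.exp_add]; ring_nf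
      have h4 : (1 - 5 / 8 * x) * (1 - 3 / 8 * x) ≤ Real.exp (-x) := by
        rw [h3]; exact mul_le_mul h1 h2 (by linarith) (Real.exp_pos _).le
      have h5 : 1 ≤ (1 + x) * (1 - 3 / 8 * x) := by nlinarith
      have h6 : 0 ≤ 1 - 5 / 8 * x := by linarith
      nlinarith [mul_le_mul_of_nonneg_left h4 (by linarith : 0 ≤ 1 + x),
        mul_le_mul_of_nonneg_left h5 h6]
  rw [div_mul_eq_mul_div, div_le_iff₀ hx]
  exact hmul

/-- The quotient is inverted so that the exponent `1 - α` is nonnegative. At `z = -1` both sides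
follow the conventions for division by zero and powers of `0`, giving `0` for `α < 1`. -/
theorem norm_E3 (α β : ℝ) (z : ℂ) :
    ‖E3 α β z‖ = ‖(1 + z) / z‖ ^ (1 - α) * ‖Complex.exp z‖ ^ (-β) := by
  unfold E3
  rw [norm_mul]
  congr 1
  · have : ((α : ℂ) - 1) = ((-(1 - α) : ℝ) : ℂ) := by push_cast; ring
    rw [this, Complex.norm_cpow_real, Real.rpow_neg (norm_nonneg _), ← Real.inv_rpow (norm_nonneg _),
      ← norm_inv, inv_div]
  · rw [Complex.norm_exp, Complex.norm_exp, ← Real.exp_mul]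
    congr 1
    simp [mul_comm]

/-- `P⁻¹` will be the logistic factor of `ψ'`. It is split as `|P⁻¹|^(1-α) |P|^(-α)`: the first part
pairs with `|(1+z)/z|^(1-α)`, the second supplies the decay on the left. -/
theorem weight_le {α β κ C a : ℝ} {z P : ℂ} (hα : 0 < α) (hα1 : α ≤ 1) (hβ : 0 < β)
    (hκ : 0 < κ) (h1 : (1 + Real.exp a) * κ ≤ ‖Complex.exp z‖)
    (h2 : (1 + Real.exp (-a)) * κ ≤ ‖P‖) (hC : ‖(1 + z) / z * P⁻¹‖ ≤ C) :
    ‖E3 α β z‖ * ‖P⁻¹‖ ≤ C ^ (1 - α) / κ ^ (α + β) *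
      ((1 + Real.exp a) ^ (-β) * (1 + Real.exp (-a)) ^ (-α)) := by
  have hP : 0 < ‖P‖ := lt_of_lt_of_le (by positivity) h2
  have e1 : ‖P⁻¹‖ = ‖P⁻¹‖ ^ (1 - α) * ‖P‖ ^ (-α) := by
    rw [norm_inv, Real.inv_rpow hP.le, ← Real.rpow_neg hP.le, ← Real.rpow_add hP,
      show -(1 - α) + -α = -1 by ring, Real.rpow_neg_one]
  rw [norm_E3, e1]
  have e2 : ‖(1 + z) / z‖ ^ (1 - α) * ‖P⁻¹‖ ^ (1 - α) ≤ C ^ (1 - α) := by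
    rw [← Real.mul_rpow (norm_nonneg _) (norm_nonneg _), ← norm_mul]
    exact Real.rpow_le_rpow (norm_nonneg _) hC (by linarith)
  have e3 : ‖Complex.exp z‖ ^ (-β) ≤ (1 + Real.exp a) ^ (-β) * κ ^ (-β) := by
    rw [← Real.mul_rpow (by positivity) hκ.le]
    exact Real.rpow_le_rpow_of_nonpos (by positivity) h1 (by linarith)
  have e4 : ‖P‖ ^ (-α) ≤ (1 + Real.exp (-a)) ^ (-α) * κ ^ (-α) := by
    rw [← Real.mul_rpow (by positivity) hκ.le]
    exact Real.rpow_le_rpow_of_nonpos (by positivity) h2 (by linarith)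
  have e5 : (κ ^ (α + β))⁻¹ = κ ^ (-α) * κ ^ (-β) := by
    rw [← Real.rpow_neg hκ.le, ← Real.rpow_add hκ]; congr 1; ring
  calc _ = (‖(1 + z) / z‖ ^ (1 - α) * ‖P⁻¹‖ ^ (1 - α)) * (‖Complex.exp z‖ ^ (-β) * ‖P‖ ^ (-α)) := by
        ring
    _ ≤ C ^ (1 - α) * (((1 + Real.exp a) ^ (-β) * κ ^ (-β)) *
          ((1 + Real.exp (-a)) ^ (-α) * κ ^ (-α))) := by
        have := Real.rpow_nonneg ((norm_nonneg _).trans hC) (1 - α)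
        gcongr
    _ = _ := by rw [div_eq_mul_inv, e5]; ring

theorem weight_real_le_neg {α β a : ℝ} (hα : 0 < α) (hβ : 0 < β) :
    (1 + Real.exp a) ^ (-β) * (1 + Real.exp (-a)) ^ (-α) ≤ Real.exp (α * a) := by
  have h1 : (1 + Real.exp a) ^ (-β) ≤ 1 :=
    Real.rpow_le_one_of_one_le_of_nonpos (by linarith [Real.exp_pos a]) (by linarith)
  have h2 : (1 + Real.exp (-a)) ^ (-α) ≤ Real.exp (-a) ^ (-α) :=
    Real.rpow_le_rpow_of_nonpos (Real.exp_pos _) (by linarith) (by linarith)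
  rw [← Real.exp_mul] at h2
  calc _ ≤ 1 * Real.exp (-a * -α) := mul_le_mul h1 h2 (by positivity) zero_le_one
    _ = _ := by rw [one_mul]; ring_nf

theorem weight_real_le_pos {α β a : ℝ} (hα : 0 < α) (hβ : 0 < β) :
    (1 + Real.exp a) ^ (-β) * (1 + Real.exp (-a)) ^ (-α) ≤ Real.exp (-(β * a)) := by
  have := weight_real_le_neg (a := -a) hβ hα
  rw [neg_neg] at this
  rw [mul_comm]
  refine this.trans (le_of_eq ?_)
  ring_nf

end SincDE

/-! ### The transformed integrand and its discretization error. -/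

namespace SincDE
open Filter Topology Set MeasureTheory

theorem abs_le_abs_sinh (t : ℝ) : |t| ≤ |Real.sinh t| := by
  rw [Real.abs_sinh]; exact Real.self_le_sinh_iff.2 (abs_nonneg _)

/-- A crude majorant that is integrable, tends to zero and is summable over the nodes. It comes from
`exp u ≥ u³/6` at `u = k(1 + |sinh t|)`, with `cosh t ≤ 1 + |sinh t|`. -/
theorem cosh_mul_exp_le {k : ℝ} (hk : 0 < k) (t : ℝ) :
    Real.cosh t * Real.exp (-(k * |Real.sinh t|)) ≤ 6 * Real.exp k / k ^ 3 * (1 + t ^ 2)⁻¹ := by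
  set s := |Real.sinh t| with hs
  have hs0 : 0 ≤ s := abs_nonneg _
  have hts : t ^ 2 ≤ s ^ 2 := sq_le_sq.2 (by rw [hs, abs_abs]; exact abs_le_abs_sinh t)
  have hcosh : Real.cosh t ≤ 1 + s := by
    refine le_of_sq_le_sq ?_ (by positivity)
    rw [Real.cosh_sq, ← sq_abs (Real.sinh t), ← hs]; nlinarith
  have h1 : (k * (1 + s)) ^ 3 / 6 ≤ Real.exp (k * (1 + s)) := by
    simpa [Nat.factorial] using Real.pow_div_factorial_le_exp (x := k * (1 + s)) (by positivity) 3
  have h2 : Real.exp (-(k * s)) = Real.exp k * (Real.exp (k * (1 + s)))⁻¹ := by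
    rw [← Real.exp_neg, ← Real.exp_add]; ring_nf
  have h3 : (Real.exp (k * (1 + s)))⁻¹ ≤ ((k * (1 + s)) ^ 3 / 6)⁻¹ := inv_anti₀ (by positivity) h1
  calc Real.cosh t * Real.exp (-(k * s))
      ≤ (1 + s) * (Real.exp k * ((k * (1 + s)) ^ 3 / 6)⁻¹) := by rw [h2]; gcongr
    _ = 6 * Real.exp k / k ^ 3 * ((1 + s) ^ 2)⁻¹ := by field_simp
    _ ≤ _ := by
        gcongr
        nlinarith

theorem tendsto_exp_neg_mul_sinh {k : ℝ} (hk : 0 < k) :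
    Tendsto (fun t => -(k⁻¹ * Real.exp (-(k * Real.sinh t)))) atTop (𝓝 0) := by
  have h0 : Tendsto Real.sinh atTop atTop := by
    refine tendsto_atTop_mono' _ ?_ tendsto_id
    filter_upwards [eventually_ge_atTop 0] with t ht using Real.self_le_sinh_iff.2 ht
  have h1 := Real.tendsto_exp_neg_atTop_nhds_zero.comp (h0.const_mul_atTop hk)
  simpa using (h1.const_mul k⁻¹).neg

theorem integral_cosh_mul_exp {k : ℝ} (hk : 0 < k) :
    ∫ t in Ioi (0 : ℝ), Real.cosh t * Real.exp (-(k * Real.sinh t)) = k⁻¹ := by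
  have := integral_Ioi_of_hasDerivAt_of_nonneg' (a := 0) (l := 0)
    (g := fun t => -(k⁻¹ * Real.exp (-(k * Real.sinh t))))
    (g' := fun t => Real.cosh t * Real.exp (-(k * Real.sinh t))) (fun t _ => by
      have h1 := (((Real.hasDerivAt_sinh t).const_mul k).neg.exp.const_mul k⁻¹).neg
      refine h1.congr_deriv ?_
      simp only [Pi.neg_apply]
      field_simp) (fun t _ => by positivity) (tendsto_exp_neg_mul_sinh hk)
  rw [this]; simp

theorem integral_cosh_mul_exp_abs {k : ℝ} (hk : 0 < k) :
    ∫ t : ℝ, Real.cosh t * Real.exp (-(k * |Real.sinh t|)) = 2 * k⁻¹ := by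
  have := integral_comp_abs (f := fun t => Real.cosh t * Real.exp (-(k * Real.sinh t)))
  simp only [Real.cosh_abs] at this
  simp_rw [Real.abs_sinh]
  rw [this, integral_cosh_mul_exp hk]

theorem integrable_cosh_mul_exp_abs {k : ℝ} (hk : 0 < k) :
    Integrable fun t : ℝ => Real.cosh t * Real.exp (-(k * |Real.sinh t|)) := by
  refine (integrable_inv_one_add_sq.const_mul (6 * Real.exp k / k ^ 3)).mono'
    (Continuous.aestronglyMeasurable ?_) (Eventually.of_forall fun t => ?_)
  · have := Real.continuous_cosh
    have := Real.continuous_sinh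
    fun_prop
  · rw [Real.norm_eq_abs, abs_of_pos (by positivity)]
    exact cosh_mul_exp_le hk t

theorem tendsto_inv_one_add_sq_atTop : Tendsto (fun t : ℝ => (1 + t ^ 2)⁻¹) atTop (𝓝 0) :=
  tendsto_inv_atTop_zero.comp (tendsto_atTop_add_const_left _ _ (tendsto_pow_atTop two_ne_zero))

theorem tendsto_inv_one_add_sq_atBot : Tendsto (fun t : ℝ => (1 + t ^ 2)⁻¹) atBot (𝓝 0) := by
  simpa [Function.comp_def] using tendsto_inv_one_add_sq_atTop.comp tendsto_neg_atBot_atTop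

theorem summable_inv_one_add_sq_nodes {h : ℝ} (hh : 0 < h) :
    Summable fun k : ℤ => (1 + ((k : ℝ) * h) ^ 2)⁻¹ := by
  have h1 : Summable fun k : ℤ => (h ^ 2)⁻¹ * (1 / (k : ℝ) ^ 2) :=
    (Real.summable_one_div_int_pow.2 one_lt_two).mul_left _
  refine Summable.of_norm_bounded_eventually h1 ?_
  refine (Set.finite_singleton (0 : ℤ)).subset fun k hk => ?_
  by_contra hk0
  refine hk ?_
  have : (k : ℝ) ≠ 0 := by exact_mod_cast hk0
  change ‖(1 + ((k : ℝ) * h) ^ 2)⁻¹‖ ≤ (h ^ 2)⁻¹ * (1 / (k : ℝ) ^ 2)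
  rw [Real.norm_eq_abs, abs_of_pos (by positivity), one_div, ← mul_inv]
  refine inv_anti₀ (by positivity) ?_
  nlinarith

/-- The integrand after the double-exponential change of variables, `f (ψ ζ) ψ' ζ`. -/
noncomputable def deF (f : ℂ → ℂ) (ζ : ℂ) : ℂ :=
  f (psi ζ) * (Real.pi * Complex.cosh ζ * (1 + Complex.exp (-(Real.pi * Complex.sinh ζ)))⁻¹)

theorem strip_mono {d d' : ℝ} (h : d ≤ d') : strip d ⊆ strip d' := fun _ hz => lt_of_lt_of_le hz h

theorem isOpen_strip (d : ℝ) : IsOpen (strip d) :=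
  isOpen_lt Complex.continuous_im.abs continuous_const

theorem one_add_exp_neg_ne_zero {ζ : ℂ} (h : ζ ∈ strip (Real.pi / 2)) :
    1 + Complex.exp (-(Real.pi * Complex.sinh ζ)) ≠ 0 := by
  have h1 := exp_psi h
  intro h0
  apply Complex.exp_ne_zero (psi ζ)
  have h2 : Complex.exp (Real.pi * Complex.sinh ζ) * Complex.exp (-(Real.pi * Complex.sinh ζ)) = 1 := by
    rw [← Complex.exp_add]; simp
  rw [h1]
  linear_combination Complex.exp (Real.pi * Complex.sinh ζ) * h0 - h2

/-- Identifies the logistic factor of `ψ'` with the factor `1 - exp(-z)`, `z = ψ(ζ)`, that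
compensates the singularity at `z = 0`. -/
theorem one_sub_exp_neg_psi {ζ : ℂ} (h : ζ ∈ strip (Real.pi / 2)) :
    1 - Complex.exp (-psi ζ) = (1 + Complex.exp (-(Real.pi * Complex.sinh ζ)))⁻¹ := by
  have h1 := exp_psi h
  have h2 : Complex.exp (Real.pi * Complex.sinh ζ) * Complex.exp (-(Real.pi * Complex.sinh ζ)) = 1 := by
    rw [← Complex.exp_add]; simp
  have h3 : Complex.exp (psi ζ) * Complex.exp (-psi ζ) = 1 := by rw [← Complex.exp_add]; simp
  rw [h1] at h3
  refine eq_inv_of_mul_eq_one_left ?_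
  set A := Complex.exp (Real.pi * Complex.sinh ζ)
  set B := Complex.exp (-(Real.pi * Complex.sinh ζ))
  linear_combination -B * h3 + Complex.exp (-psi ζ) * h2

theorem psi_ne_zero {ζ : ℂ} (h : ζ ∈ strip (Real.pi / 2)) : psi ζ ≠ 0 := by
  intro h0
  have h1 := exp_psi h
  rw [h0, Complex.exp_zero] at h1
  exact Complex.exp_ne_zero (Real.pi * Complex.sinh ζ) (by linear_combination -h1)

theorem norm_cosh_le (t y : ℝ) : ‖Complex.cosh (t + y * Complex.I)‖ ≤ Real.cosh t := by
  have e : Complex.cosh (t + y * Complex.I) = ((Real.cosh t * Real.cos y : ℝ) : ℂ) +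
      ((Real.sinh t * Real.sin y : ℝ) : ℂ) * Complex.I := by
    rw [Complex.cosh_add, Complex.sinh_mul_I, Complex.cosh_mul_I]; push_cast; ring
  refine le_of_sq_le_sq ?_ (Real.cosh_pos t).le
  rw [e, ← Complex.normSq_eq_norm_sq, Complex.normSq_add_mul_I]
  have h1 := Real.cosh_sq t
  have h2 := Real.sin_sq_add_cos_sq y
  nlinarith [sq_nonneg (Real.sin y)]

section
variable {d K α β : ℝ} {f : ℂ → ℂ}

theorem differentiableAt_deF (hd : d ≤ Real.pi / 2)
    (hf : AnalyticOnNhd ℂ f (psi '' strip d)) {ζ : ℂ} (hζ : ζ ∈ strip d) :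
    DifferentiableAt ℂ (deF f) ζ := by
  have hζ' := strip_mono hd hζ
  have h1 : DifferentiableAt ℂ psi ζ :=
    (differentiableOn_psi ζ hζ').differentiableAt ((isOpen_strip _).mem_nhds hζ')
  have h2 : DifferentiableAt ℂ f (psi ζ) := (hf _ (mem_image_of_mem _ hζ)).differentiableAt
  have h3 : DifferentiableAt ℂ (fun ζ => f (psi ζ)) ζ := h2.comp ζ h1
  refine h3.mul (DifferentiableAt.mul (by fun_prop) (DifferentiableAt.inv (by fun_prop)
    (one_add_exp_neg_ne_zero hζ')))

/-- The constants `κ` and `C` are left free because the estimate is used twice: with `kap D` and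
`cTilde D` in the strip, and with `1` and `13/8` on the real line. -/
theorem norm_deF_le (hd : d ≤ Real.pi / 2) (hK : 0 < K)
    (hα : 0 < α) (hα1 : α ≤ 1) (hβ : 0 < β)
    (hfE : ∀ z ∈ psi '' strip d, ‖f z‖ ≤ K * ‖E3 α β z‖) {κ C t y : ℝ} (hκ : 0 < κ)
    (hy : |y| < d)
    (h1 : (1 + Real.exp (Real.pi * (Real.sinh t * Real.cos y))) * κ ≤
      ‖1 + Complex.exp (Real.pi * Complex.sinh (t + y * Complex.I))‖)
    (h2 : (1 + Real.exp (-(Real.pi * (Real.sinh t * Real.cos y)))) * κ ≤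
      ‖1 + Complex.exp (-(Real.pi * Complex.sinh (t + y * Complex.I)))‖)
    (hC : ‖(1 + psi (t + y * Complex.I)) / psi (t + y * Complex.I) *
      (1 - Complex.exp (-psi (t + y * Complex.I)))‖ ≤ C) :
    ‖deF f (t + y * Complex.I)‖ ≤ K * (C ^ (1 - α) / κ ^ (α + β)) * (Real.pi * Real.cosh t *
      ((1 + Real.exp (Real.pi * (Real.sinh t * Real.cos y))) ^ (-β) *
        (1 + Real.exp (-(Real.pi * (Real.sinh t * Real.cos y)))) ^ (-α))) := by
  have hmem : (t + y * Complex.I : ℂ) ∈ strip d := by simpa [strip] using hy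
  have hmem' := strip_mono hd hmem
  set ζ : ℂ := t + y * Complex.I
  rw [one_sub_exp_neg_psi hmem'] at hC
  rw [← exp_psi hmem'] at h1
  have hw := weight_le hα hα1 hβ hκ h1 h2 hC
  have hf := hfE _ (mem_image_of_mem _ hmem)
  have hc : ‖Complex.cosh ζ‖ ≤ Real.cosh t := norm_cosh_le t y
  unfold deF
  rw [norm_mul, norm_mul, norm_mul, Complex.norm_real, Real.norm_eq_abs, abs_of_pos Real.pi_pos]
  calc _ ≤ (K * ‖E3 α β (psi ζ)‖) * (Real.pi * Real.cosh t *
        ‖(1 + Complex.exp (-(Real.pi * Complex.sinh ζ)))⁻¹‖) := by gcongr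
    _ = K * (Real.pi * Real.cosh t) * (‖E3 α β (psi ζ)‖ *
        ‖(1 + Complex.exp (-(Real.pi * Complex.sinh ζ)))⁻¹‖) := by ring
    _ ≤ K * (Real.pi * Real.cosh t) * _ := mul_le_mul_of_nonneg_left hw (by positivity)
    _ = _ := by ring

/-- The bound of the transformed integrand on horizontal lines. -/
theorem norm_deF_line_le (hd : d ≤ Real.pi / 2) (hK : 0 < K)
    (hα : 0 < α) (hα1 : α ≤ 1) (hβ : 0 < β)
    (hfE : ∀ z ∈ psi '' strip d, ‖f z‖ ≤ K * ‖E3 α β z‖) {D t y : ℝ} (hD : D < d)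
    (hy : |y| ≤ D) :
    ‖deF f (t + y * Complex.I)‖ ≤ K * (cTilde D ^ (1 - α) / kap D ^ (α + β)) * (Real.pi *
      (Real.cosh t * Real.exp (-(Real.pi * min α β * Real.cos D * |Real.sinh t|)))) := by
  have hD2 : D < Real.pi / 2 := by linarith
  have hD0 : 0 ≤ D := (abs_nonneg y).trans hy
  have hκ := kap_pos hD0 hD2
  obtain ⟨h1, h2⟩ := norm_one_add_exp_pi_sinh_ge (t := t) hy hD2
  have hmem' : (t + y * Complex.I : ℂ) ∈ strip (Real.pi / 2) := by
    have : |y| < Real.pi / 2 := by linarith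
    simpa [strip] using this
  have hcD : 0 < cD D := by
    have : 0 < 1 / kap D := by positivity
    unfold cD; unfold kap at this; linarith
  have hC : ‖(1 + psi (t + y * Complex.I)) / psi (t + y * Complex.I) *
      (1 - Complex.exp (-psi (t + y * Complex.I)))‖ ≤ cTilde D := by
    refine norm_one_add_div_mul_le hcD (psi_ne_zero hmem') ?_
    rw [one_sub_exp_neg_psi hmem', norm_inv]
    have : kap D ≤ ‖1 + Complex.exp (-(Real.pi * Complex.sinh (t + y * Complex.I)))‖ := by
      refine le_trans ?_ h2
      nlinarith [Real.exp_pos (-(Real.pi * (Real.sinh t * Real.cos y)))]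
    refine (inv_anti₀ hκ this).trans ?_
    unfold cD; unfold kap; rw [one_div]; linarith
  have main := norm_deF_le hd hK hα hα1 hβ hfE hκ (hy.trans_lt hD) h1 h2 hC
  have hcos : Real.cos D ≤ Real.cos y := by
    rw [← Real.cos_abs y]
    exact Real.cos_le_cos_of_nonneg_of_le_pi (abs_nonneg y) (by linarith) hy
  have hcosD : 0 < Real.cos D := Real.cos_pos_of_mem_Ioo ⟨by linarith, hD2⟩
  have hw : (1 + Real.exp (Real.pi * (Real.sinh t * Real.cos y))) ^ (-β) *
      (1 + Real.exp (-(Real.pi * (Real.sinh t * Real.cos y)))) ^ (-α) ≤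
      Real.exp (-(Real.pi * min α β * Real.cos D * |Real.sinh t|)) := by
    -- The decay rate is `β` on the right and `α` on the left; both are weakened to `min α β`, and
    -- `cos y` to `cos D`.
    rcases le_total 0 (Real.sinh t) with hs | hs
    · refine (weight_real_le_pos hα hβ).trans (Real.exp_le_exp.2 (neg_le_neg ?_))
      rw [abs_of_nonneg hs]
      calc Real.pi * min α β * Real.cos D * Real.sinh t
          ≤ Real.pi * β * Real.cos y * Real.sinh t := by
            gcongr
            exact min_le_right _ _
        _ = _ := by ring
    · refine (weight_real_le_neg hα hβ).trans (Real.exp_le_exp.2 ?_)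
      rw [abs_of_nonpos hs]
      have hs' : 0 ≤ -Real.sinh t := by linarith
      have : Real.pi * min α β * Real.cos D * (-Real.sinh t)
          ≤ Real.pi * α * Real.cos y * (-Real.sinh t) := by
            gcongr
            exact min_le_left _ _
      linarith
  refine main.trans ?_
  have hcT : 0 ≤ cTilde D := (norm_nonneg _).trans hC
  have := Real.rpow_nonneg hcT (1 - α)
  rw [mul_assoc Real.pi (Real.cosh t)]
  gcongr

/-- The bounds of the transformed integrand on the real line. -/
theorem norm_deF_real_le (hd0 : 0 < d) (hd : d ≤ Real.pi / 2) (hK : 0 < K)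
    (hα : 0 < α) (hα1 : α ≤ 1) (hβ : 0 < β)
    (hfE : ∀ z ∈ psi '' strip d, ‖f z‖ ≤ K * ‖E3 α β z‖) (t : ℝ) :
    ‖deF f t‖ ≤ K * (13 / 8) ^ (1 - α) *
      (Real.pi * Real.cosh t * Real.exp (-(Real.pi * β * Real.sinh t))) ∧
    ‖deF f t‖ ≤ K * (13 / 8) ^ (1 - α) *
      (Real.pi * Real.cosh t * Real.exp (-(Real.pi * α * Real.sinh (-t)))) := by
  obtain ⟨h1, h2⟩ := norm_one_add_exp_pi_sinh_ge (t := t) (y := 0) (D := 0) (by simp) (by linarith)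
  have hk : kap 0 = 1 := by simp [kap]
  rw [hk] at h1 h2
  have hC : ‖(1 + psi (t + (0 : ℝ) * Complex.I)) / psi (t + (0 : ℝ) * Complex.I) *
      (1 - Complex.exp (-psi (t + (0 : ℝ) * Complex.I)))‖ ≤ 13 / 8 := by
    have hx := psiReal_pos t
    have h3 := one_add_div_mul_le hx
    have e : psi (t + (0 : ℝ) * Complex.I) = (psiReal t : ℝ) := by simpa using psi_ofReal t
    rw [e]
    have e2 : (1 + (psiReal t : ℂ)) / (psiReal t : ℂ) * (1 - Complex.exp (-(psiReal t : ℂ))) =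
        (((1 + psiReal t) / psiReal t * (1 - Real.exp (-psiReal t)) : ℝ) : ℂ) := by push_cast; rfl
    rw [e2, Complex.norm_real, Real.norm_eq_abs, abs_of_nonneg]
    · exact h3
    · have : Real.exp (-psiReal t) ≤ 1 := Real.exp_le_one_iff.2 (by linarith)
      exact mul_nonneg (by positivity) (by linarith)
  have main := norm_deF_le hd hK hα hα1 hβ hfE one_pos (by simpa using hd0) h1 h2 hC
  simp only [Complex.ofReal_zero, zero_mul, add_zero, Real.one_rpow, div_one, Real.cos_zero,
    mul_one] at main
  have w1 := weight_real_le_pos (a := Real.pi * Real.sinh t) hα hβ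
  have w2 := weight_real_le_neg (a := Real.pi * Real.sinh t) hα hβ
  constructor <;> refine main.trans ?_
  · gcongr
    refine w1.trans (le_of_eq ?_)
    ring_nf
  · gcongr
    refine w2.trans (le_of_eq ?_)
    rw [Real.sinh_neg]
    ring_nf

theorem stripDecay_deF (hd : d ≤ Real.pi / 2) (hK : 0 < K)
    (hα : 0 < α) (hα1 : α ≤ 1) (hβ : 0 < β) (hf : AnalyticOnNhd ℂ f (psi '' strip d))
    (hfE : ∀ z ∈ psi '' strip d, ‖f z‖ ≤ K * ‖E3 α β z‖) {D : ℝ} (hD0 : 0 < D) (hD : D < d) :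
    ∃ C : ℝ, StripDecay (deF f) D fun t => C * (1 + t ^ 2)⁻¹ := by
  have hpi := Real.pi_pos
  have hcosD : 0 < Real.cos D := Real.cos_pos_of_mem_Ioo ⟨by linarith, by linarith⟩
  have hk : 0 < Real.pi * min α β * Real.cos D := by positivity
  set k := Real.pi * min α β * Real.cos D with hkdef
  set W := K * (cTilde D ^ (1 - α) / kap D ^ (α + β)) with hW
  have hW0 : 0 ≤ W := by
    have := (norm_nonneg _).trans
      (norm_deF_line_le hd hK hα hα1 hβ hfE (t := 0) (y := 0) hD (by simpa using hD0.le))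
    rw [← hW] at this
    exact nonneg_of_mul_nonneg_left this (by positivity)
  refine ⟨W * (Real.pi * (6 * Real.exp k / k ^ 3)), hD0, ?_, ?_, ?_, ?_, ?_⟩
  · intro z hz
    exact differentiableAt_deF hd hf (lt_of_le_of_lt hz hD)
  · intro t y hy
    refine (norm_deF_line_le hd hK hα hα1 hβ hfE hD hy).trans ?_
    refine (mul_le_mul_of_nonneg_left
      (mul_le_mul_of_nonneg_left (cosh_mul_exp_le hk t) hpi.le) hW0).trans (le_of_eq ?_)
    ring
  · exact integrable_inv_one_add_sq.const_mul _
  · simpa using tendsto_inv_one_add_sq_atTop.const_mul (W * (Real.pi * (6 * Real.exp k / k ^ 3)))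
  · simpa using tendsto_inv_one_add_sq_atBot.const_mul (W * (Real.pi * (6 * Real.exp k / k ^ 3)))

theorem integral_norm_deF_le (hd : d ≤ Real.pi / 2) (hK : 0 < K)
    (hα : 0 < α) (hα1 : α ≤ 1) (hβ : 0 < β)
    (hfE : ∀ z ∈ psi '' strip d, ‖f z‖ ≤ K * ‖E3 α β z‖) {D y : ℝ} (hD0 : 0 < D) (hD : D < d)
    (hy : |y| ≤ D) :
    ∫ t : ℝ, ‖deF f (t + y * Complex.I)‖ ≤
      2 * K / min α β * (cTilde D ^ (1 - α) / (kap D ^ (α + β) * Real.cos D)) := by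
  have hcosD : 0 < Real.cos D := Real.cos_pos_of_mem_Ioo ⟨by linarith, by linarith⟩
  have hk : 0 < Real.pi * min α β * Real.cos D := by positivity
  refine (integral_mono_of_nonneg (Eventually.of_forall fun _ => norm_nonneg _)
    (((integrable_cosh_mul_exp_abs hk).const_mul Real.pi).const_mul _)
    (Eventually.of_forall fun t => norm_deF_line_le hd hK hα hα1 hβ hfE hD hy)).trans (le_of_eq ?_)
  rw [MeasureTheory.integral_const_mul, MeasureTheory.integral_const_mul,
    integral_cosh_mul_exp_abs hk]
  field_simp

/-- The discretization error with the explicit constant. -/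
theorem discretization_error_deF (hd0 : 0 < d) (hd : d < Real.pi / 2) (hK : 0 < K)
    (hα : 0 < α) (hα1 : α ≤ 1) (hβ : 0 < β) (hf : AnalyticOnNhd ℂ f (psi '' strip d))
    (hfE : ∀ z ∈ psi '' strip d, ‖f z‖ ≤ K * ‖E3 α β z‖) {h : ℝ} (hh : 0 < h) (b : ℝ) :
    ‖(∫ x in Iic b, deF f (x : ℂ)) - ∑' k : ℤ, deF f ((k * h : ℝ) : ℂ) * ((J k h b : ℝ) : ℂ)‖ ≤
      2 * K / (min α β * d) * (cTilde d ^ (1 - α) / (kap d ^ (α + β) * Real.cos d)) *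
        (h * (Real.exp (-(Real.pi / h * d)) / (1 - Real.exp (-(2 * (Real.pi / h * d)))))) := by
  -- `f` is controlled only over the open strip, so the contours stay at `D < d`. The left side does
  -- not depend on `D`, and the right side is continuous at `d`.
  have key : ∀ D, 0 < D → D < d →
      ‖(∫ x in Iic b, deF f (x : ℂ)) - ∑' k : ℤ, deF f ((k * h : ℝ) : ℂ) * ((J k h b : ℝ) : ℂ)‖ ≤
      2 * K / (min α β * D) * (cTilde D ^ (1 - α) / (kap D ^ (α + β) * Real.cos D)) *
        (h * (Real.exp (-(Real.pi / h * D)) / (1 - Real.exp (-(2 * (Real.pi / h * D)))))) := by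
    intro D hD0 hD
    obtain ⟨C, H⟩ := stripDecay_deF hd.le hK hα hα1 hβ hf hfE hD0 hD
    have h1 := H.discretization_error hh ((summable_inv_one_add_sq_nodes hh).mul_left C) b
    have i1 := integral_norm_deF_le hd.le hK hα hα1 hβ hfE (y := -D) hD0 hD H.abs_neg_le
    have i2 := integral_norm_deF_le hd.le hK hα hα1 hβ hfE (y := D) hD0 hD H.abs_le
    have hpos2 : 0 < 1 - Real.exp (-(2 * (Real.pi / h * D))) := by
      rw [sub_pos, Real.exp_lt_one_iff]
      have : 0 < Real.pi / h * D := by positivity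
      linarith
    refine h1.trans ((mul_le_mul_of_nonneg_right (add_le_add i1 i2) (by positivity)).trans
      (le_of_eq ?_))
    field_simp
    ring
  have hk := kap_pos hd0.le hd
  have hcos : 0 < Real.cos d := Real.cos_pos_of_mem_Ioo ⟨by linarith, hd⟩
  have hpos2 : 0 < 1 - Real.exp (-(2 * (Real.pi / h * d))) := by
    rw [sub_pos, Real.exp_lt_one_iff]
    have : 0 < Real.pi / h * d := by positivity
    linarith
  have ckap : ContinuousAt kap d := by unfold kap; fun_prop
  have ccD : ContinuousAt cD d := by
    have h0 : Real.cos (Real.pi / 2 * Real.sin d) ≠ 0 := hk.ne'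
    unfold cD
    exact continuousAt_const.add (continuousAt_const.div (by fun_prop) h0)
  have hcD : 0 < cD d := by
    have : 0 < 1 / kap d := by positivity
    unfold cD; unfold kap at this; linarith
  have hlog : 0 < Real.log (1 + cD d) := Real.log_pos (by linarith)
  have clog : ContinuousAt (fun D => Real.log (1 + cD D)) d :=
    (continuousAt_const.add ccD).log (add_pos one_pos hcD).ne'
  have ccT : ContinuousAt cTilde d := by
    unfold cTilde
    exact ((continuousAt_const.add clog).div clog hlog.ne').mul ccD
  have hcT : 0 < cTilde d := by unfold cTilde; positivity
  have hcont : ContinuousAt (fun D => 2 * K / (min α β * D) *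
      (cTilde D ^ (1 - α) / (kap D ^ (α + β) * Real.cos D)) *
        (h * (Real.exp (-(Real.pi / h * D)) / (1 - Real.exp (-(2 * (Real.pi / h * D))))))) d := by
    refine ContinuousAt.mul (ContinuousAt.mul ?_ ?_) (ContinuousAt.mul continuousAt_const ?_)
    · exact continuousAt_const.div (by fun_prop) (by positivity)
    · exact (ccT.rpow_const (Or.inl hcT.ne')).div
        ((ckap.rpow_const (Or.inl hk.ne')).mul Real.continuous_cos.continuousAt) (by positivity)
    · exact ContinuousAt.div (by fun_prop) (by fun_prop) hpos2.ne'
  refine ge_of_tendsto (hcont.tendsto.mono_left (nhdsWithin_le_nhds (s := Iio d))) ?_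
  filter_upwards [self_mem_nhdsWithin, mem_nhdsWithin_of_mem_nhds (Ioi_mem_nhds hd0)] with D hD hD0
  exact key D hD0 hD

end
end SincDE

/-! ### The truncation error and its absorption into the constant. -/

namespace SincDE
open Filter Topology Set MeasureTheory

/-- By convexity of `exp`, the difference on the right is at least `exp(-πγ sinh x) πγ (sinh x -
sinh(x - h))`, and `sinh x - sinh(x - h)` exceeds `cosh x (1 - exp(-h))` by `exp(-x)(cosh h - 1) ≥
0`. No monotonicity of the summand enters. -/
theorem cosh_mul_exp_telescope {γ h : ℝ} (hγ : 0 < γ) (x : ℝ) :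
    Real.pi * Real.cosh x * Real.exp (-(Real.pi * γ * Real.sinh x)) * (γ * (1 - Real.exp (-h))) ≤
      Real.exp (-(Real.pi * γ * Real.sinh (x - h))) - Real.exp (-(Real.pi * γ * Real.sinh x)) := by
  have h1 : Real.cosh x * (1 - Real.exp (-h)) ≤ Real.sinh x - Real.sinh (x - h) := by
    have e1 : Real.sinh x - Real.sinh (x - h) - Real.cosh x * (1 - Real.exp (-h)) =
        Real.exp (-x) * (Real.cosh h - 1) := by
      rw [Real.sinh_sub, Real.cosh_eq h, Real.sinh_eq h, Real.cosh_eq x, Real.sinh_eq x]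
      ring
    have := Real.one_le_cosh h
    have h2 := mul_nonneg (Real.exp_pos (-x)).le (by linarith : 0 ≤ Real.cosh h - 1)
    linarith
  set E := Real.exp (-(Real.pi * γ * Real.sinh x))
  have hE : 0 < E := Real.exp_pos _
  have h2 : Real.exp (-(Real.pi * γ * Real.sinh (x - h))) =
      E * Real.exp (Real.pi * γ * (Real.sinh x - Real.sinh (x - h))) := by
    rw [← Real.exp_add]; ring_nf
  have h3 := Real.add_one_le_exp (Real.pi * γ * (Real.sinh x - Real.sinh (x - h)))
  have h4 : Real.pi * γ * (Real.cosh x * (1 - Real.exp (-h))) ≤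
      Real.pi * γ * (Real.sinh x - Real.sinh (x - h)) :=
    mul_le_mul_of_nonneg_left h1 (by positivity)
  rw [h2]
  have h5 : E * (Real.pi * γ * (Real.cosh x * (1 - Real.exp (-h)))) ≤
      E * (Real.exp (Real.pi * γ * (Real.sinh x - Real.sinh (x - h))) - 1) :=
    mul_le_mul_of_nonneg_left (by linarith) hE.le
  linarith

theorem sum_cosh_mul_exp_le {γ h : ℝ} (hγ : 0 < γ) (hh : 0 < h) (N : ℤ) (p : ℕ) :
    ∑ j ∈ Finset.range p, Real.pi * Real.cosh ((N + 1 + j) * h) *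
        Real.exp (-(Real.pi * γ * Real.sinh ((N + 1 + j) * h))) ≤
      Real.exp (-(Real.pi * γ * Real.sinh (N * h))) / (γ * (1 - Real.exp (-h))) := by
  have h0 : 0 < 1 - Real.exp (-h) := by
    rw [sub_pos, Real.exp_lt_one_iff]; linarith
  rw [le_div_iff₀ (by positivity), Finset.sum_mul]
  have key : ∀ j ∈ Finset.range p, Real.pi * Real.cosh ((N + 1 + j) * h) *
        Real.exp (-(Real.pi * γ * Real.sinh ((N + 1 + j) * h))) * (γ * (1 - Real.exp (-h))) ≤
      Real.exp (-(Real.pi * γ * Real.sinh ((N + (j : ℕ)) * h))) -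
        Real.exp (-(Real.pi * γ * Real.sinh ((N + ((j + 1 : ℕ) : ℝ)) * h))) := by
    intro j _
    refine (cosh_mul_exp_telescope hγ _).trans (le_of_eq ?_)
    push_cast
    ring_nf
  refine (Finset.sum_le_sum key).trans ?_
  rw [Finset.sum_range_sub']
  simp only [Nat.cast_zero, add_zero]
  linarith [Real.exp_pos (-(Real.pi * γ * Real.sinh ((N + (p : ℕ)) * h)))]

/-- A sum over the integers differs from a finite part by at most the two tails. -/
theorem norm_tsum_sub_sum_Icc_le {a : ℤ → ℂ} (ha : Summable a) {M N : ℤ} (hMN : -M ≤ N) {A B : ℝ}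
    (hA : ∀ p : ℕ, ∑ j ∈ Finset.range p, ‖a (N + 1 + j)‖ ≤ A)
    (hB : ∀ p : ℕ, ∑ j ∈ Finset.range p, ‖a (-(M + 1 + j))‖ ≤ B) :
    ‖∑' k, a k - ∑ k ∈ Finset.Icc (-M) N, a k‖ ≤ A + B := by
  have hfin : ∀ p : ℕ, ‖∑ k ∈ Finset.Icc (-(M + p)) (N + p), a k - ∑ k ∈ Finset.Icc (-M) N, a k‖ ≤
      ∑ j ∈ Finset.range p, (‖a (N + 1 + j)‖ + ‖a (-(M + 1 + j))‖) := by
    intro p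
    induction p with
    | zero => simp
    | succ p ih =>
      have hset : Finset.Icc (-(M + ((p + 1 : ℕ) : ℤ))) (N + ((p + 1 : ℕ) : ℤ)) =
          Finset.Icc (-(M + p)) (N + p) ∪ {N + 1 + (p : ℤ), -(M + 1 + (p : ℤ))} := by
        ext k
        simp only [Finset.mem_Icc, Finset.mem_union, Finset.mem_insert, Finset.mem_singleton]
        push_cast
        omega
      have hdisj : Disjoint (Finset.Icc (-(M + p)) (N + p))
          ({N + 1 + (p : ℤ), -(M + 1 + (p : ℤ))} : Finset ℤ) := by
        rw [Finset.disjoint_left]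
        intro k hk hk'
        simp only [Finset.mem_Icc, Finset.mem_insert, Finset.mem_singleton] at hk hk'
        omega
      rw [hset, Finset.sum_union hdisj, Finset.sum_pair (by omega), Finset.sum_range_succ,
        add_sub_right_comm]
      refine (norm_add_le _ _).trans (add_le_add ih (norm_add_le _ _))
  have ht : Tendsto (fun p : ℕ => Finset.Icc (-(M + (p : ℤ))) (N + p)) atTop atTop := by
    refine tendsto_atTop_finset_of_monotone (fun p q hpq => ?_) fun k => ⟨k.natAbs + M.natAbs + N.natAbs, ?_⟩
    · exact Finset.Icc_subset_Icc (by omega) (by omega)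
    · rw [Finset.mem_Icc]
      omega
  have hs : Tendsto (fun s : Finset ℤ => ∑ k ∈ s, a k) atTop (𝓝 (∑' k, a k)) := ha.hasSum
  have lim := ((hs.comp ht).sub_const (∑ k ∈ Finset.Icc (-M) N, a k)).norm
  refine le_of_tendsto lim (Eventually.of_forall fun p => (hfin p).trans ?_)
  rw [Finset.sum_add_distrib]
  exact add_le_add (hA p) (hB p)

section
variable {d K α β : ℝ} {f : ℂ → ℂ}

theorem truncation_error_deF (hd0 : 0 < d) (hd : d < Real.pi / 2) (hK : 0 < K)
    (hα : 0 < α) (hα1 : α ≤ 1) (hβ : 0 < β) (hf : AnalyticOnNhd ℂ f (psi '' strip d))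
    (hfE : ∀ z ∈ psi '' strip d, ‖f z‖ ≤ K * ‖E3 α β z‖) {h : ℝ} (hh : 0 < h) (b : ℝ)
    {M N : ℤ} (hMN : -M ≤ N) :
    ‖∑' k : ℤ, deF f ((k * h : ℝ) : ℂ) * ((J k h b : ℝ) : ℂ) -
      ∑ k ∈ Finset.Icc (-M) N, deF f ((k * h : ℝ) : ℂ) * ((J k h b : ℝ) : ℂ)‖ ≤
      K * (13 / 8) ^ (1 - α) * ((1 + (Real.pi⁻¹) ^ 2) * h) / (1 - Real.exp (-h)) *
        (Real.exp (-(Real.pi * β * Real.sinh (N * h))) / β +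
          Real.exp (-(Real.pi * α * Real.sinh (M * h))) / α) := by
  have h0 : 0 < 1 - Real.exp (-h) := by
    rw [sub_pos, Real.exp_lt_one_iff]; linarith
  obtain ⟨C, H⟩ := stripDecay_deF hd.le hK hα hα1 hβ hf hfE (half_pos hd0) (half_lt_self hd0)
  have hsum : Summable fun k : ℤ => deF f ((k * h : ℝ) : ℂ) * ((J k h b : ℝ) : ℂ) := by
    refine Summable.of_norm_bounded ((H.summable_nodes
      ((summable_inv_one_add_sq_nodes hh).mul_left C)).mul_right ((1 + (Real.pi⁻¹) ^ 2) * h))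
      fun k => ?_
    rw [norm_mul, Complex.norm_real]
    exact mul_le_mul_of_nonneg_left (abs_J_le k hh.le b) (norm_nonneg _)
  set W := K * (13 / 8) ^ (1 - α) * ((1 + (Real.pi⁻¹) ^ 2) * h) with hW
  have hW0 : 0 ≤ W := by positivity
  have hbound : ∀ (k : ℤ) (X : ℝ), ‖deF f ((k * h : ℝ) : ℂ)‖ ≤ K * (13 / 8) ^ (1 - α) * X →
      ‖deF f ((k * h : ℝ) : ℂ) * ((J k h b : ℝ) : ℂ)‖ ≤ W * X := by
    intro k X hX
    rw [norm_mul, Complex.norm_real]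
    calc _ ≤ (K * (13 / 8) ^ (1 - α) * X) * ((1 + (Real.pi⁻¹) ^ 2) * h) :=
          mul_le_mul hX (abs_J_le k hh.le b) (abs_nonneg _) ((norm_nonneg _).trans hX)
      _ = _ := by rw [hW]; ring
  refine (norm_tsum_sub_sum_Icc_le hsum hMN
    (A := W * (Real.exp (-(Real.pi * β * Real.sinh (N * h))) / (β * (1 - Real.exp (-h)))))
    (B := W * (Real.exp (-(Real.pi * α * Real.sinh (M * h))) / (α * (1 - Real.exp (-h)))))
    (fun p => ?_) (fun p => ?_)).trans (le_of_eq ?_)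
  · refine le_trans (Finset.sum_le_sum fun j _ => hbound _ _
      (norm_deF_real_le hd0 hd.le hK hα hα1 hβ hfE _).1) ?_
    rw [← Finset.mul_sum]
    refine mul_le_mul_of_nonneg_left ?_ hW0
    have := sum_cosh_mul_exp_le hβ hh N p
    push_cast
    exact this
  · refine le_trans (Finset.sum_le_sum fun j _ => hbound _ _
      (norm_deF_real_le hd0 hd.le hK hα hα1 hβ hfE _).2) ?_
    rw [← Finset.mul_sum]
    refine mul_le_mul_of_nonneg_left ?_ hW0
    have := sum_cosh_mul_exp_le hα hh M p
    push_cast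
    simp only [neg_mul, Real.cosh_neg, neg_neg]
    exact this
  · field_simp

end

/-- At `X = log(2y/γ)` one has `γ sinh X = y - γ²/(4y)`, and the correction is at most `γ/(2e)`
because `γe ≤ 2y`. -/
theorem exp_neg_sinh_le {γ y X : ℝ} (hγ : 0 < γ) (hy : γ * Real.exp 1 ≤ 2 * y)
    (hX : Real.log (2 * y / γ) ≤ X) :
    Real.exp (-(Real.pi * γ * Real.sinh X)) ≤
      Real.exp (-(Real.pi * y)) * Real.exp (Real.pi * γ / (2 * Real.exp 1)) := by
  have hpi := Real.pi_pos
  have he := Real.exp_pos 1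
  have hy0 : 0 < y := by nlinarith [mul_pos hγ he]
  rw [← Real.exp_add, Real.exp_le_exp]
  have h1 : Real.sinh (Real.log (2 * y / γ)) ≤ Real.sinh X := Real.sinh_le_sinh.2 hX
  rw [Real.sinh_log (by positivity)] at h1
  have h2 : γ ^ 2 / (4 * y) ≤ γ / (2 * Real.exp 1) := by
    rw [div_le_div_iff₀ (by positivity) (by positivity)]
    nlinarith
  have h3 : γ * ((2 * y / γ - (2 * y / γ)⁻¹) / 2) = y - γ ^ 2 / (4 * y) := by
    field_simp; ring
  have h4 : y - γ / (2 * Real.exp 1) ≤ γ * Real.sinh X := by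
    have := mul_le_mul_of_nonneg_left h1 hγ.le
    linarith
  have h5 := mul_le_mul_of_nonneg_left h4 hpi.le
  have h6 : Real.pi * γ / (2 * Real.exp 1) = Real.pi * (γ / (2 * Real.exp 1)) := by ring
  rw [h6]
  linarith

/-- Bernoulli's inequality for `exp(-L/n)^n` gives `n (1 - exp(-L/n)) ≥ 1 - exp(-L) ≥ 1 - exp(-1)`.
-/
theorem nodes_factor_le {d L : ℝ} {n : ℕ} (hd : 0 < d) (hn : 0 < n) (hL : 1 ≤ L) :
    d / (1 - Real.exp (-(L / n))) ≤ d * n / (1 - Real.exp (-1)) := by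
  have h0 : 0 < 1 - Real.exp (-(L / n)) := by
    rw [sub_pos, Real.exp_lt_one_iff, neg_lt_zero]; positivity
  have h1 : 0 < 1 - Real.exp (-1) := by
    rw [sub_pos, Real.exp_lt_one_iff]; norm_num
  have hb := one_add_mul_le_pow (a := Real.exp (-(L / n)) - 1)
    (by linarith [Real.exp_pos (-(L / n))]) n
  have e : (1 + (Real.exp (-(L / n)) - 1)) ^ n = Real.exp (-L) := by
    rw [add_sub_cancel, ← Real.exp_nat_mul]
    congr 1; field_simp
  rw [e] at hb
  have h2 : Real.exp (-L) ≤ Real.exp (-1) := Real.exp_le_exp.2 (by linarith)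
  rw [div_le_div_iff₀ h0 h1, mul_assoc]
  refine mul_le_mul_of_nonneg_left ?_ hd.le
  linarith

/-- The elementary inequality that absorbs the truncation error into the constant. -/
theorem truncation_numeric {α β μ y L : ℝ} (hα1 : α ≤ 1) (hβ : 0 < β) (hμα : μ ≤ α)
    (hy : 0 < y) (hL : 1 ≤ L) (hμ : μ = 2 * y * Real.exp (-L)) :
    (1 + (Real.pi⁻¹) ^ 2) * (13 / 8) ^ (1 - α) * (y / (1 - Real.exp (-1))) *
      Real.exp (-(Real.pi * y * (1 - 1 / L))) * Real.exp (Real.pi * (α + β) / (2 * Real.exp 1)) ≤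
      Real.exp (Real.pi * (1 + 5 * α + 6 * β) / 12) := by
  have hpi1 := Real.pi_gt_d2
  have hpi2 := Real.pi_lt_d2
  have he1 := Real.exp_one_gt_d9
  have he2 := Real.exp_one_lt_d9
  have hpi0 := Real.pi_pos
  have hα0 : 0 < α := lt_of_lt_of_le (by rw [hμ]; positivity) hμα
  have hinv : Real.exp (-1) ≤ 0.368 := by
    rw [Real.exp_neg]
    refine (inv_le_comm₀ (Real.exp_pos 1) (by norm_num)).2 (by norm_num; linarith)
  have hinv0 := Real.exp_pos (-1)
  have hpinv : (Real.pi⁻¹) ^ 2 ≤ 0.102 := by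
    have : Real.pi⁻¹ ≤ 0.3185 := (inv_le_comm₀ hpi0 (by norm_num)).2 (by norm_num; linarith)
    have h0 : 0 < Real.pi⁻¹ := by positivity
    nlinarith
  -- This is `e u ≤ exp u` at `u = 0.87 y`: the linear factor `y` is traded for `exp(0.87 y)`.
  have hyexp : 0.87 * 2.718 * y ≤ Real.exp (0.87 * y) := by
    have h1 := Real.add_one_le_exp (0.87 * y - 1)
    have h2 : Real.exp (0.87 * y) = Real.exp 1 * Real.exp (0.87 * y - 1) := by
      rw [← Real.exp_add]; ring_nf
    rw [h2]
    have h3 : 0.87 * y ≤ Real.exp (0.87 * y - 1) := by linarith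
    calc 0.87 * 2.718 * y = 2.718 * (0.87 * y) := by ring
      _ ≤ _ := mul_le_mul (by linarith) h3 (by positivity) (by positivity)
  have hconst : (1 + (Real.pi⁻¹) ^ 2) * (y / (1 - Real.exp (-1))) ≤
      Real.exp (Real.pi / 12 - 1 / 2) * Real.exp (0.87 * y) := by
    have h1 : y / (1 - Real.exp (-1)) ≤ y / 0.632 :=
      div_le_div_of_nonneg_left hy.le (by norm_num) (by linarith)
    have h2 : 0.76 ≤ Real.exp (Real.pi / 12 - 1 / 2) := by
      have := Real.add_one_le_exp (Real.pi / 12 - 1 / 2)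
      linarith
    calc (1 + (Real.pi⁻¹) ^ 2) * (y / (1 - Real.exp (-1))) ≤ 1.102 * (y / 0.632) :=
          mul_le_mul (by linarith) h1 (div_nonneg hy.le (by linarith)) (by norm_num)
      _ = 1.102 / 0.632 * y := by ring
      _ ≤ 0.76 * (0.87 * 2.718) * y := mul_le_mul_of_nonneg_right (by norm_num) hy.le
      _ = 0.76 * (0.87 * 2.718 * y) := by ring
      _ ≤ _ := mul_le_mul h2 hyexp (by positivity) (by positivity)
  have hpow : ((13 : ℝ) / 8) ^ (1 - α) ≤ Real.exp (1 / 2 * (1 - α)) := by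
    rw [Real.exp_mul]
    refine Real.rpow_le_rpow (by norm_num) ?_ (by linarith)
    have := Real.quadratic_le_exp_of_nonneg (x := 1 / 2) (by norm_num)
    linarith
  have hexpL : 0.3678 * (2 - L) ≤ Real.exp (-L) ∧ 0 < Real.exp (-L) := by
    refine ⟨?_, Real.exp_pos _⟩
    rcases le_total L 2 with h | h
    · have h1 := Real.add_one_le_exp (1 - L)
      have h2 : Real.exp (-L) = Real.exp (-1) * Real.exp (1 - L) := by
        rw [← Real.exp_add]; ring_nf
      have h3 : 0.3678 ≤ Real.exp (-1) := by
        rw [Real.exp_neg]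
        refine (le_inv_comm₀ (by norm_num) (Real.exp_pos 1)).2 (by norm_num; linarith)
      rw [h2]
      exact mul_le_mul h3 (by linarith) (by linarith) hinv0.le
    · nlinarith [Real.exp_pos (-L)]
  -- The cost `0.87 y` is paid by `πy(1 - 1/L)` unless `L` is near `1`. There the term `2.44 y
  -- exp(-L) = 1.22 μ ≤ 1.22 α` takes over, and it is charged to the allowance `5πα/12`.
  have hkey : 0.87 ≤ Real.pi * (1 - 1 / L) + 2.44 * Real.exp (-L) := by
    have hL0 : 0 < L := by linarith
    rcases le_total L 3 with h | h
    · have h1 : (L - 1) / 3 ≤ 1 - 1 / L := by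
        rw [div_le_iff₀ (by norm_num), ← sub_nonneg]
        have : (1 - 1 / L) * 3 - (L - 1) = (L - 1) * (3 - L) / L := by field_simp
        rw [this]
        exact div_nonneg (mul_nonneg (by linarith) (by linarith)) hL0.le
      nlinarith [hexpL.1]
    · have h1 : 2 / 3 ≤ 1 - 1 / L := by
        have : 1 / L ≤ 1 / 3 := one_div_le_one_div_of_le (by norm_num) h
        linarith
      nlinarith [hexpL.2]
  have hyk := mul_le_mul_of_nonneg_left hkey hy.le
  have hfrac : Real.pi * (α + β) / (2 * Real.exp 1) ≤ 0.184 * (Real.pi * (α + β)) := by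
    rw [div_le_iff₀ (by positivity)]
    have : 0 < Real.pi * (α + β) := by positivity
    nlinarith
  calc _ = ((1 + (Real.pi⁻¹) ^ 2) * (y / (1 - Real.exp (-1)))) * (13 / 8) ^ (1 - α) *
      Real.exp (-(Real.pi * y * (1 - 1 / L))) *
        Real.exp (Real.pi * (α + β) / (2 * Real.exp 1)) := by ring
    _ ≤ (Real.exp (Real.pi / 12 - 1 / 2) * Real.exp (0.87 * y)) * Real.exp (1 / 2 * (1 - α)) *
      Real.exp (-(Real.pi * y * (1 - 1 / L))) * Real.exp (0.184 * (Real.pi * (α + β))) := by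
        gcongr
    _ ≤ _ := by
        rw [← Real.exp_add, ← Real.exp_add, ← Real.exp_add, ← Real.exp_add, Real.exp_le_exp]
        -- The terms `±1/2` cancel. The coefficients of `α` compare as `1.22 - 0.5 + 0.184π ≤
        -- 5π/12`, those of `β` as `0.184π ≤ π/2`.
        nlinarith [mul_le_mul_of_nonneg_right hpi1.le hα0.le, mul_pos hpi0 hβ]

end SincDE

/-! ### Change of variables, truncation points and the final estimate. -/

namespace SincDE
open Filter Topology Set MeasureTheory

theorem hasDerivAt_psiReal (x : ℝ) :
    HasDerivAt psiReal (Real.pi * Real.cosh x * (1 + Real.exp (-(Real.pi * Real.sinh x)))⁻¹) x := by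
  have h1 := ((((Real.hasDerivAt_sinh x).const_mul Real.pi).exp).const_add 1).log
    (by positivity : 1 + Real.exp (Real.pi * Real.sinh x) ≠ 0)
  refine h1.congr_deriv ?_
  rw [Real.exp_neg]
  have := Real.exp_pos (Real.pi * Real.sinh x)
  field_simp
  ring

theorem deF_ofReal (f : ℂ → ℂ) (x : ℝ) :
    deF f x = f ((psiReal x : ℝ) : ℂ) * ((deriv psiReal x : ℝ) : ℂ) := by
  rw [(hasDerivAt_psiReal x).deriv, deF, psi_ofReal]
  push_cast
  rfl

theorem strictMono_psiReal : StrictMono psiReal :=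
  strictMono_of_deriv_pos fun x => by
    have := Real.pi_pos
    have := Real.cosh_pos x
    rw [(hasDerivAt_psiReal x).deriv]; positivity

theorem image_psiReal_Iic {τ : ℝ} (hτ : 0 < τ) : psiReal '' Iic (psiInv τ) = Ioc 0 τ := by
  ext t
  constructor
  · rintro ⟨x, hx, rfl⟩
    refine ⟨psiReal_pos x, ?_⟩
    rw [← psiReal_psiInv hτ]
    exact strictMono_psiReal.monotone hx
  · rintro ⟨h1, h2⟩
    refine ⟨psiInv t, ?_, psiReal_psiInv h1⟩
    rw [← psiReal_psiInv h1, ← psiReal_psiInv hτ] at h2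
    exact strictMono_psiReal.le_iff_le.1 h2

/-- Change of variables for the injective map `ψ`. Integrability of `f` near `0`, where it may be
unbounded, is inherited from that of `F`. -/
theorem integral_eq_integral_deF {f : ℂ → ℂ} (hF : Integrable fun x : ℝ => deF f x) {τ : ℝ}
    (hτ : 0 < τ) :
    IntervalIntegrable (fun t : ℝ => f (t : ℂ)) volume 0 τ ∧
      ∫ t in (0 : ℝ)..τ, f (t : ℂ) = ∫ x in Iic (psiInv τ), deF f x := by
  have e : ∀ x : ℝ, |Real.pi * Real.cosh x * (1 + Real.exp (-(Real.pi * Real.sinh x)))⁻¹| •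
      f ((psiReal x : ℝ) : ℂ) = deF f x := by
    intro x
    have := Real.pi_pos
    have := Real.cosh_pos x
    rw [abs_of_pos (by positivity), deF_ofReal, (hasDerivAt_psiReal x).deriv, Complex.real_smul,
      mul_comm]
  have hder : ∀ x ∈ Iic (psiInv τ), HasDerivWithinAt psiReal
      (Real.pi * Real.cosh x * (1 + Real.exp (-(Real.pi * Real.sinh x)))⁻¹) (Iic (psiInv τ)) x :=
    fun x _ => (hasDerivAt_psiReal x).hasDerivWithinAt
  have hinj : InjOn psiReal (Iic (psiInv τ)) := strictMono_psiReal.injective.injOn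
  constructor
  · rw [intervalIntegrable_iff_integrableOn_Ioc_of_le hτ.le, ← image_psiReal_Iic hτ,
      integrableOn_image_iff_integrableOn_abs_deriv_smul measurableSet_Iic hder hinj]
    simp_rw [e]
    exact hF.integrableOn
  · rw [intervalIntegral.integral_of_le hτ.le, ← image_psiReal_Iic hτ,
      integral_image_eq_integral_abs_deriv_smul measurableSet_Iic hder hinj]
    simp_rw [e]

/-- The truncation points lie beyond `log (2dn/α)` and `log (2dn/β)`. -/
theorem truncation_points {α β h c : ℝ} {n : ℕ} (hα : 0 < α) (hβ : 0 < β) (hh : 0 < h) (hc : 0 < c)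
    (hnh : n * h = Real.log (c / min α β)) :
    Real.log (c / α) ≤ lowerM α β h n * h ∧ Real.log (c / β) ≤ upperN α β h n * h := by
  unfold lowerM upperN
  split_ifs with hab
  · rw [min_eq_left hab] at hnh
    refine ⟨by push_cast; exact hnh.ge, ?_⟩
    -- Rounding down the amount subtracted from `n` can only move the truncation point outwards.
    have h1 : (⌊Real.log (β / α) / h⌋ : ℝ) * h ≤ Real.log (β / α) := by
      rw [← le_div_iff₀ hh]; exact Int.floor_le _
    push_cast
    rw [sub_mul, hnh]
    have h2 := Real.log_div hβ.ne' hα.ne'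
    rw [Real.log_div hc.ne' hα.ne', Real.log_div hc.ne' hβ.ne']
    linarith
  · rw [min_eq_right (not_le.1 hab).le] at hnh
    refine ⟨?_, by push_cast; exact hnh.ge⟩
    have h1 : (⌊Real.log (α / β) / h⌋ : ℝ) * h ≤ Real.log (α / β) := by
      rw [← le_div_iff₀ hh]; exact Int.floor_le _
    push_cast
    rw [sub_mul, hnh]
    have h2 := Real.log_div hα.ne' hβ.ne'
    rw [Real.log_div hc.ne' hα.ne', Real.log_div hc.ne' hβ.ne']
    linarith

theorem one_le_log_div {c γ : ℝ} (hγ : 0 < γ) (h : γ * Real.exp 1 ≤ c) : 1 ≤ Real.log (c / γ) := by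
  have hc : 0 < c := lt_of_lt_of_le (by positivity) h
  rw [Real.le_log_iff_exp_le (by positivity), le_div_iff₀ hγ]
  linarith

theorem truncation_le {d K α β L h : ℝ} {n : ℕ} {M N : ℤ} (hd : 0 < d) (hK : 0 < K) (hα : 0 < α)
    (hα1 : α ≤ 1) (hβ : 0 < β) (hn : 0 < n) (hαn : α * Real.exp 1 ≤ 2 * (d * n))
    (hβn : β * Real.exp 1 ≤ 2 * (d * n)) (hL : L = Real.log (2 * (d * n) / min α β))
    (hh : h = L / n) (hM : Real.log (2 * (d * n) / α) ≤ M * h)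
    (hN : Real.log (2 * (d * n) / β) ≤ N * h) :
    K * (13 / 8) ^ (1 - α) * ((1 + (Real.pi⁻¹) ^ 2) * h) / (1 - Real.exp (-h)) *
        (Real.exp (-(Real.pi * β * Real.sinh (N * h))) / β +
          Real.exp (-(Real.pi * α * Real.sinh (M * h))) / α) ≤
      2 * K / (min α β * d) * Real.exp (Real.pi * (1 + 5 * α + 6 * β) / 12) *
        (h * Real.exp (-(Real.pi / h * d))) := by
  set y := d * n with hy
  have hy0 : 0 < y := by positivity
  set μ := min α β with hμdef
  have hμ : 0 < μ := lt_min hα hβ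
  have hμα : μ ≤ α := min_le_left _ _
  have hμβ : μ ≤ β := min_le_right _ _
  have hL1 : 1 ≤ L := by
    rw [hL]
    exact one_le_log_div hμ ((mul_le_mul_of_nonneg_right hμα (Real.exp_pos 1).le).trans hαn)
  have hh0 : 0 < h := by rw [hh]; positivity
  have h0 : 0 < 1 - Real.exp (-h) := by
    rw [sub_pos, Real.exp_lt_one_iff]; linarith
  have hμy : μ = 2 * y * Real.exp (-L) := by
    rw [Real.exp_neg, hL, Real.exp_log (by positivity)]
    field_simp
  set Q := Real.exp (-(Real.pi * y)) * Real.exp (Real.pi * (α + β) / (2 * Real.exp 1)) with hQ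
  have tail : ∀ (γ : ℝ) (X : ℝ), 0 < γ → μ ≤ γ → γ ≤ α + β → γ * Real.exp 1 ≤ 2 * y →
      Real.log (2 * y / γ) ≤ X → Real.exp (-(Real.pi * γ * Real.sinh X)) / γ ≤ Q / μ := by
    intro γ X hγ hμγ hγs hγy hX
    refine div_le_div₀ (by positivity) ((exp_neg_sinh_le hγ hγy hX).trans ?_) hμ hμγ
    rw [hQ]
    gcongr
  have t1 := tail β (N * h) hβ hμβ (by linarith) hβn hN
  have t2 := tail α (M * h) hα hμα (by linarith) hαn hM
  have hfac := nodes_factor_le hd hn hL1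
  rw [← hh, ← hy] at hfac
  have hnum := truncation_numeric hα1 hβ hμα hy0 hL1 hμy
  -- As `πd/h = πy/L`, the tail size `exp(-πy)` is the target rate times the surplus `exp(-πy(1 -
  -- 1/L))`.
  have hexp : Real.exp (-(Real.pi * y)) =
      Real.exp (-(Real.pi * y * (1 - 1 / L))) * Real.exp (-(Real.pi / h * d)) := by
    rw [← Real.exp_add]
    congr 1
    rw [hh, hy]
    field_simp
    ring
  set P := K * (13 / 8) ^ (1 - α) * ((1 + (Real.pi⁻¹) ^ 2) * h) / (1 - Real.exp (-h)) with hP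
  have hP0 : 0 ≤ P := by positivity
  set G := Real.exp (-(Real.pi / h * d))
  set A := Real.exp (-(Real.pi * y * (1 - 1 / L)))
  set S := Real.exp (Real.pi * (α + β) / (2 * Real.exp 1))
  calc _ ≤ P * (Q / μ + Q / μ) := mul_le_mul_of_nonneg_left (add_le_add t1 t2) hP0
    _ = 2 * K / (μ * d) * ((1 + (Real.pi⁻¹) ^ 2) * (13 / 8) ^ (1 - α) *
          (d / (1 - Real.exp (-h))) * A * S) * (h * G) := by
        rw [hQ, hexp, hP]; field_simp; ring
    _ ≤ 2 * K / (μ * d) * ((1 + (Real.pi⁻¹) ^ 2) * (13 / 8) ^ (1 - α) *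
          (y / (1 - Real.exp (-1))) * A * S) * (h * G) := by gcongr
    _ ≤ _ := by gcongr

end SincDE

theorem theorem3p6 (d K α β μ ν h : ℝ) (n : ℕ) (M N : ℤ) (f : ℂ → ℂ)
    (hd : 0 < d) (hd' : d < Real.pi / 2) (hK : 0 < K) (hα : 0 < α) (hα1 : α ≤ 1) (hβ : 0 < β)
    (hf : AnalyticOnNhd ℂ f (SincDE.psi '' SincDE.strip d))
    (hfE : ∀ z ∈ SincDE.psi '' SincDE.strip d, ‖f z‖ ≤ K * ‖SincDE.E3 α β z‖)
    (hμ : μ = min α β) (hν : ν = max α β)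
    (hh : h = Real.log (2 * d * n / μ) / n)
    (hM : M = SincDE.lowerM α β h n) (hN : N = SincDE.upperN α β h n)
    (hn : ν * Real.exp 1 / (2 * d) ≤ n)
    (hMx : SincDE.xThreshold α ≤ M * h) (hNx : SincDE.xThreshold β ≤ N * h) :
    ∀ τ : ℝ, 0 < τ →
      IntervalIntegrable (fun t : ℝ => f (t : ℂ)) MeasureTheory.volume 0 τ ∧
      ‖(∫ t in (0 : ℝ)..τ, f (t : ℂ)) -
          ∑ k ∈ Finset.Icc (-M) N,
            f ((SincDE.psiReal (k * h) : ℝ) : ℂ) * ((deriv SincDE.psiReal (k * h) : ℝ) : ℂ) *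
              ((SincDE.J k h (SincDE.psiInv τ) : ℝ) : ℂ)‖
        ≤ SincDE.errConst d K α β * SincDE.epsDE d (2 * μ) n := by
  intro τ hτ
  have he := Real.exp_pos 1
  have hμ0 : 0 < μ := by rw [hμ]; exact lt_min hα hβ
  have hαν : α ≤ ν := by rw [hν]; exact le_max_left _ _
  have hβν : β ≤ ν := by rw [hν]; exact le_max_right _ _
  have hμα : μ ≤ α := by rw [hμ]; exact min_le_left _ _
  have hν0 : 0 < ν := hα.trans_le hαν
  have hn' : (0 : ℝ) < n := lt_of_lt_of_le (by positivity) hn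
  have hn0 : 0 < n := by exact_mod_cast hn'
  have hνn : ν * Real.exp 1 ≤ 2 * (d * n) := by
    rw [div_le_iff₀ (by positivity)] at hn; linarith
  have hαn : α * Real.exp 1 ≤ 2 * (d * n) := (mul_le_mul_of_nonneg_right hαν he.le).trans hνn
  have hβn : β * Real.exp 1 ≤ 2 * (d * n) := (mul_le_mul_of_nonneg_right hβν he.le).trans hνn
  have hμn : μ * Real.exp 1 ≤ 2 * (d * n) := (mul_le_mul_of_nonneg_right hμα he.le).trans hαn
  obtain ⟨L, hL⟩ : ∃ L, L = Real.log (2 * (d * n) / μ) := ⟨_, rfl⟩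
  have hhL : h = L / n := by rw [hh, hL, mul_assoc]
  have hL1 : 1 ≤ L := by rw [hL]; exact SincDE.one_le_log_div hμ0 hμn
  have hL0 : 0 < L := by linarith
  have hh0 : 0 < h := by rw [hhL]; positivity
  have hnh : n * h = Real.log (2 * (d * n) / min α β) := by
    rw [← hμ, ← hL, hhL]; field_simp
  obtain ⟨pM, pN⟩ := SincDE.truncation_points hα hβ hh0 (by positivity) hnh
  rw [← hM] at pM
  rw [← hN] at pN
  have hMpos : (0 : ℝ) < M := pos_of_mul_pos_left
    (lt_of_lt_of_le one_pos ((SincDE.one_le_log_div hα hαn).trans pM)) hh0.le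
  have hNpos : (0 : ℝ) < N := pos_of_mul_pos_left
    (lt_of_lt_of_le one_pos ((SincDE.one_le_log_div hβ hβn).trans pN)) hh0.le
  have hMN : -M ≤ N := by
    have h1 : (0 : ℤ) < M := by exact_mod_cast hMpos
    have h2 : (0 : ℤ) < N := by exact_mod_cast hNpos
    omega
  -- Only integrability on the real line is needed here; any width below `d` serves.
  obtain ⟨C, H⟩ := SincDE.stripDecay_deF hd'.le hK hα hα1 hβ hf hfE (half_pos hd) (half_lt_self hd)
  obtain ⟨hint, heq⟩ := SincDE.integral_eq_integral_deF H.integrable_real hτ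
  refine ⟨hint, ?_⟩
  have disc := SincDE.discretization_error_deF hd hd' hK hα hα1 hβ hf hfE hh0 (SincDE.psiInv τ)
  have trunc := SincDE.truncation_error_deF hd hd' hK hα hα1 hβ hf hfE hh0 (SincDE.psiInv τ) hMN
  have hcomb := norm_add_le_of_le disc (trunc.trans (SincDE.truncation_le hd hK hα hα1 hβ hn0 hαn
    hβn (by rw [hL, hμ]) hhL pM pN))
  rw [sub_add_sub_cancel, ← heq] at hcomb
  simp_rw [SincDE.deF_ofReal] at hcomb
  refine hcomb.trans ?_
  have hk : 0 < SincDE.kap d := SincDE.kap_pos hd.le hd'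
  have hcos : 0 < Real.cos d := Real.cos_pos_of_mem_Ioo ⟨by linarith, hd'⟩
  have hcD : 0 < SincDE.cD d := by
    have : 0 < 1 / SincDE.kap d := by positivity
    unfold SincDE.cD; unfold SincDE.kap at this; linarith
  have hcT : 0 < SincDE.cTilde d := by
    have : 0 < Real.log (1 + SincDE.cD d) := Real.log_pos (by linarith)
    unfold SincDE.cTilde; positivity
  -- `epsDE` contains `log(4dn/·)`, so the argument `2μ` produces the required `log(2dn/μ)`.
  have heps : SincDE.epsDE d (2 * μ) n = h * Real.exp (-(Real.pi / h * d)) := by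
    have e1 : 4 * d * n / (2 * μ) = 2 * (d * n) / μ := by field_simp; ring
    have e2 : -(Real.pi * d * n) / L = -(Real.pi / h * d) := by rw [hhL]; field_simp
    rw [SincDE.epsDE, e1, ← hL, e2, hhL]
    ring
  -- Since `2dn/μ = exp L ≥ e L`, the exponent `2πd/h = 2πdn/L` is at least `πμe`; this removes `n`
  -- from the denominator.
  have hden : 1 - Real.exp (-(Real.pi * μ * Real.exp 1)) ≤
      1 - Real.exp (-(2 * (Real.pi / h * d))) := by
    have h1 : Real.exp 1 * L ≤ 2 * (d * n) / μ := by
      have h2 : Real.exp L = 2 * (d * n) / μ := by rw [hL, Real.exp_log (by positivity)]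
      rw [← h2, show L = 1 + (L - 1) by ring, Real.exp_add]
      exact mul_le_mul_of_nonneg_left (by linarith [Real.add_one_le_exp (L - 1)]) he.le
    rw [le_div_iff₀ hμ0] at h1
    have h3 : Real.pi * μ * Real.exp 1 ≤ 2 * (Real.pi / h * d) := by
      have : 2 * (Real.pi / h * d) = Real.pi * (2 * (d * n)) / L := by rw [hhL]; field_simp
      rw [this, le_div_iff₀ hL0]
      nlinarith
    have := Real.exp_le_exp.2 (neg_le_neg h3)
    linarith
  have hden0 : 0 < 1 - Real.exp (-(Real.pi * μ * Real.exp 1)) := by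
    rw [sub_pos, Real.exp_lt_one_iff, neg_lt_zero]; positivity
  rw [heps, SincDE.errConst, ← hμ]
  change _ ≤ 2 * K / (μ * d) * (SincDE.cTilde d ^ (1 - α) /
    ((1 - Real.exp (-(Real.pi * μ * Real.exp 1))) * SincDE.kap d ^ (α + β) * Real.cos d) +
      Real.exp (Real.pi * (1 + 5 * α + 6 * β) / 12)) * (h * Real.exp (-(Real.pi / h * d)))
  have hsplit : ∀ a b c e : ℝ, a * (b + c) * e = a * b * e + a * c * e := fun a b c e => by ring
  rw [hsplit]
  refine add_le_add ?_ le_rfl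
  set E := Real.exp (-(Real.pi / h * d))
  calc _ ≤ 2 * K / (μ * d) * (SincDE.cTilde d ^ (1 - α) / (SincDE.kap d ^ (α + β) * Real.cos d)) *
        (h * (E / (1 - Real.exp (-(Real.pi * μ * Real.exp 1))))) := by gcongr
    _ = _ := by field_simp
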